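/- **Theorem.** Let $k,l\ge 1$ be integers, $\alpha,\beta\ge 0$ real numbers and $\sigma,\tau$ non-zero complex numbers. Put $$\tau_1=(2\pi i)^{l-k}\,\tau,\qquad \sigma_1=(-1)^{l-k}(2\pi i)^{l-k}\,\overline{\sigma},$$ and assume that $(k,l,\sigma,\tau)$ is elliptic, i.e. that neither of the polynomials $\xi^k-\sigma_1\eta^l$ and $\xi^k-\tau_1\eta^l$ has a real zero $(\xi,\eta)\in\mathbb{R}^2$ other than $(0,0)$. For complex-valued Schwartz functions $f,g$ on $\mathbb{R}^2$ put $$\langle f,g\rangle_{W_2^{\alpha,\beta}}=\int_{\mathbb{R}^2}\hat f(\xi,\eta)\,\overline{\hat g(\xi,\eta)}\,|\xi|^{2\alpha}|\eta|^{2\beta}\,d\xi\,d\eta,\qquad \hat f(\xi,\eta)=\int_{\mathbb{R}^2}f(x,y)\,e^{-2\pi i(x\xi+y\eta)}\,dx\,dy .$$ Then there is a constant $C$ such that $$\bigl|\langle f,g\rangle_{W_2^{\alpha,\beta}}\bigr|\le C\,\bigl\|(\partial_1^k-\tau\partial_2^l)f\bigr\|_{L_1(\mathbb{R}^2)}\,\bigl\|(\partial_1^k-\sigma\partial_2^l)g\bigr\|_{L_1(\mathbb{R}^2)}\qquad\text{for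 all Schwartz functions } f,g \text{ on } \mathbb{R}^2$$ if and only if the following three conditions hold: at least one of the numbers $k,l$ is odd; $\alpha=\frac{k-1}{2}$ and $\beta=\frac{l-1}{2}$; the imaginary parts of $\sigma_1$ and $\tau_1$ are non-zero and have the same sign. -/

import Mathlib

open scoped SchwartzMap FourierTransform LineDeriv ComplexConjugate

noncomputable section

namespace BilinearEmbedding

/-- The Euclidean plane. -/
abbrev Plane : Type := EuclideanSpace ℝ (Fin 2)

/-- The `j`-th standard unit vector of the plane. -/
def basisVec (j : Fin 2) : Plane := EuclideanSpace.single j 1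

/-- The differential operator `∂₁ ^ k - c ∂₂ ^ l` acting on Schwartz functions. -/
def diffOp (k l : ℕ) (c : ℂ) (f : 𝓢(Plane, ℂ)) : 𝓢(Plane, ℂ) :=
  ∂^{fun _ : Fin k => basisVec 0} f - c • ∂^{fun _ : Fin l => basisVec 1} f

/-- The `L₁` norm of a Schwartz function. -/
def normL1 (f : 𝓢(Plane, ℂ)) : ℝ := ∫ x, ‖f x‖

/-- The scalar product of the homogeneous anisotropic fractional Sobolev space `W₂^{α,β}`. The
Fourier transform is normalized by `𝓕 f ξ = ∫ x, exp (-2πi⟨x, ξ⟩) f x`. The integrand is absolutely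
integrable for nonnegative `α`, `β`. -/
def sobolevInner (α β : ℝ) (f g : 𝓢(Plane, ℂ)) : ℂ :=
  ∫ p : Plane, 𝓕 f p * conj (𝓕 g p) * ((|p 0| ^ (2 * α) * |p 1| ^ (2 * β) : ℝ) : ℂ)

/-- The bilinear inequality, with a constant uniform in the Schwartz functions `f` and `g`. -/
def BE (k l : ℕ) (α β : ℝ) (σ τ : ℂ) : Prop :=
  ∃ C : ℝ, ∀ f g : 𝓢(Plane, ℂ),
    ‖sobolevInner α β f g‖ ≤ C * (normL1 (diffOp k l τ f) * normL1 (diffOp k l σ g))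

/-- `τ₁ = (2πi)^(l-k) τ`, with an integer exponent. -/
def tauOne (k l : ℕ) (τ : ℂ) : ℂ :=
  (2 * (Real.pi : ℂ) * Complex.I) ^ ((l : ℤ) - (k : ℤ)) * τ

/-- `σ₁ = (-1)^(l-k) (2πi)^(l-k) conj σ`, with integer exponents. -/
def sigmaOne (k l : ℕ) (σ : ℂ) : ℂ :=
  (-1 : ℂ) ^ ((l : ℤ) - (k : ℤ)) *
    (2 * (Real.pi : ℂ) * Complex.I) ^ ((l : ℤ) - (k : ℤ)) * conj σ

/-- The polynomial `ξ ^ k - c η ^ l` has no real zeros `(ξ, η)` except `(0, 0)`. -/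
def NoRealRoots (k l : ℕ) (c : ℂ) : Prop :=
  ∀ ξ η : ℝ, (ξ : ℂ) ^ k - c * (η : ℂ) ^ l = 0 → ξ = 0 ∧ η = 0

/-- Ellipticity of `(k, l, σ, τ)`. -/
def Elliptic (k l : ℕ) (σ τ : ℂ) : Prop :=
  NoRealRoots k l (sigmaOne k l σ) ∧ NoRealRoots k l (tauOne k l τ)

end BilinearEmbedding

end

namespace BilinearEmbedding

open MeasureTheory Set Filter Topology

/-! ### Integrals over the half-line -/

/-! Write $F=(\partial_1^k-\tau\partial_2^l)f$ and $G=(\partial_1^k-\sigma\partial_2^l)g$. On the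
Fourier side the scalar product is $(2\pi)^{-2k}\int\hat F\,\overline{\hat G}\,m$ with
$m=|\xi|^{2\alpha}|\eta|^{2\beta}/((\xi^k-\tau_1\eta^l)(\xi^k-\sigma_1\eta^l))$. The inequality thus
amounts to a uniform bound for the Fourier transforms of suitable truncations of $m$.

Testing on the dilations $(r^l\xi,r^k\eta)$ of one function forces the critical homogeneity
$l(2\alpha+1)+k(2\beta+1)=2kl$ (`BE.homogeneity`). In the coordinates $\xi=\pm r^{l/k}t$, $\eta=\pm
r$ the measure $m\,d\xi\,d\eta$ then becomes $\frac{dr}{r}$ times a profile in $t$ for each quadrant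
(`integral_mul_multiplier`), and everything depends on the sum of the four profile integrals,
`multiplierMean`.

If the mean is not zero, functions with $\hat f=$ cutoff/symbol keep the right-hand side bounded
while the left-hand side grows like a logarithm (`BE.multiplierMean_eq_zero`). If it is zero and
$\alpha=\frac{k-1}2$, $\beta=\frac{l-1}2$, the Fourier transform of the profile is its value at $0$
cut off to $|z|\le1$, up to an error integrable against $dr/r$. The cut-off parts combine, by
cancellation of the mean, into Dirichlet integrals $\int\sin(\omega r)\frac{dr}r$, which are
uniformly bounded (`exists_norm_kernel_le`).

It remains to see when the mean vanishes (`multiplierMean_eq_zero_iff`). The substitution $u=t^k$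
gives $S(c,d)=\int_0^\infty u^s/((u+c)(u+d))\,du$ with $s=(2\alpha+1)/k-1\in(-1,1)$, and
$(d-c)S(c,d)=A\,(P(d)-P(c))$, where $P$ is a primitive of $z^{s-1}$ and $A\ne0$. If $k,l$ are both
even, the mean is a multiple of a single $S$, nonzero because $P$ is injective on the slit plane.
Otherwise it is a multiple of $S(-a,-b)+S(a,b)$. For $a,b$ in the same half-plane this vanishes only
for $s=0$, that is $\alpha=\frac{k-1}2$; for $a,b$ in opposite half-planes it never does. -/

theorem integrableOn_rpow_mul_one_add_rpow {p q : ℝ} (hp : -1 < p) (hq : p + q < -1) :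
    IntegrableOn (fun t : ℝ => t ^ p * (1 + t) ^ q) (Ioi 0) := by
  have hmeas : Measurable (fun t : ℝ => t ^ p * (1 + t) ^ q) := by fun_prop
  rw [← Ioc_union_Ioi_eq_Ioi (zero_le_one' ℝ)]
  refine IntegrableOn.union ?_ ?_
  -- The sign of `q` is arbitrary, so on each piece the bounded factor is dominated by `2 ^ |q|`.
  · have h1 : IntegrableOn (fun t : ℝ => t ^ p * (2 : ℝ) ^ |q|) (Ioc 0 1) :=
      ((intervalIntegral.intervalIntegrable_rpow' (a := 0) (b := 1) hp).1).mul_const _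
    refine Integrable.mono' h1 hmeas.aestronglyMeasurable ?_
    refine (ae_restrict_iff' measurableSet_Ioc).2 (ae_of_all _ fun t ht => ?_)
    have h0 : (0 : ℝ) < 1 + t := by linarith [ht.1]
    rw [Real.norm_of_nonneg (mul_nonneg (Real.rpow_nonneg ht.1.le _) (Real.rpow_nonneg h0.le _))]
    refine mul_le_mul_of_nonneg_left ?_ (Real.rpow_nonneg ht.1.le _)
    calc (1 + t) ^ q ≤ (1 + t) ^ |q| :=
          Real.rpow_le_rpow_of_exponent_le (by linarith [ht.1]) (le_abs_self q)
      _ ≤ 2 ^ |q| := Real.rpow_le_rpow h0.le (by linarith [ht.2]) (abs_nonneg q)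
  · have h1 : IntegrableOn (fun t : ℝ => t ^ (p + q) * (2 : ℝ) ^ |q|) (Ioi 1) :=
      (integrableOn_Ioi_rpow_of_lt hq one_pos).mul_const _
    refine Integrable.mono' h1 hmeas.aestronglyMeasurable ?_
    refine (ae_restrict_iff' measurableSet_Ioi).2 (ae_of_all _ fun t ht => ?_)
    have ht1 : (1 : ℝ) < t := ht
    have ht0 : (0 : ℝ) < t := by linarith
    have h0 : (0 : ℝ) < 1 + t := by linarith
    rw [Real.norm_of_nonneg (mul_nonneg (Real.rpow_nonneg ht0.le _) (Real.rpow_nonneg h0.le _)),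
      Real.rpow_add ht0, mul_assoc]
    refine mul_le_mul_of_nonneg_left ?_ (Real.rpow_nonneg ht0.le _)
    have h2 : (1 + t) ^ q = t ^ q * (1 + t⁻¹) ^ q := by
      rw [← Real.mul_rpow ht0.le (by positivity)]
      congr 1
      field_simp
      ring
    rw [h2]
    refine mul_le_mul_of_nonneg_left ?_ (Real.rpow_nonneg ht0.le _)
    have h3 : (1 : ℝ) ≤ 1 + t⁻¹ := by have := inv_pos.2 ht0; linarith
    calc (1 + t⁻¹) ^ q ≤ (1 + t⁻¹) ^ |q| :=
          Real.rpow_le_rpow_of_exponent_le h3 (le_abs_self q)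
      _ ≤ 2 ^ |q| := Real.rpow_le_rpow (by linarith)
          (by have := inv_le_one_of_one_le₀ ht1.le; linarith) (abs_nonneg q)

section ScaleInvariance

variable {E : Type*} [NormedAddCommGroup E] [NormedSpace ℝ E]

theorem integral_inv_smul_comp_mul (φ : ℝ → E) {c : ℝ} (hc : 0 < c) :
    ∫ r in Ioi (0 : ℝ), r⁻¹ • φ (c * r) = ∫ s in Ioi (0 : ℝ), s⁻¹ • φ s := by
  have h := integral_comp_mul_left_Ioi (fun s => s⁻¹ • φ s) 0 hc
  rw [mul_zero] at h
  have h2 : ∀ r : ℝ, (c * r)⁻¹ • φ (c * r) = c⁻¹ • (r⁻¹ • φ (c * r)) := fun r => by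
    rw [smul_smul, mul_inv]
  simp_rw [h2, integral_smul] at h
  exact smul_right_injective E (inv_ne_zero hc.ne') h

theorem integral_inv_smul_comp_rpow (φ : ℝ → E) {p : ℝ} (hp : 0 < p) :
    ∫ r in Ioi (0 : ℝ), r⁻¹ • φ (r ^ p) = p⁻¹ • ∫ s in Ioi (0 : ℝ), s⁻¹ • φ s := by
  have h := integral_comp_rpow_Ioi_of_pos (g := fun s => s⁻¹ • φ s) hp
  rw [← h, ← integral_smul]
  refine setIntegral_congr_fun measurableSet_Ioi fun r hr => ?_
  have hr : 0 < r := hr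
  simp only [smul_smul]
  congr 1
  rw [Real.rpow_sub_one hr.ne']
  have := (Real.rpow_pos_of_pos hr p).ne'
  field_simp

/-- The measure `dr / r` on the half-line is invariant, up to a factor, under `r ↦ c * r ^ p`. -/
theorem integral_inv_smul_comp_mul_rpow (φ : ℝ → E) {c p : ℝ} (hc : 0 < c) (hp : 0 < p) :
    ∫ r in Ioi (0 : ℝ), r⁻¹ • φ (c * r ^ p) = p⁻¹ • ∫ s in Ioi (0 : ℝ), s⁻¹ • φ s := by
  rw [integral_inv_smul_comp_rpow (fun s => φ (c * s)) hp, integral_inv_smul_comp_mul φ hc]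

theorem integrableOn_inv_smul_comp_mul_rpow {φ : ℝ → E} {c p : ℝ} (hc : 0 < c) (hp : 0 < p)
    (h : IntegrableOn (fun s : ℝ => s⁻¹ • φ s) (Ioi 0)) :
    IntegrableOn (fun r : ℝ => r⁻¹ • φ (c * r ^ p)) (Ioi 0) := by
  have h1 : IntegrableOn (fun s : ℝ => (c * s)⁻¹ • φ (c * s)) (Ioi 0) := by
    have := integrableOn_Ioi_comp_mul_left_iff (fun s => s⁻¹ • φ s) 0 hc
    rw [mul_zero] at this
    exact this.2 h
  have h2 := (integrableOn_Ioi_comp_rpow_iff' (fun s => (c * s)⁻¹ • φ (c * s)) hp.ne').2 h1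
  have h3 : IntegrableOn (fun r : ℝ => c • (r ^ (p - 1) • (c * r ^ p)⁻¹ • φ (c * r ^ p))) (Ioi 0) :=
    h2.smul c
  refine h3.congr_fun (fun r hr => ?_) measurableSet_Ioi
  have hr : 0 < r := hr
  simp only [smul_smul]
  congr 1
  rw [Real.rpow_sub_one hr.ne']
  have := (Real.rpow_pos_of_pos hr p).ne'
  field_simp

end ScaleInvariance

/-! ### The integrals `∫ u ^ s / ((u + c) (u + d))` -/

/-- Off the cut, `u + c` stays away from zero and grows like `u`. This lower bound supplies every
domination used for the denominators. -/
theorem exists_mul_one_add_le_norm_add {c : ℂ} (hc : c ∈ Complex.slitPlane) :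
    ∃ κ : ℝ, 0 < κ ∧ ∀ u : ℝ, 0 ≤ u → κ * (1 + u) ≤ ‖(u : ℂ) + c‖ := by
  rcases hc with h | h
  · refine ⟨min 1 c.re, lt_min one_pos h, fun u hu => ?_⟩
    have h1 : u + c.re ≤ ‖(u : ℂ) + c‖ := by
      simpa using Complex.re_le_norm ((u : ℂ) + c)
    have h2 := min_le_left 1 c.re
    have h3 := min_le_right 1 c.re
    nlinarith
  · have him : 0 < |c.im| := abs_pos.2 h
    -- The constant comes from `1 + u ≤ (1 + ‖c‖) + ‖u + c‖`, with the first summand estimated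
    -- through `|c.im| ≤ ‖u + c‖`.
    refine ⟨((1 + ‖c‖) / |c.im| + 1)⁻¹, by positivity, fun u hu => ?_⟩
    have h1 : |c.im| ≤ ‖(u : ℂ) + c‖ := by
      simpa using Complex.abs_im_le_norm ((u : ℂ) + c)
    have h2 : u ≤ ‖(u : ℂ) + c‖ + ‖c‖ := by
      have := norm_sub_le ((u : ℂ) + c) c
      simpa [abs_of_nonneg hu] using this
    have h3 : 1 + ‖c‖ ≤ (1 + ‖c‖) / |c.im| * ‖(u : ℂ) + c‖ := by
      rw [div_mul_eq_mul_div, le_div_iff₀ him]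
      exact mul_le_mul_of_nonneg_left h1 (by positivity)
    rw [inv_mul_le_iff₀ (by positivity)]
    linarith

/-- The local uniformity in the parameter allows differentiation under the integral sign. -/
theorem exists_mul_one_add_le_norm_add_of_mem_ball {c : ℂ} (hc : c ∈ Complex.slitPlane) :
    ∃ κ : ℝ, 0 < κ ∧ ∀ c' ∈ Metric.ball c κ, ∀ u : ℝ, 0 ≤ u → κ * (1 + u) ≤ ‖(u : ℂ) + c'‖ := by
  obtain ⟨κ, hκ, h⟩ := exists_mul_one_add_le_norm_add hc
  refine ⟨κ / 2, by positivity, fun c' hc' u hu => ?_⟩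
  have h1 := h u hu
  have h2 : ‖(u : ℂ) + c‖ ≤ ‖(u : ℂ) + c'‖ + ‖c' - c‖ := by
    have := norm_sub_le ((u : ℂ) + c') (c' - c)
    rwa [show (u : ℂ) + c' - (c' - c) = u + c by ring] at this
  have h3 : ‖c' - c‖ < κ / 2 := by rwa [← dist_eq_norm]
  nlinarith

theorem ofReal_add_ne_zero {c : ℂ} (hc : c ∈ Complex.slitPlane) {u : ℝ} (hu : 0 ≤ u) :
    (u : ℂ) + c ≠ 0 := by
  obtain ⟨κ, hκ, h⟩ := exists_mul_one_add_le_norm_add hc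
  have := h u hu
  intro h0
  rw [h0, norm_zero] at this
  nlinarith

/-- `∫ u ^ s / ((u + c) (u + d))` over the half-line. -/
noncomputable def stieltjes (s : ℝ) (c d : ℂ) : ℂ :=
  ∫ u in Ioi (0 : ℝ), ((u ^ s : ℝ) : ℂ) * (((u : ℂ) + c) * ((u : ℂ) + d))⁻¹

theorem integrableOn_stieltjes {s : ℝ} (hs : -1 < s) (hs1 : s < 1) {c d : ℂ}
    (hc : c ∈ Complex.slitPlane) (hd : d ∈ Complex.slitPlane) :
    IntegrableOn (fun u : ℝ => ((u ^ s : ℝ) : ℂ) * (((u : ℂ) + c) * ((u : ℂ) + d))⁻¹) (Ioi 0) := by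
  obtain ⟨κ, hκ, h⟩ := exists_mul_one_add_le_norm_add hc
  obtain ⟨κ', hκ', h'⟩ := exists_mul_one_add_le_norm_add hd
  have hi : IntegrableOn (fun u : ℝ => (κ * κ')⁻¹ * (u ^ s * (1 + u) ^ (-2 : ℝ))) (Ioi 0) :=
    (integrableOn_rpow_mul_one_add_rpow hs (by linarith)).const_mul _
  refine Integrable.mono' hi (by fun_prop) ?_
  refine (ae_restrict_iff' measurableSet_Ioi).2 (ae_of_all _ fun u hu => ?_)
  have hu : 0 < u := hu
  have h1 := h u hu.le
  have h2 := h' u hu.le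
  rw [norm_mul, Complex.norm_real, Real.norm_of_nonneg (Real.rpow_nonneg hu.le _), norm_inv,
    norm_mul, mul_left_comm]
  refine mul_le_mul_of_nonneg_left ?_ (Real.rpow_nonneg hu.le _)
  have h3 : (1 + u) ^ (-2 : ℝ) = ((1 + u) ^ 2)⁻¹ := by
    rw [Real.rpow_neg (by linarith)]; norm_cast
  rw [h3, ← mul_inv]
  refine inv_anti₀ (by positivity) ?_
  calc κ * κ' * (1 + u) ^ 2 = (κ * (1 + u)) * (κ' * (1 + u)) := by ring
    _ ≤ _ := mul_le_mul h1 h2 (by positivity) (norm_nonneg _)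

/-- Partial fractions: $(d-z)/((u+z)(u+d))=1/(u+z)-1/(u+d)$, so the factor $d-z$ makes the
derivative in $z$ independent of $d$. -/
theorem hasDerivAt_mul_stieltjes {s : ℝ} (hs : -1 < s) (hs1 : s < 1) {c d : ℂ}
    (hc : c ∈ Complex.slitPlane) (hd : d ∈ Complex.slitPlane) :
    HasDerivAt (fun z => (d - z) * stieltjes s z d) (-stieltjes s c c) c := by
  obtain ⟨κ, hκ, h⟩ := exists_mul_one_add_le_norm_add_of_mem_ball hc
  -- A point `c'` of the ball on the cut would make `u + c'` vanish at `u = -c'.re ≥ 0`, against the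
  -- lower bound.
  have hball : Metric.ball c κ ⊆ Complex.slitPlane := by
    intro c' hc'
    by_contra hn
    rw [Complex.mem_slitPlane_iff_not_le_zero, not_not, Complex.le_def] at hn
    have := h c' hc' (-c'.re) (by simpa using hn.1)
    have h0 : ((-c'.re : ℝ) : ℂ) + c' = 0 := by
      apply Complex.ext <;> simp [hn.2]
    rw [h0, norm_zero] at this
    have h1 : c'.re ≤ 0 := by simpa using hn.1
    nlinarith
  set F : ℂ → ℝ → ℂ := fun z u =>
    (d - z) * (((u ^ s : ℝ) : ℂ) * (((u : ℂ) + z) * ((u : ℂ) + d))⁻¹) with hF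
  set F' : ℂ → ℝ → ℂ := fun z u =>
    -(((u ^ s : ℝ) : ℂ) * (((u : ℂ) + z) * ((u : ℂ) + z))⁻¹) with hF'
  have hbound : IntegrableOn (fun u : ℝ => (κ * κ)⁻¹ * (u ^ s * (1 + u) ^ (-2 : ℝ))) (Ioi 0) :=
    (integrableOn_rpow_mul_one_add_rpow hs (by linarith)).const_mul _
  have key := hasDerivAt_integral_of_dominated_loc_of_deriv_le (F := F) (F' := F') (x₀ := c)
    (μ := volume.restrict (Ioi (0 : ℝ))) (Metric.ball_mem_nhds c hκ)
    (Eventually.of_forall fun z => by simp only [hF]; fun_prop)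
    ((integrableOn_stieltjes hs hs1 hc hd).const_mul _)
    (by simp only [hF']; fun_prop)
    ((ae_restrict_iff' measurableSet_Ioi).2 (ae_of_all _ fun u hu z hz => ?_)) hbound
    ((ae_restrict_iff' measurableSet_Ioi).2 (ae_of_all _ fun u hu z hz => ?_))
  · have h2 := key.2
    simp only [hF, hF', integral_const_mul, integral_neg] at h2
    exact h2
  · have hu : 0 < u := hu
    have h1 := h z hz u hu.le
    simp only [hF', norm_neg]
    rw [norm_mul, Complex.norm_real, Real.norm_of_nonneg (Real.rpow_nonneg hu.le _), norm_inv,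
      norm_mul, mul_left_comm]
    refine mul_le_mul_of_nonneg_left ?_ (Real.rpow_nonneg hu.le _)
    have h3 : (1 + u) ^ (-2 : ℝ) = ((1 + u) ^ 2)⁻¹ := by
      rw [Real.rpow_neg (by linarith)]; norm_cast
    rw [h3, ← mul_inv]
    refine inv_anti₀ (by positivity) ?_
    calc κ * κ * (1 + u) ^ 2 = (κ * (1 + u)) * (κ * (1 + u)) := by ring
      _ ≤ _ := mul_le_mul h1 h1 (by positivity) (norm_nonneg _)
  · have hu : 0 < u := hu
    have hz0 := ofReal_add_ne_zero (hball hz) hu.le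
    have hd0 := ofReal_add_ne_zero hd hu.le
    have h1 : HasDerivAt (fun z : ℂ => (u : ℂ) + z) 1 z := (hasDerivAt_id z).const_add _
    have h2 := ((hasDerivAt_id z).const_sub d).mul
      (((h1.mul_const ((u : ℂ) + d)).inv (mul_ne_zero hz0 hd0)).const_mul ((u ^ s : ℝ) : ℂ))
    refine h2.congr_deriv ?_
    simp only [hF', id, Pi.inv_apply]
    field_simp
    ring

/-- The value of this constant is never needed, only that it is not zero. -/
theorem stieltjes_self_one_pos {s : ℝ} (hs : -1 < s) (hs1 : s < 1) :
    ∃ A : ℝ, 0 < A ∧ stieltjes s 1 1 = A := by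
  have h1 : ∀ u : ℝ, ((u ^ s : ℝ) : ℂ) * (((u : ℂ) + 1) * ((u : ℂ) + 1))⁻¹ =
      ((u ^ s * ((u + 1) * (u + 1))⁻¹ : ℝ) : ℂ) := fun u => by push_cast; rfl
  refine ⟨∫ u in Ioi (0 : ℝ), u ^ s * ((u + 1) * (u + 1))⁻¹, ?_, ?_⟩
  · have hint := integrableOn_stieltjes hs hs1 (c := 1) (d := 1) (by simp) (by simp)
    simp_rw [h1] at hint
    have hint' := hint.re
    simp only [RCLike.re_to_complex, Complex.ofReal_re] at hint'
    rw [setIntegral_pos_iff_support_of_nonneg_ae _ hint']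
    · have : Ioi (0 : ℝ) ⊆
          (Function.support fun u : ℝ => u ^ s * ((u + 1) * (u + 1))⁻¹) ∩ Ioi 0 := by
        intro u hu
        have hu' : 0 < u := hu
        refine ⟨?_, hu⟩
        have := Real.rpow_pos_of_pos hu' s
        simp only [Function.mem_support]
        positivity
      exact lt_of_lt_of_le (by simp) (measure_mono this)
    · refine (ae_restrict_iff' measurableSet_Ioi).2 (ae_of_all _ fun u hu => ?_)
      have hu : 0 < u := hu
      have := Real.rpow_pos_of_pos hu s
      simp only [Pi.zero_apply]
      positivity
  · rw [stieltjes]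
    simp_rw [h1]
    exact integral_ofReal

theorem stieltjes_self_ofReal (s : ℝ) {r : ℝ} (hr : 0 < r) :
    stieltjes s r r = ((r ^ (s - 1) : ℝ) : ℂ) * stieltjes s 1 1 := by
  have h := integral_comp_mul_left_Ioi
    (fun u : ℝ => ((u ^ s : ℝ) : ℂ) * (((u : ℂ) + r) * ((u : ℂ) + r))⁻¹) 0 hr
  rw [mul_zero] at h
  have h2 : ∀ u ∈ Ioi (0 : ℝ), (((r * u) ^ s : ℝ) : ℂ) *
      ((((r * u : ℝ) : ℂ) + r) * (((r * u : ℝ) : ℂ) + r))⁻¹ =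
      ((r ^ (s - 2) : ℝ) : ℂ) * (((u ^ s : ℝ) : ℂ) * (((u : ℂ) + 1) * ((u : ℂ) + 1))⁻¹) := by
    intro u hu
    have hu : 0 < u := hu
    rw [Real.mul_rpow hr.le hu.le, Real.rpow_sub hr]
    have hr' : (r : ℂ) ≠ 0 := by exact_mod_cast hr.ne'
    have h3 : (u : ℂ) + 1 ≠ 0 := by exact_mod_cast (by positivity : u + 1 ≠ 0)
    have h4 : (r : ℂ) * u + r ≠ 0 := by
      rw [show (r : ℂ) * u + r = r * (u + 1) by ring]
      exact mul_ne_zero hr' h3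
    push_cast
    field_simp
    norm_num
  rw [setIntegral_congr_fun measurableSet_Ioi h2, integral_const_mul] at h
  have hr' : (r : ℂ) ≠ 0 := by exact_mod_cast hr.ne'
  rw [stieltjes, stieltjes]
  have h5 : ((r ^ (s - 1) : ℝ) : ℂ) = r * ((r ^ (s - 2) : ℝ) : ℂ) := by
    have : r ^ (s - 1) = r * r ^ (s - 2) := by
      rw [show s - 1 = 1 + (s - 2) by ring, Real.rpow_add hr, Real.rpow_one]
    rw [this]; push_cast; rfl
  rw [h5, mul_assoc, h, Complex.real_smul]
  push_cast
  field_simp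

/-- Analytic continuation: both sides are holomorphic on the slit plane and agree on the positive
half-line by scaling. -/
theorem stieltjes_self {s : ℝ} (hs : -1 < s) (hs1 : s < 1) {c : ℂ} (hc : c ∈ Complex.slitPlane) :
    stieltjes s c c = c ^ ((s : ℂ) - 1) * stieltjes s 1 1 := by
  have hQ : DifferentiableOn ℂ (fun z => (1 - z) * stieltjes s z 1) Complex.slitPlane :=
    fun z hz => (hasDerivAt_mul_stieltjes hs hs1 hz
      (by simp)).differentiableAt.differentiableWithinAt
  -- The diagonal is minus the derivative of the holomorphic function `(1 - z) * stieltjes s z 1`.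
  have hD : DifferentiableOn ℂ (fun z => stieltjes s z z) Complex.slitPlane := by
    refine ((hQ.deriv Complex.isOpen_slitPlane).neg).congr fun z hz => ?_
    rw [Pi.neg_apply, (hasDerivAt_mul_stieltjes hs hs1 hz (by simp)).deriv, neg_neg]
  have hP : DifferentiableOn ℂ (fun z : ℂ => z ^ ((s : ℂ) - 1) * stieltjes s 1 1)
      Complex.slitPlane := fun z hz =>
    ((differentiableAt_id.cpow_const hz).mul_const _).differentiableWithinAt
  have hpre : IsPreconnected Complex.slitPlane :=
    (Complex.starConvex_one_slitPlane.isPathConnected (by simp)).isConnected.isPreconnected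
  refine (hD.analyticOnNhd Complex.isOpen_slitPlane).eqOn_of_preconnected_of_frequently_eq
    (hP.analyticOnNhd Complex.isOpen_slitPlane) hpre (z₀ := 1) (by simp) ?_ hc
  have ht : Tendsto (fun n : ℕ => ((1 + 1 / ((n : ℝ) + 1) : ℝ) : ℂ)) atTop (𝓝[≠] 1) := by
    refine tendsto_nhdsWithin_iff.2 ⟨?_, Eventually.of_forall fun n => ?_⟩
    · have := (tendsto_one_div_add_atTop_nhds_zero_nat (𝕜 := ℝ)).const_add 1
      rw [add_zero] at this
      have h2 := (Complex.continuous_ofReal.tendsto (1 : ℝ)).comp this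
      rw [Complex.ofReal_one] at h2
      exact h2
    · have : (0 : ℝ) < 1 / ((n : ℝ) + 1) := by positivity
      simp only [mem_compl_iff, mem_singleton_iff]
      intro h
      have : (1 + 1 / ((n : ℝ) + 1) : ℝ) = 1 := by exact_mod_cast h
      linarith
  refine ht.frequently (Frequently.of_forall fun n => ?_)
  have hpos : (0 : ℝ) < 1 + 1 / ((n : ℝ) + 1) := by positivity
  rw [stieltjes_self_ofReal s hpos, Complex.ofReal_cpow hpos.le]
  push_cast
  rfl

/-- A primitive of `z ^ (s - 1)` on the slit plane. -/
noncomputable def powPrimitive (s : ℝ) (z : ℂ) : ℂ :=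
  if s = 0 then Complex.log z else z ^ (s : ℂ) / s

theorem hasDerivAt_powPrimitive (s : ℝ) {z : ℂ} (hz : z ∈ Complex.slitPlane) :
    HasDerivAt (powPrimitive s) (z ^ ((s : ℂ) - 1)) z := by
  by_cases h : s = 0
  · have : powPrimitive s = Complex.log := by ext; simp [powPrimitive, h]
    rw [this, h]
    refine (Complex.hasDerivAt_log hz).congr_deriv ?_
    simp [Complex.cpow_neg_one]
  · have : powPrimitive s = fun z : ℂ => z ^ (s : ℂ) / s := by ext; simp [powPrimitive, h]
    rw [this]
    have h0 : (s : ℂ) ≠ 0 := by exact_mod_cast h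
    refine (((hasDerivAt_id z).cpow_const hz).div_const (s : ℂ)).congr_deriv ?_
    simp only [id]
    field_simp

/-- As functions of `c` both sides have derivative $-A c^{s-1}$ on the connected slit plane, where
$A$ is `stieltjes s 1 1`, and both vanish at `c = d`. -/
theorem mul_stieltjes {s : ℝ} (hs : -1 < s) (hs1 : s < 1) {c d : ℂ}
    (hc : c ∈ Complex.slitPlane) (hd : d ∈ Complex.slitPlane) :
    (d - c) * stieltjes s c d = stieltjes s 1 1 * (powPrimitive s d - powPrimitive s c) := by
  have hpre : IsPreconnected Complex.slitPlane :=
    (Complex.starConvex_one_slitPlane.isPathConnected (by simp)).isConnected.isPreconnected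
  have h : ∀ z ∈ Complex.slitPlane, HasDerivAt
      (fun z => (d - z) * stieltjes s z d + stieltjes s 1 1 * powPrimitive s z) 0 z := fun z hz => by
    refine ((hasDerivAt_mul_stieltjes hs hs1 hz hd).add
      ((hasDerivAt_powPrimitive s hz).const_mul _)).congr_deriv ?_
    rw [stieltjes_self hs hs1 hz]
    ring
  have h2 := Complex.isOpen_slitPlane.is_const_of_deriv_eq_zero hpre
    (fun z hz => (h z hz).differentiableAt.differentiableWithinAt) (fun z hz => (h z hz).deriv) hc hd
  simp only [sub_self, zero_mul, zero_add] at h2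
  linear_combination h2

/-- Equal powers have exponents $s\log c$ and $s\log d$ differing by $2\pi i n$. Since $|s|<1$ and
the arguments differ by less than $2\pi$, $n=0$. -/
theorem cpow_injOn_slitPlane {s : ℝ} (hs : -1 < s) (hs1 : s < 1) (h0 : s ≠ 0) :
    InjOn (fun z : ℂ => z ^ (s : ℂ)) Complex.slitPlane := by
  intro c hc d hd h
  have hc0 := Complex.slitPlane_ne_zero hc
  have hd0 := Complex.slitPlane_ne_zero hd
  simp only [Complex.cpow_def_of_ne_zero hc0, Complex.cpow_def_of_ne_zero hd0] at h
  obtain ⟨n, hn⟩ := Complex.exp_eq_exp_iff_exists_int.1 h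
  have him := congrArg Complex.im hn
  simp only [Complex.mul_im, Complex.add_im, Complex.log_im, Complex.log_re, Complex.ofReal_re,
    Complex.ofReal_im, mul_zero, zero_add, add_zero, Complex.intCast_re, Complex.intCast_im,
    Complex.I_re, Complex.I_im, zero_mul, mul_one, Complex.mul_re, sub_zero, Complex.re_ofNat,
    Complex.im_ofNat] at him
  have h1 := Complex.arg_le_pi c
  have h2 := Complex.neg_pi_lt_arg c
  have h3 := Complex.arg_le_pi d
  have h4 := Complex.neg_pi_lt_arg d
  have hπ := Real.pi_pos
  have hlt : |(c.arg - d.arg) * s| < 2 * Real.pi := by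
    have e1 : |c.arg - d.arg| < 2 * Real.pi := by rw [abs_lt]; constructor <;> linarith
    have e2 : |s| < 1 := abs_lt.2 ⟨hs, hs1⟩
    rw [abs_mul]
    nlinarith [abs_nonneg s, abs_nonneg (c.arg - d.arg)]
  have hn0 : n = 0 := by
    have e3 : (c.arg - d.arg) * s = n * (2 * Real.pi) := by linarith
    rw [e3, abs_mul, abs_of_pos (by linarith : 0 < 2 * Real.pi)] at hlt
    have e4 : |(n : ℝ)| < 1 := by
      by_contra hge
      push Not at hge
      nlinarith
    have e5 : |n| < 1 := by exact_mod_cast e4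
    exact Int.abs_lt_one_iff.1 e5
  rw [hn0] at hn
  have hs0 : (s : ℂ) ≠ 0 := by exact_mod_cast h0
  have hlog : Complex.log c = Complex.log d := by
    refine mul_right_cancel₀ hs0 ?_
    simpa using hn
  rw [← Complex.exp_log hc0, hlog, Complex.exp_log hd0]

theorem powPrimitive_injOn {s : ℝ} (hs : -1 < s) (hs1 : s < 1) :
    InjOn (powPrimitive s) Complex.slitPlane := by
  intro c hc d hd h
  by_cases h0 : s = 0
  · simp only [powPrimitive, h0, if_true] at h
    rw [← Complex.exp_log (Complex.slitPlane_ne_zero hc), h,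
      Complex.exp_log (Complex.slitPlane_ne_zero hd)]
  · simp only [powPrimitive, h0, if_false] at h
    have hs0 : (s : ℂ) ≠ 0 := by exact_mod_cast h0
    exact cpow_injOn_slitPlane hs hs1 h0 hc hd ((div_left_inj' hs0).1 h)

theorem stieltjes_one_one_ne_zero {s : ℝ} (hs : -1 < s) (hs1 : s < 1) : stieltjes s 1 1 ≠ 0 := by
  obtain ⟨A, hA, h⟩ := stieltjes_self_one_pos hs hs1
  rw [h]
  exact_mod_cast hA.ne'

/-- For `c ≠ d` this is the injectivity of the primitive; on the diagonal it is the explicit power.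
It rules out the case of even `k` and `l`. -/
theorem stieltjes_ne_zero {s : ℝ} (hs : -1 < s) (hs1 : s < 1) {c d : ℂ}
    (hc : c ∈ Complex.slitPlane) (hd : d ∈ Complex.slitPlane) : stieltjes s c d ≠ 0 := by
  have hA := stieltjes_one_one_ne_zero hs hs1
  by_cases hcd : c = d
  · rw [← hcd, stieltjes_self hs hs1 hc]
    refine mul_ne_zero ?_ hA
    rw [Complex.cpow_def_of_ne_zero (Complex.slitPlane_ne_zero hc)]
    exact Complex.exp_ne_zero _
  · intro h
    have h2 := mul_stieltjes hs hs1 hc hd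
    rw [h, mul_zero, eq_comm, mul_eq_zero, or_iff_right hA, sub_eq_zero] at h2
    exact hcd (powPrimitive_injOn hs hs1 hd hc h2).symm

/-- Raising to the power `s` contracts the argument, so the right half-plane is mapped into itself.
-/
theorem cpow_re_pos {s : ℝ} (hs : -1 < s) (hs1 : s < 1) {w : ℂ} (hw : 0 < w.re) :
    0 < (w ^ (s : ℂ)).re := by
  have hw0 : w ≠ 0 := by rintro rfl; simp at hw
  rw [Complex.cpow_def_of_ne_zero hw0, Complex.exp_re]
  refine mul_pos (Real.exp_pos _) (Real.cos_pos_of_mem_Ioo ?_)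
  have h1 : |w.arg| < Real.pi / 2 := Complex.abs_arg_lt_pi_div_two_iff.2 (Or.inl hw)
  have h2 : (Complex.log w * (s : ℂ)).im = w.arg * s := by
    simp [Complex.mul_im, Complex.log_im]
  rw [h2, mem_Ioo, ← abs_lt, abs_mul]
  have h3 : |s| < 1 := abs_lt.2 ⟨hs, hs1⟩
  nlinarith [abs_nonneg s, abs_nonneg w.arg]

/-- Rotating the upper half-plane by $-\pi/2$ does not cross the cut of the logarithm. -/
theorem log_neg_I_mul {z : ℂ} (hz : 0 < z.im) :
    Complex.log (-Complex.I * z) = Complex.log z - Real.pi / 2 * Complex.I := by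
  have hz0 : z ≠ 0 := by rintro rfl; simp at hz
  have h1 := Complex.arg_lt_pi_iff.2 (Or.inr hz.ne')
  have h2 := (Complex.arg_nonneg_iff.2 hz.le)
  have hI : Complex.log (-Complex.I) = -(Real.pi / 2) * Complex.I := Complex.log_neg_I
  rw [Complex.log_mul (by simp) hz0, hI]
  · ring
  · rw [Complex.arg_neg_I]
    constructor <;> linarith [Real.pi_pos]

theorem log_neg_of_im_pos {z : ℂ} (hz : 0 < z.im) :
    Complex.log (-z) = Complex.log z - Real.pi * Complex.I := by
  apply Complex.ext
  · simp [Complex.log_re]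
  · simp [Complex.log_im, Complex.arg_neg_eq_arg_sub_pi_of_im_pos hz]

/-- The ratio `sin (π s / 2) / s`, extended by continuity. -/
noncomputable def sinRatio (s : ℝ) : ℝ :=
  if s = 0 then Real.pi / 2 else Real.sin (Real.pi * s / 2) / s

theorem sinRatio_ne_zero {s : ℝ} (hs : -1 < s) (hs1 : s < 1) : sinRatio s ≠ 0 := by
  have hπ := Real.pi_pos
  by_cases h0 : s = 0
  · simp [sinRatio, h0, hπ.ne']
  · simp only [sinRatio, h0, if_false]
    refine div_ne_zero (fun h => h0 ?_) h0
    have := (Real.sin_eq_zero_iff_of_lt_of_lt (by nlinarith) (by nlinarith)).1 h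
    have h2 : Real.pi * s = 0 := by linarith
    exact (mul_eq_zero.1 h2).resolve_left hπ.ne'

/-- The logarithms of $-z$ and $z$ are $\log(-iz)\mp i\pi/2$, so the two powers are symmetric around
$(-iz)^s$ and their difference is a sine. The base $-iz$ lies in the right half-plane, where powers
are well controlled. -/
theorem powPrimitive_neg_sub {s : ℝ} {z : ℂ} (hz : 0 < z.im) :
    powPrimitive s (-z) - powPrimitive s z =
      -2 * Complex.I * sinRatio s * (-Complex.I * z) ^ (s : ℂ) := by
  have hz0 : z ≠ 0 := by rintro rfl; simp at hz
  by_cases h0 : s = 0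
  · simp only [powPrimitive, sinRatio, h0, if_true, log_neg_of_im_pos hz]
    push_cast
    rw [Complex.cpow_zero]
    ring
  · simp only [powPrimitive, sinRatio, h0, if_false]
    rw [Complex.cpow_def_of_ne_zero (neg_ne_zero.2 hz0), Complex.cpow_def_of_ne_zero hz0,
      Complex.cpow_def_of_ne_zero (mul_ne_zero (by simp) hz0), log_neg_I_mul hz,
      log_neg_of_im_pos hz]
    have hs0 : (s : ℂ) ≠ 0 := by exact_mod_cast h0
    push_cast
    rw [Complex.sin]
    set L := (Complex.log z - Real.pi / 2 * Complex.I) * s with hL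
    rw [show (Complex.log z - Real.pi * Complex.I) * s = L + -(Real.pi * s / 2) * Complex.I by
        rw [hL]; ring,
      show Complex.log z * s = L + (Real.pi * s / 2) * Complex.I by rw [hL]; ring,
      Complex.exp_add, Complex.exp_add]
    generalize Complex.exp (-(Real.pi * s / 2) * Complex.I) = X
    generalize Complex.exp (Real.pi * s / 2 * Complex.I) = Y
    field_simp
    linear_combination (X - Y) * Complex.I_sq

theorem mul_stieltjes_neg_add_stieltjes {s : ℝ} (hs : -1 < s) (hs1 : s < 1) {a b : ℂ}
    (ha : a.im ≠ 0) (hb : b.im ≠ 0) :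
    (a - b) * (stieltjes s (-a) (-b) + stieltjes s a b) = stieltjes s 1 1 *
      ((powPrimitive s (-b) - powPrimitive s b) - (powPrimitive s (-a) - powPrimitive s a)) := by
  have h1 := mul_stieltjes hs hs1 (c := -a) (d := -b) (Or.inr (by simpa using ha))
    (Or.inr (by simpa using hb))
  have h2 := mul_stieltjes hs hs1 (c := a) (d := b) (Or.inr ha) (Or.inr hb)
  linear_combination h1 - h2

theorem stieltjes_comm (s : ℝ) (c d : ℂ) : stieltjes s c d = stieltjes s d c := by
  simp only [stieltjes, mul_comm]

/-- The confluent case, where division by `a - b` is impossible: the sum is a nonzero multiple of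
$(a^s-(-a)^s)/a$, and injectivity of the power applies. -/
theorem stieltjes_neg_add_stieltjes_self_eq_zero_iff {s : ℝ} (hs : -1 < s) (hs1 : s < 1) {a : ℂ}
    (ha : a.im ≠ 0) : stieltjes s (-a) (-a) + stieltjes s a a = 0 ↔ s = 0 := by
  have ham : a ∈ Complex.slitPlane := Or.inr ha
  have hnm : -a ∈ Complex.slitPlane := Or.inr (by simpa using ha)
  have ha0 := Complex.slitPlane_ne_zero ham
  have hn0 := neg_ne_zero.2 ha0
  rw [stieltjes_self hs hs1 ham, stieltjes_self hs hs1 hnm, ← add_mul, mul_eq_zero,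
    or_iff_left (stieltjes_one_one_ne_zero hs hs1), Complex.cpow_sub _ _ ha0,
    Complex.cpow_sub _ _ hn0, Complex.cpow_one, Complex.cpow_one]
  have : (-a) ^ (s : ℂ) / -a + a ^ (s : ℂ) / a = (a ^ (s : ℂ) - (-a) ^ (s : ℂ)) / a := by
    field_simp
    ring
  rw [this, div_eq_zero_iff, or_iff_left ha0, sub_eq_zero]
  refine ⟨fun h => ?_, fun h => by simp [h]⟩
  by_contra h0
  have := cpow_injOn_slitPlane hs hs1 h0 ham hnm h
  exact ha0 (self_eq_neg.1 this)

/-- For $a\ne b$ the sum is a nonzero multiple of $(-ib)^s-(-ia)^s$, and $z\mapsto z^s$ is injective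
on the right half-plane unless $s=0$. -/
theorem stieltjes_neg_add_stieltjes_eq_zero_iff_of_pos {s : ℝ} (hs : -1 < s) (hs1 : s < 1)
    {a b : ℂ} (ha : 0 < a.im) (hb : 0 < b.im) :
    stieltjes s (-a) (-b) + stieltjes s a b = 0 ↔ s = 0 := by
  by_cases hab : a = b
  · rw [hab]
    exact stieltjes_neg_add_stieltjes_self_eq_zero_iff hs hs1 hb.ne'
  have h := mul_stieltjes_neg_add_stieltjes hs hs1 ha.ne' hb.ne'
  rw [powPrimitive_neg_sub ha, powPrimitive_neg_sub hb, ← mul_sub] at h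
  have hσ : (sinRatio s : ℂ) ≠ 0 := by exact_mod_cast sinRatio_ne_zero hs hs1
  have hA := stieltjes_one_one_ne_zero hs hs1
  have h1 : stieltjes s (-a) (-b) + stieltjes s a b = 0 ↔
      (-Complex.I * b) ^ (s : ℂ) = (-Complex.I * a) ^ (s : ℂ) := by
    rw [← sub_eq_zero (b := (-Complex.I * a) ^ (s : ℂ))]
    constructor
    · intro h0
      rw [h0, mul_zero] at h
      simpa [hA, hσ] using h.symm
    · intro h0
      rw [h0, mul_zero, mul_zero] at h
      exact (mul_eq_zero.1 h).resolve_left (sub_ne_zero.2 hab)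
  rw [h1]
  refine ⟨fun h => ?_, fun h => by simp [h]⟩
  by_contra h0
  have := cpow_injOn_slitPlane hs hs1 h0 (Or.inl (by simpa using hb)) (Or.inl (by simpa using ha)) h
  exact hab (by simpa using this.symm)

/-- With `b` in the lower half-plane the formula applies to `-b`, which changes one sign: the
difference of powers becomes a sum of two numbers with positive real part. -/
theorem stieltjes_neg_add_stieltjes_ne_zero_of_pos_of_neg {s : ℝ} (hs : -1 < s) (hs1 : s < 1)
    {a b : ℂ} (ha : 0 < a.im) (hb : b.im < 0) :
    stieltjes s (-a) (-b) + stieltjes s a b ≠ 0 := by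
  intro h0
  have h := mul_stieltjes_neg_add_stieltjes hs hs1 ha.ne' hb.ne
  have hb' : 0 < (-b).im := by simpa using hb
  have h2 := powPrimitive_neg_sub (s := s) hb'
  rw [neg_neg] at h2
  have hσ : (sinRatio s : ℂ) ≠ 0 := by exact_mod_cast sinRatio_ne_zero hs hs1
  rw [h0, mul_zero, powPrimitive_neg_sub ha, ← neg_sub (powPrimitive s b), h2, eq_comm,
    mul_eq_zero, or_iff_right (stieltjes_one_one_ne_zero hs hs1)] at h
  have h3 : 2 * Complex.I * sinRatio s *
      ((-Complex.I * -b) ^ (s : ℂ) + (-Complex.I * a) ^ (s : ℂ)) = 0 := by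
    linear_combination h
  have h4 := (mul_eq_zero.1 h3).resolve_left (by simp [hσ])
  have h5 := cpow_re_pos hs hs1 (w := -Complex.I * -b) (by simpa using hb)
  have h6 := cpow_re_pos hs hs1 (w := -Complex.I * a) (by simpa using ha)
  have h7 := congrArg Complex.re h4
  rw [Complex.add_re, Complex.zero_re] at h7
  linarith

/-- The two-sided integral vanishes only at the critical exponent and for parameters in the same
half-plane. -/
theorem stieltjes_neg_add_stieltjes_eq_zero_iff {s : ℝ} (hs : -1 < s) (hs1 : s < 1) {a b : ℂ}
    (ha : a.im ≠ 0) (hb : b.im ≠ 0) :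
    stieltjes s (-a) (-b) + stieltjes s a b = 0 ↔
      s = 0 ∧ ((0 < a.im ∧ 0 < b.im) ∨ (a.im < 0 ∧ b.im < 0)) := by
  rcases lt_or_gt_of_ne ha with ha | ha <;> rcases lt_or_gt_of_ne hb with hb | hb
  · have := stieltjes_neg_add_stieltjes_eq_zero_iff_of_pos hs hs1 (a := -a) (b := -b)
      (by simpa using ha) (by simpa using hb)
    rw [neg_neg, neg_neg, add_comm] at this
    simp [this, ha, hb]
  · have := stieltjes_neg_add_stieltjes_ne_zero_of_pos_of_neg hs hs1 hb ha
    rw [stieltjes_comm s b a, stieltjes_comm s (-b) (-a)] at this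
    simp [this, ha.le, hb.le]
  · have := stieltjes_neg_add_stieltjes_ne_zero_of_pos_of_neg hs hs1 ha hb
    simp [this, ha.le, hb.le]
  · have := stieltjes_neg_add_stieltjes_eq_zero_iff_of_pos hs hs1 ha hb
    simp [this, ha, hb]

/-! ### Integrals over the four quadrants -/

theorem measurePreserving_units_mul (ε : ℤˣ) :
    MeasurePreserving (fun x : ℝ => ((ε : ℤ) : ℝ) * x) := by
  rcases Int.units_eq_one_or ε with rfl | rfl
  · simp only [Units.val_one, Int.cast_one, one_mul]
    exact MeasurePreserving.id (volume : Measure ℝ)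
  · simpa using! Measure.measurePreserving_neg (volume : Measure ℝ)

theorem sum_units {E : Type*} [AddCommMonoid E] (f : ℤˣ → E) : ∑ ε, f ε = f 1 + f (-1) := by
  rw [UnitsInt.univ, Finset.sum_pair (by decide)]

theorem integral_eq_sum_units {E : Type*} [NormedAddCommGroup E] [NormedSpace ℝ E]
    {f : ℝ → E} (hf : Integrable f) :
    ∫ x, f x = ∑ ε : ℤˣ, ∫ x in Ioi (0 : ℝ), f (((ε : ℤ) : ℝ) * x) := by
  have h : ∫ x in Ioi (0 : ℝ), f (-x) = ∫ x in Iic (0 : ℝ), f x := by simp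
  rw [sum_units]
  simp only [Units.val_one, Int.cast_one, one_mul, Units.val_neg, Int.cast_neg, neg_mul]
  rw [h, add_comm, intervalIntegral.integral_Iic_add_Ioi hf.integrableOn hf.integrableOn]

/-- The second variable is integrated last because it becomes the radius of the anisotropic polar
coordinates. -/
theorem integral_prod_eq_sum_units {E : Type*} [NormedAddCommGroup E] [NormedSpace ℝ E]
    {H : ℝ × ℝ → E} (hH : Integrable H) :
    ∫ z, H z = ∑ ε₁ : ℤˣ, ∑ ε₂ : ℤˣ, ∫ y in Ioi (0 : ℝ), ∫ x in Ioi (0 : ℝ),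
      H (((ε₁ : ℤ) : ℝ) * x, ((ε₂ : ℤ) : ℝ) * y) := by
  rw [Measure.volume_eq_prod] at hH
  rw [Measure.volume_eq_prod, integral_prod _ hH, integral_eq_sum_units hH.integral_prod_left]
  refine Finset.sum_congr rfl fun ε₁ _ => ?_
  have h1 : Integrable (fun z : ℝ × ℝ => H (((ε₁ : ℤ) : ℝ) * z.1, z.2))
      ((volume.restrict (Ioi 0)).prod volume) := by
    have hmp := (measurePreserving_units_mul ε₁).prod (MeasurePreserving.id (volume : Measure ℝ))
    have h2 := hmp.integrable_comp_of_integrable hH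
    refine Integrable.mono_measure h2 ?_
    rw [← Measure.restrict_univ (μ := (volume : Measure ℝ)), Measure.restrict_restrict
      measurableSet_Ioi, Measure.prod_restrict, Measure.prod_restrict]
    exact Measure.restrict_mono (by simp) le_rfl
  rw [integral_integral_swap h1, integral_eq_sum_units h1.integral_prod_right]

/-! ### The homogeneous multiplier -/

/-- The profile of the multiplier along a horizontal half-line. -/
noncomputable def profile (k : ℕ) (p : ℝ) (c d : ℂ) (t : ℝ) : ℂ :=
  ((t ^ p : ℝ) : ℂ) * (((t : ℂ) ^ k + c) * ((t : ℂ) ^ k + d))⁻¹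

/-- The multiplier `|x| ^ p |y| ^ q / ((x ^ k - a y ^ l) (x ^ k - b y ^ l))`. -/
noncomputable def multiplier (k l : ℕ) (p q : ℝ) (a b : ℂ) (x y : ℝ) : ℂ :=
  ((|x| ^ p * |y| ^ q : ℝ) : ℂ) *
    (((x : ℂ) ^ k - a * (y : ℂ) ^ l) * ((x : ℂ) ^ k - b * (y : ℂ) ^ l))⁻¹

/-- The sign `ε₁ ^ k ε₂ ^ l` as a complex number. -/
noncomputable def quadSign (k l : ℕ) (ε₁ ε₂ : ℤˣ) : ℂ := (((ε₁ ^ k * ε₂ ^ l : ℤˣ) : ℤ) : ℂ)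

theorem units_cast_sq (ε : ℤˣ) : (((ε : ℤ) : ℂ)) * ((ε : ℤ) : ℂ) = 1 := by
  rcases Int.units_eq_one_or ε with rfl | rfl <;> simp

theorem abs_units_mul (ε : ℤˣ) (x : ℝ) : |((ε : ℤ) : ℝ) * x| = |x| := by
  rcases Int.units_eq_one_or ε with rfl | rfl <;> simp

/-- Reflecting the variables multiplies both parameters by the same sign, since the sign pulled out
of the two factors of the denominator is squared. All quadrants reduce to the positive one. -/
theorem multiplier_units_mul (k l : ℕ) (p q : ℝ) (a b : ℂ) (x y : ℝ) (ε₁ ε₂ : ℤˣ) :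
    multiplier k l p q a b (((ε₁ : ℤ) : ℝ) * x) (((ε₂ : ℤ) : ℝ) * y) =
      multiplier k l p q (quadSign k l ε₁ ε₂ * a) (quadSign k l ε₁ ε₂ * b) x y := by
  have h1 : (((ε₁ : ℤ) : ℂ) ^ k) * (((ε₁ : ℤ) : ℂ) ^ k) = 1 := by
    rw [← mul_pow, units_cast_sq, one_pow]
  simp only [multiplier, abs_units_mul, quadSign]
  congr 2
  push_cast
  rw [mul_pow, mul_pow]
  linear_combination ((x : ℂ) ^ k * (x : ℂ) ^ k
    - (((ε₂ : ℤ) : ℂ) ^ l * y ^ l) ^ 2 * a * b) * h1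

/-- With $R=r^{l/k}$ the relation `hsc` says exactly $R\cdot R^pr^q=r^{2l-1}$, where the extra $R$
is the Jacobian of $x=Rt$ and $r^{2l}$ cancels against the denominator. -/
theorem rpow_mul_multiplier {k l : ℕ} (hk : 1 ≤ k) {p q : ℝ}
    (hsc : (l : ℝ) * (p + 1) + k * (q + 1) = 2 * k * l) (a b : ℂ) {r t : ℝ} (hr : 0 < r)
    (ht : 0 < t) :
    ((r ^ ((l : ℝ) / k) : ℝ) : ℂ) * multiplier k l p q a b (r ^ ((l : ℝ) / k) * t) r =
      ((r⁻¹ : ℝ) : ℂ) * profile k p (-a) (-b) t := by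
  have hk0 : (k : ℝ) ≠ 0 := by positivity
  set R := r ^ ((l : ℝ) / k) with hR
  have hR0 : 0 < R := Real.rpow_pos_of_pos hr _
  have hRk : R ^ k = r ^ l := by
    rw [hR, ← Real.rpow_natCast, ← Real.rpow_mul hr.le, div_mul_cancel₀ _ hk0, Real.rpow_natCast]
  have hRkC : (R : ℂ) ^ k = (r : ℂ) ^ l := by exact_mod_cast hRk
  have hexp : R * (R ^ p * r ^ q) = r⁻¹ * (r ^ l * r ^ l) := by
    rw [hR, ← Real.rpow_mul hr.le, ← Real.rpow_natCast, ← Real.rpow_neg_one r, ← Real.rpow_add hr,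
      ← Real.rpow_add hr, ← Real.rpow_add hr, ← Real.rpow_add hr]
    congr 1
    field_simp
    linarith
  simp only [multiplier, profile, abs_of_pos (mul_pos hR0 ht), abs_of_pos hr]
  rw [Real.mul_rpow hR0.le ht.le]
  push_cast
  rw [mul_pow, hRkC, show (r : ℂ) ^ l * (t : ℂ) ^ k - a * (r : ℂ) ^ l =
    (r : ℂ) ^ l * ((t : ℂ) ^ k + -a) by ring, show (r : ℂ) ^ l * (t : ℂ) ^ k - b * (r : ℂ) ^ l =
    (r : ℂ) ^ l * ((t : ℂ) ^ k + -b) by ring]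
  have hexpC : (R : ℂ) * (((R ^ p : ℝ) : ℂ) * ((r ^ q : ℝ) : ℂ)) =
    (r : ℂ)⁻¹ * ((r : ℂ) ^ l * (r : ℂ) ^ l) := by exact_mod_cast hexp
  have hrl : (r : ℂ) ^ l ≠ 0 := pow_ne_zero _ (by exact_mod_cast hr.ne')
  rw [mul_mul_mul_comm, mul_inv ((r : ℂ) ^ l * (r : ℂ) ^ l)]
  have h3 : (r : ℂ)⁻¹ = (R : ℂ) * (((R ^ p : ℝ) : ℂ) * ((r ^ q : ℝ) : ℂ)) *
      ((r : ℂ) ^ l * (r : ℂ) ^ l)⁻¹ := by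
    rw [hexpC, mul_assoc, mul_inv_cancel₀ (mul_ne_zero hrl hrl), mul_one]
  rw [h3]
  ring

/-- Anisotropic polar coordinates for the critical homogeneous multiplier. -/
theorem integral_mul_multiplier {k l : ℕ} (hk : 1 ≤ k) {p q : ℝ}
    (hsc : (l : ℝ) * (p + 1) + k * (q + 1) = 2 * k * l) (a b : ℂ) {Θ : ℝ → ℝ → ℂ}
    (hΘ : Integrable fun z : ℝ × ℝ => Θ z.1 z.2 * multiplier k l p q a b z.1 z.2) :
    ∫ z : ℝ × ℝ, Θ z.1 z.2 * multiplier k l p q a b z.1 z.2 =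
      ∑ ε₁ : ℤˣ, ∑ ε₂ : ℤˣ, ∫ r in Ioi (0 : ℝ), r⁻¹ • ∫ t in Ioi (0 : ℝ),
        Θ (((ε₁ : ℤ) : ℝ) * (r ^ ((l : ℝ) / k) * t)) (((ε₂ : ℤ) : ℝ) * r) *
          profile k p (-(quadSign k l ε₁ ε₂ * a)) (-(quadSign k l ε₁ ε₂ * b)) t := by
  rw [integral_prod_eq_sum_units hΘ]
  refine Finset.sum_congr rfl fun ε₁ _ => Finset.sum_congr rfl fun ε₂ _ => ?_
  refine setIntegral_congr_fun measurableSet_Ioi fun r hr => ?_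
  have hr : 0 < r := hr
  have hR0 : 0 < r ^ ((l : ℝ) / k) := Real.rpow_pos_of_pos hr _
  have h := integral_comp_mul_left_Ioi' (fun x => Θ (((ε₁ : ℤ) : ℝ) * x) (((ε₂ : ℤ) : ℝ) * r) *
    multiplier k l p q a b (((ε₁ : ℤ) : ℝ) * x) (((ε₂ : ℤ) : ℝ) * r)) 0 hR0
  rw [mul_zero] at h
  simp only
  rw [← h, ← integral_smul, ← integral_smul]
  refine setIntegral_congr_fun measurableSet_Ioi fun t ht => ?_
  have ht : 0 < t := ht
  have h2 := rpow_mul_multiplier hk hsc (quadSign k l ε₁ ε₂ * a) (quadSign k l ε₁ ε₂ * b) hr ht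
  simp only [multiplier_units_mul, Complex.real_smul]
  linear_combination Θ (((ε₁ : ℤ) : ℝ) * (r ^ ((l : ℝ) / k) * t)) (((ε₂ : ℤ) : ℝ) * r) * h2

/-- Substitution $u=t^k$. The new exponent vanishes exactly when $p=k-1$. -/
theorem integral_profile {k : ℕ} (hk : 1 ≤ k) (p : ℝ) (c d : ℂ) :
    ∫ t in Ioi (0 : ℝ), profile k p c d t =
      (k : ℂ)⁻¹ * stieltjes ((p + 1) / k - 1) c d := by
  have hk0 : (0 : ℝ) < k := by exact_mod_cast hk
  have h := integral_comp_rpow_Ioi_of_pos (g := fun u : ℝ =>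
    ((u ^ ((p + 1) / k - 1) : ℝ) : ℂ) * (((u : ℂ) + c) * ((u : ℂ) + d))⁻¹) hk0
  have hkC : (k : ℂ) ≠ 0 := by exact_mod_cast hk0.ne'
  rw [stieltjes, ← h, ← integral_const_mul]
  refine setIntegral_congr_fun measurableSet_Ioi fun t ht => ?_
  have ht : 0 < t := ht
  have e1 : t ^ ((k : ℝ) - 1) * (t ^ (k : ℝ)) ^ ((p + 1) / k - 1) = t ^ p := by
    rw [← Real.rpow_mul ht.le, ← Real.rpow_add ht]
    congr 1
    field_simp
    ring
  simp only [profile, ← e1, Complex.real_smul, Real.rpow_natCast]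
  push_cast
  field_simp

theorem integrableOn_profile {k : ℕ} (hk : 1 ≤ k) {p : ℝ} (hp : -1 < p) (hpk : p + 1 < 2 * k)
    {c d : ℂ} (hc : c ∈ Complex.slitPlane) (hd : d ∈ Complex.slitPlane) :
    IntegrableOn (profile k p c d) (Ioi 0) := by
  have hk0 : (0 : ℝ) < k := by exact_mod_cast hk
  have hs : -1 < (p + 1) / k - 1 := by
    have : 0 < (p + 1) / k := by have : 0 < p + 1 := by linarith
                                 positivity
    linarith
  have hs1 : (p + 1) / k - 1 < 1 := by
    have : (p + 1) / k < 2 := by rwa [div_lt_iff₀ hk0]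
    linarith
  have h := (integrableOn_Ioi_comp_rpow_iff' (fun u : ℝ =>
    ((u ^ ((p + 1) / k - 1) : ℝ) : ℂ) * (((u : ℂ) + c) * ((u : ℂ) + d))⁻¹) hk0.ne').2
    (integrableOn_stieltjes hs hs1 hc hd)
  refine h.congr_fun (fun t ht => ?_) measurableSet_Ioi
  have ht : 0 < t := ht
  have e1 : t ^ ((k : ℝ) - 1) * (t ^ (k : ℝ)) ^ ((p + 1) / k - 1) = t ^ p := by
    rw [← Real.rpow_mul ht.le, ← Real.rpow_add ht]
    congr 1
    field_simp
    ring
  simp only [profile, ← e1, Complex.real_smul, Real.rpow_natCast]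
  push_cast
  ring

/-! ### Ellipticity and the mean value of the multiplier -/

/-- If the signed parameter were a real $r\ge0$, then $(\varepsilon_1r^{1/k},\varepsilon_2)$ would
be a forbidden real zero. Ellipticity thus supplies the slit-plane hypotheses in all four quadrants.
-/
theorem NoRealRoots.neg_quadSign_mul_mem {k l : ℕ} (hk : 1 ≤ k) {c : ℂ} (h : NoRealRoots k l c)
    (ε₁ ε₂ : ℤˣ) : -(quadSign k l ε₁ ε₂ * c) ∈ Complex.slitPlane := by
  rw [Complex.mem_slitPlane_iff_not_le_zero]
  intro hle
  obtain ⟨hre, him⟩ := Complex.le_def.1 hle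
  set r := (quadSign k l ε₁ ε₂ * c).re with hr
  have hrc : quadSign k l ε₁ ε₂ * c = r := by
    apply Complex.ext
    · simp [hr]
    · rw [Complex.neg_im, Complex.zero_im] at him
      rw [Complex.ofReal_im]
      linarith
  have hr0 : 0 ≤ r := by
    rw [Complex.neg_re, Complex.zero_re] at hre
    linarith
  have hroot : ((r ^ ((k : ℝ)⁻¹) : ℝ) : ℂ) ^ k = r := by
    rw [← Complex.ofReal_pow, Real.rpow_inv_natCast_pow hr0 (by omega)]
  have h1 : (((ε₁ : ℤ) : ℂ) ^ k) * (((ε₁ : ℤ) : ℂ) ^ k) = 1 := by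
    rw [← mul_pow, units_cast_sq, one_pow]
  have := h (((ε₁ : ℤ) : ℝ) * r ^ ((k : ℝ)⁻¹)) (((ε₂ : ℤ) : ℝ)) ?_
  · have h2 := this.2
    rcases Int.units_eq_one_or ε₂ with rfl | rfl <;> simp at h2
  · push_cast
    rw [mul_pow, hroot, ← hrc, quadSign]
    push_cast
    linear_combination (((ε₂ : ℤ) : ℂ) ^ l * c) * h1

theorem sum_quadSign {k l : ℕ} (hodd : Odd k ∨ Odd l) (f : ℂ → ℂ) :
    ∑ ε₁ : ℤˣ, ∑ ε₂ : ℤˣ, f (quadSign k l ε₁ ε₂) = 2 * (f 1 + f (-1)) := by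
  simp only [sum_units, quadSign]
  rcases Nat.even_or_odd k with hk | hk <;> rcases Nat.even_or_odd l with hl | hl
  · rcases hodd with h | h
    · exact absurd hk (Nat.not_even_iff_odd.2 h)
    · exact absurd hl (Nat.not_even_iff_odd.2 h)
  all_goals
    simp [hk.neg_one_pow, hl.neg_one_pow]
    ring

theorem sum_quadSign_of_even {k l : ℕ} (hk : Even k) (hl : Even l) (f : ℂ → ℂ) :
    ∑ ε₁ : ℤˣ, ∑ ε₂ : ℤˣ, f (quadSign k l ε₁ ε₂) = 4 * f 1 := by
  simp only [sum_units, quadSign]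
  simp [hk.neg_one_pow, hl.neg_one_pow]
  ring

theorem exists_quadSign_eq_neg_one {k l : ℕ} (hodd : Odd k ∨ Odd l) :
    ∃ ε₁ ε₂ : ℤˣ, quadSign k l ε₁ ε₂ = -1 := by
  rcases hodd with h | h
  · exact ⟨-1, 1, by simp [quadSign, h.neg_one_pow]⟩
  · exact ⟨1, -1, by simp [quadSign, h.neg_one_pow]⟩

/-- When `k` or `l` is odd both signs occur, so both `c` and `-c` avoid the cut and `c` is not real.
-/
theorem NoRealRoots.im_ne_zero {k l : ℕ} (hk : 1 ≤ k) (hodd : Odd k ∨ Odd l) {c : ℂ}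
    (h : NoRealRoots k l c) : c.im ≠ 0 := by
  have h1 := h.neg_quadSign_mul_mem hk 1 1
  obtain ⟨ε₁, ε₂, hε⟩ := exists_quadSign_eq_neg_one hodd
  have h2 := h.neg_quadSign_mul_mem hk ε₁ ε₂
  rw [hε] at h2
  simp only [quadSign, one_pow, mul_one, Units.val_one, Int.cast_one, one_mul, neg_mul, neg_neg,
    Complex.mem_slitPlane_iff, Complex.neg_re, Complex.neg_im, ne_eq, neg_eq_zero] at h1 h2
  intro h0
  rcases h1 with h1 | h1
  · rcases h2 with h2 | h2
    · linarith
    · exact h2 h0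
  · exact h1 h0

/-- The mean value of the multiplier over the four quadrants. -/
noncomputable def multiplierMean (k l : ℕ) (p : ℝ) (a b : ℂ) : ℂ :=
  ∑ ε₁ : ℤˣ, ∑ ε₂ : ℤˣ, ∫ t in Ioi (0 : ℝ),
    profile k p (-(quadSign k l ε₁ ε₂ * a)) (-(quadSign k l ε₁ ε₂ * b)) t

/-- Parity decides whether the four quadrants give two copies of $S(-a,-b)+S(a,b)$ or four copies of
$S(-a,-b)$; the bounds on `p` place the exponent $s$ in $(-1,1)$. -/
theorem multiplierMean_eq_zero_iff {k l : ℕ} (hk : 1 ≤ k) {p : ℝ} (hp : -1 < p)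
    (hpk : p + 1 < 2 * k) {a b : ℂ} (ha : NoRealRoots k l a) (hb : NoRealRoots k l b) :
    multiplierMean k l p a b = 0 ↔ (Odd k ∨ Odd l) ∧ p = k - 1 ∧
      ((0 < a.im ∧ 0 < b.im) ∨ (a.im < 0 ∧ b.im < 0)) := by
  have hk0 : (0 : ℝ) < k := by exact_mod_cast hk
  have hkC : (k : ℂ) ≠ 0 := by exact_mod_cast hk0.ne'
  have hs : -1 < (p + 1) / k - 1 := by
    have : 0 < (p + 1) / k := by have : 0 < p + 1 := by linarith
                                 positivity
    linarith
  have hs1 : (p + 1) / k - 1 < 1 := by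
    have : (p + 1) / k < 2 := by rwa [div_lt_iff₀ hk0]
    linarith
  have hs0 : (p + 1) / k - 1 = 0 ↔ p = k - 1 := by
    rw [sub_eq_zero, div_eq_one_iff_eq hk0.ne', eq_sub_iff_add_eq]
  simp only [multiplierMean, integral_profile hk]
  by_cases hodd : Odd k ∨ Odd l
  · rw [sum_quadSign hodd fun ε => (k : ℂ)⁻¹ * stieltjes ((p + 1) / k - 1) (-(ε * a)) (-(ε * b)),
      ← mul_add]
    simp only [one_mul, neg_mul, neg_neg, mul_eq_zero, OfNat.ofNat_ne_zero, inv_eq_zero, hkC,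
      false_or, hodd, true_and]
    rw [stieltjes_neg_add_stieltjes_eq_zero_iff hs hs1 (ha.im_ne_zero hk hodd)
      (hb.im_ne_zero hk hodd), hs0]
  · have hev := hodd
    rw [not_or, Nat.not_odd_iff_even, Nat.not_odd_iff_even] at hev
    rw [sum_quadSign_of_even hev.1 hev.2
      fun ε => (k : ℂ)⁻¹ * stieltjes ((p + 1) / k - 1) (-(ε * a)) (-(ε * b))]
    have h1 := ha.neg_quadSign_mul_mem hk 1 1
    have h2 := hb.neg_quadSign_mul_mem hk 1 1
    have hq : quadSign k l 1 1 = 1 := by simp [quadSign]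
    rw [hq, one_mul] at h1 h2
    have := stieltjes_ne_zero hs hs1 h1 h2
    simp only [hodd, false_and, iff_false]
    simpa [hkC] using this

/-! ### The plane as a product -/

theorem measurePreserving_planeToProd :
    MeasurePreserving (fun p : Plane => (p 0, p 1)) volume (volume : Measure (ℝ × ℝ)) :=
  (volume_preserving_finTwoArrow ℝ).comp (PiLp.volume_preserving_ofLp (Fin 2))

theorem measurableEmbedding_planeToProd :
    MeasurableEmbedding (fun p : Plane => (p 0, p 1)) :=
  (MeasurableEquiv.finTwoArrow (α := ℝ)).measurableEmbedding.comp
    (MeasurableEquiv.toLp 2 (Fin 2 → ℝ)).symm.measurableEmbedding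

theorem integral_plane {E : Type*} [NormedAddCommGroup E] [NormedSpace ℝ E] (H : ℝ × ℝ → E) :
    ∫ p : Plane, H (p 0, p 1) = ∫ z, H z :=
  measurePreserving_planeToProd.integral_comp measurableEmbedding_planeToProd H

theorem integrable_plane {E : Type*} [NormedAddCommGroup E] {H : ℝ × ℝ → E} :
    Integrable (fun p : Plane => H (p 0, p 1)) ↔ Integrable H :=
  measurePreserving_planeToProd.integrable_comp_emb measurableEmbedding_planeToProd

theorem plane_eta (p : Plane) : !₂[p 0, p 1] = p := by
  ext i; fin_cases i <;> rfl

/-- The dilation `(x, y) ↦ (u x, v y)` of the plane. -/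
noncomputable def dilation (u v : ℝˣ) : Plane ≃L[ℝ] Plane :=
  LinearEquiv.toContinuousLinearEquiv
    { toFun := fun p => !₂[(u : ℝ) * p 0, (v : ℝ) * p 1]
      map_add' := fun p p' => by ext i; fin_cases i <;> simp [mul_add]
      map_smul' := fun c p => by ext i; fin_cases i <;> simp [mul_left_comm]
      invFun := fun p => !₂[((u⁻¹ : ℝˣ) : ℝ) * p 0, ((v⁻¹ : ℝˣ) : ℝ) * p 1]
      left_inv := fun p => by ext i; fin_cases i <;> simp
      right_inv := fun p => by ext i; fin_cases i <;> simp }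

@[simp] theorem dilation_apply_zero (u v : ℝˣ) (p : Plane) : dilation u v p 0 = u * p 0 := rfl

@[simp] theorem dilation_apply_one (u v : ℝˣ) (p : Plane) : dilation u v p 1 = v * p 1 := rfl

theorem integral_prod_comp_mul {E : Type*} [NormedAddCommGroup E] [NormedSpace ℝ E]
    (H : ℝ × ℝ → E) {u v : ℝ} (hu : u ≠ 0) (hv : v ≠ 0) :
    ∫ z : ℝ × ℝ, H (u * z.1, v * z.2) = |(u * v)⁻¹| • ∫ z, H z := by
  have hemb : MeasurableEmbedding (Prod.map (u * ·) (v * ·) : ℝ × ℝ → ℝ × ℝ) :=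
    ((Homeomorph.mulLeft₀ u hu).prodCongr (Homeomorph.mulLeft₀ v hv)).measurableEmbedding
  have hmap : Measure.map (Prod.map (u * ·) (v * ·)) (volume : Measure (ℝ × ℝ)) =
      ENNReal.ofReal |(u * v)⁻¹| • (volume : Measure (ℝ × ℝ)) := by
    rw [Measure.volume_eq_prod, ← Measure.map_prod_map _ _ (by fun_prop) (by fun_prop),
      Real.map_volume_mul_left hu, Real.map_volume_mul_left hv, Measure.prod_smul_left,
      Measure.prod_smul_right, smul_smul, ← ENNReal.ofReal_mul (abs_nonneg _), ← abs_mul, mul_inv]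
  have h := hemb.integral_map (μ := volume) H
  rw [hmap, integral_smul_measure, ENNReal.toReal_ofReal (abs_nonneg _)] at h
  exact h.symm

theorem integral_comp_dilation {E : Type*} [NormedAddCommGroup E] [NormedSpace ℝ E]
    (H : Plane → E) (u v : ℝˣ) :
    ∫ p, H (dilation u v p) = |((u : ℝ) * v)⁻¹| • ∫ p, H p := by
  have h1 := integral_plane fun z : ℝ × ℝ => H (!₂[(u : ℝ) * z.1, (v : ℝ) * z.2])
  have h2 := integral_plane fun z : ℝ × ℝ => H (!₂[z.1, z.2])
  simp only [plane_eta] at h2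
  rw [h2, ← integral_prod_comp_mul _ u.ne_zero v.ne_zero, ← h1]
  rfl

theorem inner_plane (p x : Plane) : inner ℝ p x = p 0 * x 0 + p 1 * x 1 := by
  simp [PiLp.inner_apply, Fin.sum_univ_two, mul_comm]

/-! ### Fourier transforms and dilations -/

theorem fourierInv_comp_dilation (w : Plane → ℂ) (u v : ℝˣ) (x : Plane) :
    𝓕⁻ (fun p => w (dilation u v p)) x =
      |((u : ℝ) * v)⁻¹| • 𝓕⁻ w (dilation u⁻¹ v⁻¹ x) := by
  rw [Real.fourierInv_eq, Real.fourierInv_eq, ← integral_comp_dilation]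
  congr with p
  congr 2
  simp only [inner_plane, dilation_apply_zero, dilation_apply_one, Units.val_inv_eq_inv_val]
  have := u.ne_zero
  have := v.ne_zero
  field_simp

/-- A dilation on the Fourier side becomes an $L_1$-normalized dilation in space. This invariance
gives both the scaling argument and the uniform bounds for the test functions. -/
theorem normL1_fourierInv_comp_dilation (w w' : 𝓢(Plane, ℂ)) (u v : ℝˣ)
    (h : ∀ p, w' p = w (dilation u v p)) : normL1 (𝓕⁻ w') = normL1 (𝓕⁻ w) := by
  have h1 : ∀ x, (𝓕⁻ w') x = |((u : ℝ) * v)⁻¹| • (𝓕⁻ w) (dilation u⁻¹ v⁻¹ x) := fun x => by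
    rw [SchwartzMap.fourierInv_coe, SchwartzMap.fourierInv_coe, ← fourierInv_comp_dilation]
    rw [show (w' : Plane → ℂ) = fun p => w (dilation u v p) from funext h]
  simp only [normL1, h1, norm_smul]
  have h2 := integral_comp_dilation (fun x => ‖(𝓕⁻ w) x‖) u⁻¹ v⁻¹
  rw [integral_const_mul, h2]
  have := u.ne_zero
  have := v.ne_zero
  simp only [Units.val_inv_eq_inv_val, smul_eq_mul, norm_abs_eq_norm, Real.norm_eq_abs]
  rw [← mul_assoc, ← abs_mul]
  field_simp
  simp

/-! ### The symbol of the differential operator -/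

/-- The symbol of `∂₁ ^ k - c ∂₂ ^ l`. -/
noncomputable def symbol (k l : ℕ) (c : ℂ) (x y : ℝ) : ℂ :=
  (2 * Real.pi * Complex.I * x) ^ k - c * (2 * Real.pi * Complex.I * y) ^ l

theorem fourier_iteratedLineDeriv_const (n : ℕ) (j : Fin 2) (f : 𝓢(Plane, ℂ)) (p : Plane) :
    𝓕 (∂^{fun _ : Fin n => basisVec j} f) p = (2 * Real.pi * Complex.I * p j) ^ n * 𝓕 f p := by
  induction n with
  | zero => simp
  | succ n ih =>
    rw [LineDeriv.iteratedLineDerivOp_succ_left, SchwartzMap.fourier_lineDerivOp_eq]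
    have htg : (fun x : Plane => inner ℝ x (basisVec j)).HasTemperateGrowth :=
      ((innerSL ℝ).flip (basisVec j)).hasTemperateGrowth
    have h2 : inner ℝ p (basisVec j) = p j := by
      simp [basisVec, EuclideanSpace.inner_single_right]
    have h3 : (Fin.tail fun _ : Fin (n + 1) => basisVec j) = fun _ : Fin n => basisVec j := rfl
    rw [smul_apply, SchwartzMap.smulLeftCLM_apply_apply htg, h2, h3, ih]
    simp only [smul_eq_mul, Complex.real_smul]
    ring

theorem fourier_diffOp (k l : ℕ) (c : ℂ) (f : 𝓢(Plane, ℂ)) (p : Plane) :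
    𝓕 (diffOp k l c f) p = symbol k l c (p 0) (p 1) * 𝓕 f p := by
  have h : 𝓕 (diffOp k l c f) = 𝓕 (∂^{fun _ : Fin k => basisVec 0} f) -
      c • 𝓕 (∂^{fun _ : Fin l => basisVec 1} f) := by
    rw [diffOp, sub_eq_add_neg, FourierTransform.fourier_add, ← neg_smul,
      FourierTransform.fourier_smul, neg_smul, sub_eq_add_neg]
  rw [h, sub_apply, smul_apply, fourier_iteratedLineDeriv_const,
    fourier_iteratedLineDeriv_const, symbol, smul_eq_mul]
  ring

/-- Test functions are prescribed by their Fourier transforms; the image under the operator is then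
found by multiplying by the symbol. -/
theorem diffOp_fourierInv (k l : ℕ) (c : ℂ) (u w : 𝓢(Plane, ℂ))
    (h : ∀ p, w p = symbol k l c (p 0) (p 1) * u p) : diffOp k l c (𝓕⁻ u) = 𝓕⁻ w := by
  have h1 : 𝓕 (diffOp k l c (𝓕⁻ u)) = w := by
    ext p
    rw [fourier_diffOp, h, FourierTransform.fourier_fourierInv_eq]
  rw [← h1, FourierTransform.fourierInv_fourier_eq]

theorem two_pi_I_ne_zero : (2 * (Real.pi : ℂ) * Complex.I) ≠ 0 := by
  simp [Real.pi_ne_zero]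

theorem symbol_eq_mul (k l : ℕ) (τ : ℂ) (x y : ℝ) :
    symbol k l τ x y =
      (2 * Real.pi * Complex.I) ^ k * ((x : ℂ) ^ k - tauOne k l τ * (y : ℂ) ^ l) := by
  have h := two_pi_I_ne_zero
  rw [symbol, tauOne, mul_pow _ (x : ℂ), mul_pow _ (y : ℂ), zpow_sub₀ h, zpow_natCast, zpow_natCast]
  generalize 2 * (Real.pi : ℂ) * Complex.I = ω at h ⊢
  field_simp

/-- Conjugation turns $2\pi i$ into $-2\pi i$, which is the origin of the factor $(-1)^{l-k}$ and of
$\overline\sigma$ in $\sigma_1$. -/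
theorem conj_symbol_eq_mul (k l : ℕ) (σ : ℂ) (x y : ℝ) :
    conj (symbol k l σ x y) =
      (-(2 * Real.pi * Complex.I)) ^ k * ((x : ℂ) ^ k - sigmaOne k l σ * (y : ℂ) ^ l) := by
  have h := neg_ne_zero.2 two_pi_I_ne_zero
  have h1 : conj (symbol k l σ x y) = (-(2 * Real.pi * Complex.I) * x) ^ k -
      conj σ * (-(2 * Real.pi * Complex.I) * y) ^ l := by
    simp [symbol, map_ofNat]
  rw [h1, sigmaOne, ← mul_zpow, neg_one_mul, mul_pow, mul_pow, zpow_sub₀ h, zpow_natCast,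
    zpow_natCast]
  generalize -(2 * (Real.pi : ℂ) * Complex.I) = ω at h ⊢
  field_simp

theorem symbol_mul_conj_symbol (k l : ℕ) (σ τ : ℂ) (x y : ℝ) :
    symbol k l τ x y * conj (symbol k l σ x y) =
      (2 * Real.pi) ^ (2 * k) * (((x : ℂ) ^ k - tauOne k l τ * (y : ℂ) ^ l) *
        ((x : ℂ) ^ k - sigmaOne k l σ * (y : ℂ) ^ l)) := by
  rw [symbol_eq_mul, conj_symbol_eq_mul, mul_mul_mul_comm, ← mul_pow]
  congr 1
  rw [pow_mul]
  congr 1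
  linear_combination -(2 * (Real.pi : ℂ)) ^ 2 * Complex.I_sq

theorem symbol_ne_zero {k l : ℕ} {τ : ℂ} (h : NoRealRoots k l (tauOne k l τ)) {x y : ℝ}
    (hxy : ¬(x = 0 ∧ y = 0)) : symbol k l τ x y ≠ 0 := by
  rw [symbol_eq_mul]
  exact mul_ne_zero (pow_ne_zero _ two_pi_I_ne_zero) fun h0 => hxy (h x y h0)

theorem symbol_ne_zero' {k l : ℕ} {σ : ℂ} (h : NoRealRoots k l (sigmaOne k l σ)) {x y : ℝ}
    (hxy : ¬(x = 0 ∧ y = 0)) : symbol k l σ x y ≠ 0 := by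
  rw [← map_ne_zero (starRingEnd ℂ), conj_symbol_eq_mul]
  exact mul_ne_zero (pow_ne_zero _ (neg_ne_zero.2 two_pi_I_ne_zero)) fun h0 => hxy (h x y h0)

/-! ### Necessity of the homogeneity relation -/

theorem sobolevInner_fourierInv (α β : ℝ) (u v : 𝓢(Plane, ℂ)) :
    sobolevInner α β (𝓕⁻ u) (𝓕⁻ v) =
      ∫ p : Plane, u p * conj (v p) * ((|p 0| ^ (2 * α) * |p 1| ^ (2 * β) : ℝ) : ℂ) := by
  simp only [sobolevInner, FourierTransform.fourier_fourierInv_eq]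

theorem normL1_nonneg (f : 𝓢(Plane, ℂ)) : 0 ≤ normL1 f := integral_nonneg fun _ => norm_nonneg _

theorem normL1_smul (c : ℂ) (f : 𝓢(Plane, ℂ)) : normL1 (c • f) = ‖c‖ * normL1 f := by
  simp only [normL1, smul_apply, norm_smul, integral_const_mul]

theorem normL1_sub_le (f g : 𝓢(Plane, ℂ)) : normL1 (f - g) ≤ normL1 f + normL1 g := by
  simp only [normL1]
  rw [← integral_add f.integrable.norm g.integrable.norm]
  refine integral_mono (f - g).integrable.norm (f.integrable.norm.add g.integrable.norm) fun x => ?_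
  rw [sub_apply]
  exact norm_sub_le _ _

theorem continuous_weight {α β : ℝ} (hα : 0 ≤ α) (hβ : 0 ≤ β) :
    Continuous fun p : Plane => |p 0| ^ (2 * α) * |p 1| ^ (2 * β) := by
  refine Continuous.mul ?_ ?_
  · exact (by fun_prop : Continuous fun p : Plane => |p 0|).rpow_const fun _ => Or.inr (by linarith)
  · exact (by fun_prop : Continuous fun p : Plane => |p 1|).rpow_const fun _ => Or.inr (by linarith)

/-- The anisotropic dilation `(x, y) ↦ (r ^ l x, r ^ k y)`. -/
noncomputable def anisoDilation (k l : ℕ) {r : ℝ} (hr : 0 < r) : Plane ≃L[ℝ] Plane :=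
  dilation (Units.mk0 (r ^ l) (pow_pos hr l).ne') (Units.mk0 (r ^ k) (pow_pos hr k).ne')

theorem anisoDilation_zero (k l : ℕ) {r : ℝ} (hr : 0 < r) (p : Plane) :
    anisoDilation k l hr p 0 = r ^ l * p 0 := rfl

theorem anisoDilation_one (k l : ℕ) {r : ℝ} (hr : 0 < r) (p : Plane) :
    anisoDilation k l hr p 1 = r ^ k * p 1 := rfl

theorem symbol_anisoDilation (k l : ℕ) (c : ℂ) {r : ℝ} (x y : ℝ) :
    symbol k l c (r ^ l * x) (r ^ k * y) = (r : ℂ) ^ (k * l) * symbol k l c x y := by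
  simp only [symbol]
  push_cast
  ring

/-- The symbol is homogeneous of degree $kl$ under the anisotropic dilation, and the dilation itself
does not change the $L_1$ norm. -/
theorem normL1_diffOp_fourierInv_anisoDilation (k l : ℕ) (c : ℂ) {r : ℝ} (hr : 0 < r)
    (u u' : 𝓢(Plane, ℂ)) (h : ∀ p, u' p = u (anisoDilation k l hr p)) :
    normL1 (diffOp k l c (𝓕⁻ u')) = (r ^ (k * l))⁻¹ * normL1 (diffOp k l c (𝓕⁻ u)) := by
  set w := 𝓕 (diffOp k l c (𝓕⁻ u)) with hw
  have hwp : ∀ p, w p = symbol k l c (p 0) (p 1) * u p := fun p => by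
    rw [hw, fourier_diffOp, FourierTransform.fourier_fourierInv_eq]
  have hrC : (r : ℂ) ^ (k * l) ≠ 0 := pow_ne_zero _ (by exact_mod_cast hr.ne')
  set w' := SchwartzMap.compCLMOfContinuousLinearEquiv ℂ (anisoDilation k l hr) w with hw'
  have hwp' : ∀ p, w' p = w (anisoDilation k l hr p) := fun p => rfl
  have h1 : diffOp k l c (𝓕⁻ u') = 𝓕⁻ (((r : ℂ) ^ (k * l))⁻¹ • w') := by
    refine diffOp_fourierInv k l c u' _ fun p => ?_
    rw [smul_apply, hwp', hwp, h, anisoDilation_zero, anisoDilation_one, symbol_anisoDilation,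
      smul_eq_mul, mul_assoc, inv_mul_cancel_left₀ hrC]
  have h2 : diffOp k l c (𝓕⁻ u) = 𝓕⁻ w := diffOp_fourierInv k l c u _ hwp
  rw [h1, h2, FourierTransform.fourierInv_smul, normL1_smul,
    normL1_fourierInv_comp_dilation w w' _ _ hwp']
  congr 1
  rw [norm_inv, norm_pow, Complex.norm_real, Real.norm_of_nonneg hr.le]

theorem eq_zero_of_forall_rpow_le {x C : ℝ} (h : ∀ r : ℝ, 0 < r → r ^ x ≤ C) : x = 0 := by
  by_contra hx
  obtain ⟨y, hy0, hy⟩ : ∃ y : ℝ, 0 < y ∧ C < y := ⟨max 1 (C + 1), by positivity,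
    lt_of_lt_of_le (by linarith) (le_max_right _ _)⟩
  have := h (y ^ x⁻¹) (Real.rpow_pos_of_pos hy0 _)
  rw [← Real.rpow_mul hy0.le, inv_mul_cancel₀ hx, Real.rpow_one] at this
  linarith

/-- For dilations of one bump the left side scales as $r^{-l(2\alpha+1)-k(2\beta+1)}$ and the right
side as $r^{-2kl}$. The ratio is a power of $r$ bounded for all $r>0$, so its exponent is zero. -/
theorem BE.homogeneity {k l : ℕ} {α β : ℝ} (hα : 0 ≤ α) (hβ : 0 ≤ β) {σ τ : ℂ}
    (h : BE k l α β σ τ) :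
    (l : ℝ) * (2 * α + 1) + k * (2 * β + 1) = 2 * k * l := by
  obtain ⟨C, hC⟩ := h
  let b : ContDiffBump (0 : Plane) := ⟨1, 2, one_pos, one_lt_two⟩
  have hcs : HasCompactSupport fun p : Plane => ((b p : ℝ) : ℂ) :=
    b.hasCompactSupport.comp_left (g := fun x : ℝ => (x : ℂ)) (by simp)
  let u : 𝓢(Plane, ℂ) := hcs.toSchwartzMap (Complex.ofRealCLM.contDiff.comp b.contDiff)
  have hu : ∀ p, u p = ((b p : ℝ) : ℂ) := fun p => rfl
  set W : Plane → ℝ := fun p => |p 0| ^ (2 * α) * |p 1| ^ (2 * β) with hW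
  have hWc : Continuous W := continuous_weight hα hβ
  set I : ℝ := ∫ p, b p * b p * W p with hI
  have hI0 : 0 < I := by
    -- The point $(1/2,1/2)$ lies in the unit ball, where the bump is `1`, and off the axes, where
    -- the weight may vanish.
    refine Continuous.integral_pos_of_hasCompactSupport_nonneg_nonzero (x := !₂[(1 / 2 : ℝ), 1 / 2])
      ((b.continuous.mul b.continuous).mul hWc) ?_ (fun p => ?_) ?_
    · exact (b.hasCompactSupport.mul_right (f' := b)).mul_right
    · have := b.nonneg (x := p)
      simp only [hW, Pi.zero_apply]
      positivity
    · have h1 : b !₂[(1 / 2 : ℝ), 1 / 2] = 1 := by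
        refine b.one_of_mem_closedBall ?_
        rw [mem_closedBall_zero_iff, EuclideanSpace.norm_eq]
        refine Real.sqrt_le_one.2 ?_
        simp [Fin.sum_univ_two]
        norm_num
      simp only [h1, hW]
      have h2 : (0 : ℝ) < 2⁻¹ ^ (2 * α) := by positivity
      have h3 : (0 : ℝ) < 2⁻¹ ^ (2 * β) := by positivity
      simp [h2.ne', h3.ne']
  set N := normL1 (diffOp k l τ (𝓕⁻ u)) * normL1 (diffOp k l σ (𝓕⁻ u)) with hN
  refine sub_eq_zero.1 (neg_eq_zero.1 (eq_zero_of_forall_rpow_le (C := C * N / I) fun r hr => ?_))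
  set D := anisoDilation k l hr with hD
  let u' := SchwartzMap.compCLMOfContinuousLinearEquiv ℂ D u
  have hu' : ∀ p, u' p = u (D p) := fun p => rfl
  have key := hC (𝓕⁻ u') (𝓕⁻ u')
  rw [normL1_diffOp_fourierInv_anisoDilation k l τ hr u u' hu',
    normL1_diffOp_fourierInv_anisoDilation k l σ hr u u' hu', sobolevInner_fourierInv] at key
  have hWD : ∀ p, W (D p) = (r ^ ((l : ℝ) * (2 * α)) * r ^ ((k : ℝ) * (2 * β))) * W p := fun p => by
    simp only [hW, hD, anisoDilation_zero, anisoDilation_one, abs_mul, abs_pow, abs_of_pos hr]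
    rw [Real.mul_rpow (by positivity) (abs_nonneg _), Real.mul_rpow (by positivity) (abs_nonneg _),
      ← Real.rpow_natCast r l, ← Real.rpow_natCast r k, ← Real.rpow_mul hr.le, ← Real.rpow_mul hr.le]
    ring
  set P := r ^ ((l : ℝ) * (2 * α)) * r ^ ((k : ℝ) * (2 * β)) with hP
  have hP0 : 0 < P := by positivity
  have hint : ∫ p : Plane, u' p * conj (u' p) * ((|p 0| ^ (2 * α) * |p 1| ^ (2 * β) : ℝ) : ℂ) =
      ((P⁻¹ * ((r ^ l * r ^ k)⁻¹ * I) : ℝ) : ℂ) := by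
    have e1 : ∀ p : Plane, u' p * conj (u' p) * ((|p 0| ^ (2 * α) * |p 1| ^ (2 * β) : ℝ) : ℂ) =
        ((P⁻¹ * (b (D p) * b (D p) * W (D p)) : ℝ) : ℂ) := fun p => by
      rw [hu', hu, hWD, Complex.conj_ofReal]
      push_cast
      have : (P : ℂ) ≠ 0 := by exact_mod_cast hP0.ne'
      field_simp
      simp only [hW]
      push_cast
      ring
    simp_rw [e1]
    rw [integral_complex_ofReal, integral_const_mul, hD, anisoDilation,
      integral_comp_dilation (fun p => b p * b p * W p)]
    simp only [Units.val_mk0, smul_eq_mul]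
    rw [abs_of_pos (by positivity)]
  rw [hint, Complex.norm_real, Real.norm_of_nonneg (by positivity)] at key
  rw [le_div_iff₀ hI0]
  have hexp : r ^ (-((l : ℝ) * (2 * α + 1) + k * (2 * β + 1) - 2 * k * l)) =
      (r ^ (k * l) * r ^ (k * l)) * (P⁻¹ * (r ^ l * r ^ k)⁻¹) := by
    rw [hP, ← Real.rpow_add hr, ← Real.rpow_natCast, ← Real.rpow_natCast, ← Real.rpow_natCast,
      ← Real.rpow_add hr, ← Real.rpow_add hr, ← Real.rpow_neg hr.le, ← Real.rpow_neg hr.le,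
      ← Real.rpow_add hr, ← Real.rpow_add hr]
    congr 1
    push_cast
    ring
  rw [hexp]
  have hrkl : 0 < r ^ (k * l) := by positivity
  calc r ^ (k * l) * r ^ (k * l) * (P⁻¹ * (r ^ l * r ^ k)⁻¹) * I
      = r ^ (k * l) * r ^ (k * l) * (P⁻¹ * ((r ^ l * r ^ k)⁻¹ * I)) := by ring
    _ ≤ r ^ (k * l) * r ^ (k * l) * _ := mul_le_mul_of_nonneg_left key (by positivity)
    _ = C * N := by rw [hN]; field_simp

/-! ### Necessity of the vanishing mean -/

/-- A smooth cutoff, equal to `1` on `(-∞, 1]` and to `0` on `[2, ∞)`. -/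
noncomputable def cutoff (s : ℝ) : ℝ := Real.smoothTransition (2 - s)

theorem cutoff_of_le {s : ℝ} (hs : s ≤ 1) : cutoff s = 1 :=
  Real.smoothTransition.one_of_one_le (by linarith)

theorem cutoff_of_ge {s : ℝ} (hs : 2 ≤ s) : cutoff s = 0 :=
  Real.smoothTransition.zero_of_nonpos (by linarith)

theorem cutoff_nonneg (s : ℝ) : 0 ≤ cutoff s := Real.smoothTransition.nonneg _

theorem cutoff_le_one (s : ℝ) : cutoff s ≤ 1 := Real.smoothTransition.le_one _

theorem contDiff_cutoff {n : ℕ∞} : ContDiff ℝ n cutoff :=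
  Real.smoothTransition.contDiff.comp (contDiff_const.sub contDiff_id)

/-- The anisotropic gauge `x ^ (2k) + y ^ (2l)`. -/
noncomputable def gauge (k l : ℕ) (p : Plane) : ℝ := p 0 ^ (2 * k) + p 1 ^ (2 * l)

theorem contDiff_gauge (k l : ℕ) {n : ℕ∞} : ContDiff ℝ n (gauge k l) := by
  unfold gauge
  fun_prop

theorem gauge_nonneg (k l : ℕ) (p : Plane) : 0 ≤ gauge k l p := by
  unfold gauge
  rw [pow_mul, pow_mul]
  positivity

theorem gauge_anisoDilation (k l : ℕ) {r : ℝ} (hr : 0 < r) (p : Plane) :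
    gauge k l (anisoDilation k l hr p) = r ^ (2 * (k * l)) * gauge k l p := by
  simp only [gauge, anisoDilation_zero, anisoDilation_one]
  ring

theorem abs_le_of_pow_le {k : ℕ} (hk : 1 ≤ k) {x R : ℝ} (hR : 1 ≤ R) (h : x ^ (2 * k) ≤ R) :
    |x| ≤ R := by
  by_contra hlt
  push Not at hlt
  have h1 : 1 ≤ |x| := by linarith
  have h2 : |x| ^ 1 ≤ |x| ^ (2 * k) := pow_le_pow_right₀ h1 (by omega)
  rw [pow_one, (even_two_mul k).pow_abs] at h2
  linarith

theorem hasCompactSupport_of_gauge {k l : ℕ} (hk : 1 ≤ k) (hl : 1 ≤ l) {f : Plane → ℂ} (R : ℝ)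
    (h : ∀ p, R ≤ gauge k l p → f p = 0) : HasCompactSupport f := by
  refine HasCompactSupport.intro (isCompact_closedBall (0 : Plane) (2 * max R 1)) fun p hp => ?_
  by_contra hf
  refine hp ?_
  have h1 : gauge k l p < R := by
    by_contra hge
    exact hf (h p (not_lt.1 hge))
  have h2 : 0 ≤ p 0 ^ (2 * k) := by rw [pow_mul]; positivity
  have h3 : 0 ≤ p 1 ^ (2 * l) := by rw [pow_mul]; positivity
  have hR : R ≤ max R 1 := le_max_left _ _
  have hR1 : 1 ≤ max R 1 := le_max_right _ _
  unfold gauge at h1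
  have h4 := abs_le_of_pow_le hk hR1 (x := p 0) (by linarith)
  have h5 := abs_le_of_pow_le hl hR1 (x := p 1) (by linarith)
  rw [mem_closedBall_zero_iff, EuclideanSpace.norm_eq]
  refine Real.sqrt_le_iff.2 ⟨by positivity, ?_⟩
  simp only [Fin.sum_univ_two, Real.norm_eq_abs]
  nlinarith [abs_nonneg (p 0), abs_nonneg (p 1)]

/-- The function `p ↦ cutoff (A * gauge p)` as a Schwartz function. -/
noncomputable def gaugeCutoff {k l : ℕ} (hk : 1 ≤ k) (hl : 1 ≤ l) {A : ℝ} (hA : 0 < A) :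
    𝓢(Plane, ℂ) :=
  (hasCompactSupport_of_gauge hk hl (f := fun p => ((cutoff (A * gauge k l p) : ℝ) : ℂ)) (2 / A)
    fun p hp => by
      rw [div_le_iff₀' hA] at hp
      rw [cutoff_of_ge hp, Complex.ofReal_zero]).toSchwartzMap
    (Complex.ofRealCLM.contDiff.comp
      (contDiff_cutoff.comp (contDiff_const.mul (contDiff_gauge k l))))

theorem gaugeCutoff_apply {k l : ℕ} (hk : 1 ≤ k) (hl : 1 ≤ l) {A : ℝ} (hA : 0 < A) (p : Plane) :
    gaugeCutoff hk hl hA p = ((cutoff (A * gauge k l p) : ℝ) : ℂ) := rfl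

/-- The factor `A` is absorbed by the anisotropic dilation with $r=A^{1/(2kl)}$, so the bound is the
same at every scale. -/
theorem normL1_fourierInv_gaugeCutoff {k l : ℕ} (hk : 1 ≤ k) (hl : 1 ≤ l) {A : ℝ} (hA : 0 < A) :
    normL1 (𝓕⁻ (gaugeCutoff hk hl hA)) = normL1 (𝓕⁻ (gaugeCutoff hk hl one_pos)) := by
  have hr : 0 < A ^ (((2 * (k * l) : ℕ) : ℝ)⁻¹) := Real.rpow_pos_of_pos hA _
  refine normL1_fourierInv_comp_dilation _ _ (Units.mk0 _ (pow_pos hr l).ne')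
    (Units.mk0 _ (pow_pos hr k).ne') fun p => ?_
  have h := gauge_anisoDilation k l hr p
  rw [Real.rpow_inv_natCast_pow hA.le (by positivity)] at h
  rw [gaugeCutoff_apply, gaugeCutoff_apply, one_mul, ← h]
  rfl

/-- The difference of two cutoffs, supported where `1 / B ≤ gauge ≤ 2 / A`. -/
noncomputable def cutoffDiff (A B s : ℝ) : ℝ := cutoff (A * s) - cutoff (B * s)

theorem contDiff_symbol (k l : ℕ) (c : ℂ) {n : ℕ∞} :
    ContDiff ℝ n fun p : Plane => symbol k l c (p 0) (p 1) := by
  have h : ∀ j : Fin 2, ContDiff ℝ n fun p : Plane => ((p j : ℝ) : ℂ) := fun j =>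
    Complex.ofRealCLM.contDiff.comp (by fun_prop)
  unfold symbol
  exact ((contDiff_const.mul (h 0)).pow k).sub
    (contDiff_const.mul ((contDiff_const.mul (h 1)).pow l))

/-- Both cutoffs equal `1` near the origin, so the numerator vanishes around the only zero of the
symbol. -/
theorem contDiff_cutoffDiff_div {k l : ℕ} (hk : 1 ≤ k) (hl : 1 ≤ l) (A B : ℝ) {c : ℂ}
    (hc : ∀ p : Plane, p ≠ 0 → symbol k l c (p 0) (p 1) ≠ 0) {n : ℕ∞} :
    ContDiff ℝ n fun p : Plane =>
      ((cutoffDiff A B (gauge k l p) : ℝ) : ℂ) / symbol k l c (p 0) (p 1) := by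
  have hnum : ContDiff ℝ n fun p : Plane => ((cutoffDiff A B (gauge k l p) : ℝ) : ℂ) := by
    refine Complex.ofRealCLM.contDiff.comp ?_
    exact (contDiff_cutoff.comp (contDiff_const.mul (contDiff_gauge k l))).sub
      (contDiff_cutoff.comp (contDiff_const.mul (contDiff_gauge k l)))
  rw [contDiff_iff_contDiffAt]
  intro p
  by_cases hp : p = 0
  · have hg0 : gauge k l p = 0 := by
      rw [hp]
      simp [gauge, show k ≠ 0 by omega, show l ≠ 0 by omega]
    have hcont : Continuous (gauge k l) := (contDiff_gauge k l (n := 0)).continuous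
    have hev : ∀ D : ℝ, ∀ᶠ q in 𝓝 p, D * gauge k l q < 1 := fun D =>
      (continuous_const.mul hcont).continuousAt.eventually_lt continuousAt_const (by simp [hg0])
    refine contDiffAt_const (c := (0 : ℂ)) |>.congr_of_eventuallyEq ?_
    filter_upwards [hev A, hev B] with q h1 h2
    simp [cutoffDiff, cutoff_of_le h1.le, cutoff_of_le h2.le]
  · simp_rw [div_eq_mul_inv]
    exact hnum.contDiffAt.mul ((contDiff_symbol k l c).contDiffAt.inv (hc p hp))

/-- The Schwartz function `cutoffDiff A B gauge / symbol`. -/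
theorem exists_schwartz_cutoffDiff_div {k l : ℕ} (hk : 1 ≤ k) (hl : 1 ≤ l) {A B : ℝ} (hA : 0 < A)
    (hB : 0 < B) {c : ℂ} (hc : ∀ p : Plane, p ≠ 0 → symbol k l c (p 0) (p 1) ≠ 0) :
    ∃ u : 𝓢(Plane, ℂ), HasCompactSupport u ∧
      (∀ p, u p = ((cutoffDiff A B (gauge k l p) : ℝ) : ℂ) / symbol k l c (p 0) (p 1)) ∧
      normL1 (diffOp k l c (𝓕⁻ u)) ≤ 2 * normL1 (𝓕⁻ (gaugeCutoff hk hl one_pos)) := by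
  have hcs : HasCompactSupport fun p : Plane =>
      ((cutoffDiff A B (gauge k l p) : ℝ) : ℂ) / symbol k l c (p 0) (p 1) := by
    refine hasCompactSupport_of_gauge hk hl (max (2 / A) (2 / B)) fun p hp => ?_
    have h1 : 2 ≤ A * gauge k l p := (div_le_iff₀' hA).1 ((le_max_left _ _).trans hp)
    have h2 : 2 ≤ B * gauge k l p := (div_le_iff₀' hB).1 ((le_max_right _ _).trans hp)
    simp [cutoffDiff, cutoff_of_ge h1, cutoff_of_ge h2]
  refine ⟨hcs.toSchwartzMap (contDiff_cutoffDiff_div hk hl A B hc), hcs, fun p => rfl, ?_⟩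
  have h : diffOp k l c (𝓕⁻ (hcs.toSchwartzMap (contDiff_cutoffDiff_div hk hl A B hc))) =
      𝓕⁻ (gaugeCutoff hk hl hA - gaugeCutoff hk hl hB) := by
    refine diffOp_fourierInv k l c _ _ fun p => ?_
    rw [sub_apply, gaugeCutoff_apply, gaugeCutoff_apply, HasCompactSupport.toSchwartzMap_toFun]
    by_cases hp : p = 0
    · have hg0 : gauge k l p = 0 := by
        rw [hp]
        simp [gauge, show k ≠ 0 by omega, show l ≠ 0 by omega]
      simp [cutoffDiff, hg0]
    · rw [mul_div_cancel₀ _ (hc p hp), cutoffDiff, Complex.ofReal_sub]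
  have h2 : 𝓕⁻ (gaugeCutoff hk hl hA - gaugeCutoff hk hl hB) =
      𝓕⁻ (gaugeCutoff hk hl hA) - 𝓕⁻ (gaugeCutoff hk hl hB) := by
    rw [sub_eq_add_neg, FourierTransform.fourierInv_add, ← neg_one_smul ℂ,
      FourierTransform.fourierInv_smul, neg_one_smul, sub_eq_add_neg]
  rw [h, h2]
  refine (normL1_sub_le _ _).trans ?_
  rw [normL1_fourierInv_gaugeCutoff hk hl hA, normL1_fourierInv_gaugeCutoff hk hl hB, two_mul]

/-- The wider cutoff equals `1` wherever the narrower one is nonzero, so the product of the two test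
functions carries a single, nonnegative cutoff. -/
theorem cutoffDiff_mul_cutoffDiff {B : ℝ} {s : ℝ} (hs : 0 ≤ s) (hB : 1 ≤ B) :
    cutoffDiff 1 B s * cutoffDiff (1 / 2) (2 * B) s = cutoffDiff 1 B s := by
  by_cases h1 : 2 ≤ s
  · have : 2 ≤ B * s := by nlinarith
    simp [cutoffDiff, cutoff_of_ge h1, cutoff_of_ge this]
  by_cases h2 : B * s ≤ 1
  · have : s ≤ 1 := by nlinarith
    simp [cutoffDiff, cutoff_of_le h2, cutoff_of_le this]
  · push Not at h1 h2
    have e1 : cutoffDiff (1 / 2) (2 * B) s = 1 := by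
      rw [cutoffDiff, cutoff_of_le (by linarith), cutoff_of_ge (by linarith), sub_zero]
    rw [e1, mul_one]

theorem cutoffDiff_nonneg {B : ℝ} {s : ℝ} (hs : 0 ≤ s) (hB : 2 ≤ B) : 0 ≤ cutoffDiff 1 B s := by
  by_cases h1 : s ≤ 1
  · rw [cutoffDiff, one_mul, cutoff_of_le h1]
    linarith [cutoff_le_one (B * s)]
  · push Not at h1
    rw [cutoffDiff, cutoff_of_ge (s := B * s) (by nlinarith), sub_zero]
    exact cutoff_nonneg _

theorem cutoffDiff_eq_zero_of_notMem {B s : ℝ} (hB : 2 ≤ B) (h : s ∉ Ioc B⁻¹ 2) (hs : 0 < s) :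
    cutoffDiff 1 B s = 0 := by
  rw [mem_Ioc, not_and_or, not_lt, not_le] at h
  have hB0 : 0 < B := by linarith
  rcases h with h | h
  · have h2 : B * s ≤ 1 := by
      have := mul_le_mul_of_nonneg_left h hB0.le
      rwa [mul_inv_cancel₀ hB0.ne'] at this
    have : s ≤ 1 := by nlinarith
    simp [cutoffDiff, cutoff_of_le h2, cutoff_of_le this]
  · have : 2 ≤ B * s := by nlinarith
    simp [cutoffDiff, cutoff_of_ge h.le, cutoff_of_ge this]

theorem continuous_cutoffDiff (A B : ℝ) : Continuous (cutoffDiff A B) := by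
  have : Continuous cutoff := (contDiff_cutoff (n := 0)).continuous
  unfold cutoffDiff
  fun_prop

theorem integrableOn_inv_mul_cutoffDiff {B : ℝ} (hB : 2 ≤ B) :
    IntegrableOn (fun s : ℝ => s⁻¹ • cutoffDiff 1 B s) (Ioi 0) := by
  have hB0 : 0 < B := by linarith
  have hB1 : 0 < B⁻¹ := by positivity
  have h1 : IntegrableOn (fun s : ℝ => s⁻¹ • cutoffDiff 1 B s) (Ioc B⁻¹ 2) := by
    refine (ContinuousOn.integrableOn_compact (K := Icc B⁻¹ 2) isCompact_Icc ?_).mono_set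
      Ioc_subset_Icc_self
    refine ContinuousOn.smul (continuousOn_inv₀.mono fun s hs => ?_)
      (continuous_cutoffDiff _ _).continuousOn
    exact (lt_of_lt_of_le hB1 hs.1).ne'
  refine (h1.integrable_indicator measurableSet_Ioc).integrableOn.congr_fun (fun s hs => ?_)
    measurableSet_Ioi
  by_cases hm : s ∈ Ioc B⁻¹ 2
  · rw [indicator_of_mem hm]
  · rw [indicator_of_notMem hm]
    simp [cutoffDiff_eq_zero_of_notMem hB hm hs]

/-- The cutoff equals `1` on $(2/B,1]$, which alone contributes $\int ds/s=\log(B/2)$. -/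
theorem log_le_integral_cutoffDiff {B : ℝ} (hB : 2 ≤ B) :
    Real.log (B / 2) ≤ ∫ s in Ioi (0 : ℝ), s⁻¹ • cutoffDiff 1 B s := by
  have hB0 : 0 < B := by linarith
  have hB1 : 0 < 2 / B := by positivity
  have hB2 : 2 / B ≤ 1 := by rw [div_le_one hB0]; exact hB
  have h1 : Real.log (B / 2) = ∫ s in Ioc (2 / B) 1, s⁻¹ := by
    rw [← intervalIntegral.integral_of_le hB2, integral_inv_of_pos hB1 one_pos, one_div_div]
  have hsub : Ioc (2 / B) 1 ⊆ Ioi 0 := fun s hs => hB1.trans hs.1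
  rw [h1]
  refine le_trans (le_of_eq (setIntegral_congr_fun measurableSet_Ioc fun s hs => ?_))
    (setIntegral_mono_set (integrableOn_inv_mul_cutoffDiff hB) ?_
      (Filter.Eventually.of_forall hsub))
  · have : 2 ≤ B * s := by
      have := hs.1.le
      rwa [div_le_iff₀' hB0] at this
    simp [cutoffDiff, cutoff_of_ge this, cutoff_of_le hs.2]
  · refine (ae_restrict_iff' measurableSet_Ioi).2 (ae_of_all _ fun s hs => ?_)
    have hs : 0 < s := hs
    have := cutoffDiff_nonneg hs.le hB
    simp only [Pi.zero_apply, smul_eq_mul]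
    positivity

/-- After exchanging the integrals, invariance of $dr/r$ removes the factor $1+t^{2k}$: the radial
integral is the same for every $t$ and splits off. -/
theorem integral_cutoffDiff_mul_profile {k l : ℕ} (hl : 1 ≤ l) {B : ℝ} (hB : 2 ≤ B) {g : ℝ → ℂ}
    (hg : IntegrableOn g (Ioi 0)) :
    ∫ r in Ioi (0 : ℝ), r⁻¹ • ∫ t in Ioi (0 : ℝ),
      ((cutoffDiff 1 B (r ^ (2 * l) * (1 + t ^ (2 * k))) : ℝ) : ℂ) * g t =
      (((2 * l : ℝ)⁻¹ * ∫ s in Ioi (0 : ℝ), s⁻¹ • cutoffDiff 1 B s : ℝ) : ℂ) *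
        ∫ t in Ioi (0 : ℝ), g t := by
  have hl0 : (0 : ℝ) < 2 * l := by positivity
  have hc : ∀ t : ℝ, 0 < 1 + t ^ (2 * k) := fun t => by
    have : 0 ≤ t ^ (2 * k) := by rw [pow_mul]; positivity
    linarith
  have hpow : ∀ r t : ℝ, r ^ (2 * l) * (1 + t ^ (2 * k)) = (1 + t ^ (2 * k)) * r ^ (2 * l : ℝ) := by
    intro r t
    rw [mul_comm]
    congr 1
    exact_mod_cast (Real.rpow_natCast r (2 * l)).symm
  have hr : ∀ t : ℝ, IntegrableOn
      (fun r : ℝ => r⁻¹ • cutoffDiff 1 B (r ^ (2 * l) * (1 + t ^ (2 * k)))) (Ioi 0) := fun t => by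
    simp_rw [hpow]
    exact integrableOn_inv_smul_comp_mul_rpow (hc t) hl0 (integrableOn_inv_mul_cutoffDiff hB)
  have hrI : ∀ t : ℝ, ∫ r in Ioi (0 : ℝ), r⁻¹ • cutoffDiff 1 B (r ^ (2 * l) * (1 + t ^ (2 * k))) =
      (2 * l : ℝ)⁻¹ * ∫ s in Ioi (0 : ℝ), s⁻¹ • cutoffDiff 1 B s := fun t => by
    simp_rw [hpow]
    rw [integral_inv_smul_comp_mul_rpow (cutoffDiff 1 B) (hc t) hl0, smul_eq_mul]
  set T : ℝ := (2 * l : ℝ)⁻¹ * ∫ s in Ioi (0 : ℝ), s⁻¹ • cutoffDiff 1 B s with hT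
  have hint : Integrable (fun z : ℝ × ℝ =>
      ((z.1⁻¹ • cutoffDiff 1 B (z.1 ^ (2 * l) * (1 + z.2 ^ (2 * k))) : ℝ) : ℂ) * g z.2)
      ((volume.restrict (Ioi 0)).prod (volume.restrict (Ioi 0))) := by
    -- Since the cutoff is nonnegative, the radial integral of the norm is exactly `T * ‖g t‖`.
    rw [integrable_prod_iff']
    · refine ⟨ae_of_all _ fun t => ((hr t).ofReal.mul_const (g t)), ?_⟩
      refine (hg.norm.const_mul T).congr (ae_of_all _ fun t => ?_)
      simp only [norm_mul]
      rw [integral_mul_const]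
      congr 1
      rw [← hrI t]
      refine setIntegral_congr_fun measurableSet_Ioi fun r hr => ?_
      have hr : 0 < r := hr
      have h2 := cutoffDiff_nonneg (B := B) (s := r ^ (2 * l) * (1 + t ^ (2 * k)))
        (mul_nonneg (by positivity) (hc t).le) hB
      rw [Complex.norm_real, Real.norm_of_nonneg]
      rw [smul_eq_mul]
      positivity
    · refine AEStronglyMeasurable.mul ?_ hg.aestronglyMeasurable.comp_snd
      have := (continuous_cutoffDiff 1 B).measurable
      have h3 : Measurable fun z : ℝ × ℝ =>
        ((z.1⁻¹ • cutoffDiff 1 B (z.1 ^ (2 * l) * (1 + z.2 ^ (2 * k))) : ℝ) : ℂ) := by fun_prop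
      exact h3.aestronglyMeasurable
  calc _ = ∫ r in Ioi (0 : ℝ), ∫ t in Ioi (0 : ℝ),
        ((r⁻¹ • cutoffDiff 1 B (r ^ (2 * l) * (1 + t ^ (2 * k))) : ℝ) : ℂ) * g t := by
        refine setIntegral_congr_fun measurableSet_Ioi fun r _ => ?_
        rw [← integral_smul]
        refine setIntegral_congr_fun measurableSet_Ioi fun t _ => ?_
        simp only [Complex.real_smul, smul_eq_mul]
        push_cast
        ring
    _ = ∫ t in Ioi (0 : ℝ), ∫ r in Ioi (0 : ℝ),
        ((r⁻¹ • cutoffDiff 1 B (r ^ (2 * l) * (1 + t ^ (2 * k))) : ℝ) : ℂ) * g t :=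
        integral_integral_swap hint
    _ = ∫ t in Ioi (0 : ℝ), (T : ℂ) * g t := by
        refine setIntegral_congr_fun measurableSet_Ioi fun t _ => ?_
        rw [integral_mul_const, integral_complex_ofReal, hrI t]
    _ = _ := integral_const_mul _ _

/-- With $\hat f,\hat g$ equal to cutoffs divided by the symbols, the right side is bounded
independently of `B`. The left side is the mean times a radial integral of size at least a multiple
of $\log(B/2)$. -/
theorem BE.multiplierMean_eq_zero {k l : ℕ} (hk : 1 ≤ k) (hl : 1 ≤ l) {α β : ℝ} (hα : 0 ≤ α)
    (hβ : 0 ≤ β) {σ τ : ℂ} (hell : Elliptic k l σ τ) (h : BE k l α β σ τ)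
    (hsc : (l : ℝ) * (2 * α + 1) + k * (2 * β + 1) = 2 * k * l) (hα1 : 2 * α + 1 < 2 * k) :
    multiplierMean k l (2 * α) (tauOne k l τ) (sigmaOne k l σ) = 0 := by
  obtain ⟨C, hC⟩ := h
  obtain ⟨hσ, hτ⟩ := hell
  have hp0 : ∀ p : Plane, p ≠ 0 → ¬(p 0 = 0 ∧ p 1 = 0) := fun p hp h0 => hp (by
    ext i; fin_cases i
    · exact h0.1
    · exact h0.2)
  set a := tauOne k l τ with ha
  set b := sigmaOne k l σ with hb
  set M := multiplierMean k l (2 * α) a b with hM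
  set N := normL1 (𝓕⁻ (gaugeCutoff hk hl one_pos)) with hN
  have hN0 : 0 ≤ N := normL1_nonneg _
  set K : ℝ := |C| * (2 * N * (2 * N)) * (2 * Real.pi) ^ (2 * k) * (2 * l) with hK
  have hπ : (0 : ℝ) < (2 * Real.pi) ^ (2 * k) := by positivity
  have hmain : ∀ B : ℝ, 2 ≤ B → Real.log (B / 2) * ‖M‖ ≤ K := by
    intro B hB
    have hB0 : 0 < B := by linarith
    obtain ⟨u, hucs, hu, hun⟩ := exists_schwartz_cutoffDiff_div hk hl one_pos hB0 (c := τ)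
      fun p hp => symbol_ne_zero hτ (hp0 p hp)
    obtain ⟨v, -, hv, hvn⟩ := exists_schwartz_cutoffDiff_div hk hl (half_pos one_pos)
      (by positivity : 0 < 2 * B) (c := σ) fun p hp => symbol_ne_zero' hσ (hp0 p hp)
    have key := hC (𝓕⁻ u) (𝓕⁻ v)
    rw [sobolevInner_fourierInv] at key
    have hint : Integrable fun p : Plane =>
        u p * conj (v p) * ((|p 0| ^ (2 * α) * |p 1| ^ (2 * β) : ℝ) : ℂ) := by
      refine Continuous.integrable_of_hasCompactSupport ?_ ?_
      · exact (u.continuous.mul (Complex.continuous_conj.comp v.continuous)).mul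
          (Complex.continuous_ofReal.comp (continuous_weight hα hβ))
      · exact (hucs.mul_right (f' := fun p => conj (v p))).mul_right
    set Θ : ℝ → ℝ → ℂ := fun x y =>
      (((2 * Real.pi) ^ (2 * k))⁻¹ : ℝ) * ((cutoffDiff 1 B (x ^ (2 * k) + y ^ (2 * l)) : ℝ) : ℂ)
      with hΘ
    have hpt : ∀ p : Plane, u p * conj (v p) * ((|p 0| ^ (2 * α) * |p 1| ^ (2 * β) : ℝ) : ℂ) =
        Θ (p 0) (p 1) * multiplier k l (2 * α) (2 * β) a b (p 0) (p 1) := by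
      intro p
      have h1 : ((cutoffDiff 1 B (gauge k l p) : ℝ) : ℂ) =
          ((cutoffDiff 1 B (gauge k l p) : ℝ) : ℂ) *
            ((cutoffDiff (1 / 2) (2 * B) (gauge k l p) : ℝ) : ℂ) := by
        rw [← Complex.ofReal_mul, cutoffDiff_mul_cutoffDiff (gauge_nonneg k l p) (by linarith)]
      have h2 : Θ (p 0) (p 1) = (((2 * Real.pi) ^ (2 * k))⁻¹ : ℝ) *
          ((cutoffDiff 1 B (gauge k l p) : ℝ) : ℂ) := rfl
      rw [h2, h1, hu, hv, map_div₀, Complex.conj_ofReal, div_mul_div_comm,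
        symbol_mul_conj_symbol, multiplier, div_eq_mul_inv, mul_inv]
      push_cast
      ring
    simp_rw [hpt] at key hint
    rw [integral_plane fun z : ℝ × ℝ =>
      Θ z.1 z.2 * multiplier k l (2 * α) (2 * β) a b z.1 z.2] at key
    have hint' := integrable_plane (H := fun z : ℝ × ℝ =>
      Θ z.1 z.2 * multiplier k l (2 * α) (2 * β) a b z.1 z.2) |>.1 hint
    rw [integral_mul_multiplier hk hsc a b hint'] at key
    set T : ℝ := (2 * l : ℝ)⁻¹ * ∫ s in Ioi (0 : ℝ), s⁻¹ • cutoffDiff 1 B s with hT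
    have hsum : (∑ ε₁ : ℤˣ, ∑ ε₂ : ℤˣ, ∫ r in Ioi (0 : ℝ), r⁻¹ • ∫ t in Ioi (0 : ℝ),
        Θ (((ε₁ : ℤ) : ℝ) * (r ^ ((l : ℝ) / k) * t)) (((ε₂ : ℤ) : ℝ) * r) *
          profile k (2 * α) (-(quadSign k l ε₁ ε₂ * a)) (-(quadSign k l ε₁ ε₂ * b)) t) =
        (((2 * Real.pi) ^ (2 * k))⁻¹ : ℝ) * ((T : ℂ) * M) := by
      rw [hM, multiplierMean, Finset.mul_sum, Finset.mul_sum]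
      refine Finset.sum_congr rfl fun ε₁ _ => ?_
      rw [Finset.mul_sum, Finset.mul_sum]
      refine Finset.sum_congr rfl fun ε₂ _ => ?_
      have hprof := integrableOn_profile hk (p := 2 * α) (by linarith) hα1
        (hτ.neg_quadSign_mul_mem hk ε₁ ε₂) (hσ.neg_quadSign_mul_mem hk ε₁ ε₂)
      rw [← integral_cutoffDiff_mul_profile (k := k) hl hB hprof, ← integral_const_mul]
      refine setIntegral_congr_fun measurableSet_Ioi fun r hr => ?_
      have hr : 0 < r := hr
      rw [mul_smul_comm, ← integral_const_mul]
      congr 1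
      refine setIntegral_congr_fun measurableSet_Ioi fun t ht => ?_
      have hR : (r ^ ((l : ℝ) / k)) ^ (2 * k) = r ^ (2 * l) := by
        rw [← Real.rpow_natCast, ← Real.rpow_natCast, ← Real.rpow_mul hr.le]
        congr 1
        have : (k : ℝ) ≠ 0 := by positivity
        push_cast
        field_simp
      have hε : ∀ (ε : ℤˣ) (n : ℕ), (((ε : ℤ) : ℝ)) ^ (2 * n) = 1 := fun ε n => by
        rcases Int.units_eq_one_or ε with rfl | rfl <;> simp
      have harg : (((ε₁ : ℤ) : ℝ) * (r ^ ((l : ℝ) / k) * t)) ^ (2 * k) +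
          (((ε₂ : ℤ) : ℝ) * r) ^ (2 * l) = r ^ (2 * l) * (1 + t ^ (2 * k)) := by
        rw [mul_pow, mul_pow, mul_pow, hε, hε, hR]
        ring
      simp only [hΘ, harg]
      ring
    rw [hsum] at key
    have hTle : (2 * l : ℝ)⁻¹ * Real.log (B / 2) ≤ T :=
      mul_le_mul_of_nonneg_left (log_le_integral_cutoffDiff hB) (by positivity)
    have hlog : 0 ≤ Real.log (B / 2) := Real.log_nonneg (by linarith)
    have hT0 : 0 ≤ T := le_trans (by positivity) hTle
    rw [norm_mul, norm_mul, Complex.norm_real, Complex.norm_real, Real.norm_of_nonneg hT0,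
      Real.norm_of_nonneg (by positivity)] at key
    have key2 : ((2 * Real.pi) ^ (2 * k))⁻¹ * (T * ‖M‖) ≤ |C| * (2 * N * (2 * N)) := by
      refine key.trans ((mul_le_mul_of_nonneg_right (le_abs_self C) ?_).trans ?_)
      · exact mul_nonneg (normL1_nonneg _) (normL1_nonneg _)
      · refine mul_le_mul_of_nonneg_left ?_ (abs_nonneg _)
        exact mul_le_mul hun hvn (normL1_nonneg _) (by positivity)
    rw [inv_mul_le_iff₀ hπ] at key2
    have hl0 : (0 : ℝ) < 2 * l := by positivity
    rw [inv_mul_le_iff₀ hl0] at hTle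
    calc Real.log (B / 2) * ‖M‖ ≤ 2 * l * T * ‖M‖ :=
          mul_le_mul_of_nonneg_right hTle (norm_nonneg _)
      _ = 2 * l * (T * ‖M‖) := by ring
      _ ≤ 2 * l * ((2 * Real.pi) ^ (2 * k) * (|C| * (2 * N * (2 * N)))) :=
          mul_le_mul_of_nonneg_left key2 hl0.le
      _ = K := by rw [hK]; ring
  by_contra hM0
  have hMpos : 0 < ‖M‖ := norm_pos_iff.2 hM0
  have hK0 : 0 ≤ K := by positivity
  -- This `B` makes the left side equal to `K + ‖M‖`.
  have h1 := hmain (2 * Real.exp (K / ‖M‖ + 1)) (by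
    have : 1 ≤ Real.exp (K / ‖M‖ + 1) := Real.one_le_exp (by positivity)
    linarith)
  rw [mul_div_cancel_left₀ _ two_ne_zero, Real.log_exp, add_mul, one_mul,
    div_mul_cancel₀ _ hMpos.ne'] at h1
  linarith

/-! ### Oscillatory integrals over the half-line -/

/-- The power $1/2$ replaces the Lipschitz bound because $t\,g(t)$ need not be integrable when $g$
decays only like $t^{-2}$, as the profile does for $k=1$. -/
theorem norm_exp_ofReal_mul_I_sub_one_le (θ : ℝ) :
    ‖Complex.exp (θ * Complex.I) - 1‖ ≤ 2 * |θ| ^ (1 / 2 : ℝ) := by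
  rcases le_total |θ| 1 with h | h
  · have h1 : ‖Complex.exp (θ * Complex.I) - 1‖ ≤ |θ| := by
      rw [mul_comm]
      exact Real.norm_exp_I_mul_ofReal_sub_one_le
    have h2 : |θ| ^ (1 : ℝ) ≤ |θ| ^ (1 / 2 : ℝ) := by
      rcases eq_or_lt_of_le (abs_nonneg θ) with h0 | h0
      · rw [← h0]; simp
      · exact Real.rpow_le_rpow_of_exponent_ge h0 h (by norm_num)
    rw [Real.rpow_one] at h2
    have h3 := Real.rpow_nonneg (abs_nonneg θ) (1 / 2)
    linarith
  · have h1 : ‖Complex.exp (θ * Complex.I) - 1‖ ≤ 2 := by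
      refine (norm_sub_le _ _).trans ?_
      rw [Complex.norm_exp_ofReal_mul_I, norm_one]
      norm_num
    have h2 : 1 ≤ |θ| ^ (1 / 2 : ℝ) := Real.one_le_rpow h (by norm_num)
    linarith

/-- The Fourier integral of a function over the positive half-line. -/
noncomputable def halfFourier (g : ℝ → ℂ) (z : ℝ) : ℂ :=
  ∫ t in Ioi (0 : ℝ), Complex.exp ((-2 * Real.pi * z * t : ℝ) * Complex.I) * g t

theorem halfFourier_zero (g : ℝ → ℂ) : halfFourier g 0 = ∫ t in Ioi (0 : ℝ), g t := by
  simp [halfFourier]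

theorem integrableOn_one_add_inv_sq :
    IntegrableOn (fun t : ℝ => ((1 + t)⁻¹) ^ 2) (Ioi 0) := by
  have h := integrableOn_rpow_mul_one_add_rpow (p := 0) (q := -2) (by norm_num) (by norm_num)
  refine h.congr_fun (fun t ht => ?_) measurableSet_Ioi
  have ht : 0 < t := ht
  simp only [Real.rpow_zero, one_mul]
  rw [Real.rpow_neg (by linarith), inv_pow]
  norm_cast

theorem exists_norm_halfFourier_sub_le {g : ℝ → ℂ} {C : ℝ}
    (hm : AEStronglyMeasurable g (volume.restrict (Ioi 0)))
    (hg : ∀ t, 0 < t → ‖g t‖ ≤ C * ((1 + t)⁻¹) ^ 2) :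
    ∃ C', 0 ≤ C' ∧ ∀ z, ‖halfFourier g z - halfFourier g 0‖ ≤ C' * |z| ^ (1 / 2 : ℝ) := by
  have hgi : IntegrableOn g (Ioi 0) := Integrable.mono' (integrableOn_one_add_inv_sq.const_mul C) hm
    ((ae_restrict_iff' measurableSet_Ioi).2 (ae_of_all _ fun t ht => hg t ht))
  have hC : 0 ≤ C := by
    have h1 := (norm_nonneg _).trans (hg 1 one_pos)
    norm_num at h1
    linarith
  have hi : IntegrableOn (fun t : ℝ => t ^ (1 / 2 : ℝ) * (1 + t) ^ (-2 : ℝ)) (Ioi 0) :=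
    integrableOn_rpow_mul_one_add_rpow (by norm_num) (by norm_num)
  refine ⟨2 * (2 * Real.pi) ^ (1 / 2 : ℝ) * C *
    ∫ t in Ioi (0 : ℝ), t ^ (1 / 2 : ℝ) * (1 + t) ^ (-2 : ℝ), ?_, fun z => ?_⟩
  · refine mul_nonneg (by positivity) (setIntegral_nonneg measurableSet_Ioi fun t ht => ?_)
    have ht : 0 < t := ht
    positivity
  · rw [halfFourier_zero, halfFourier, ← integral_sub ?_ hgi]
    · have hb : ∀ t ∈ Ioi (0 : ℝ),
          ‖Complex.exp ((-2 * Real.pi * z * t : ℝ) * Complex.I) * g t - g t‖ ≤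
          (2 * (2 * Real.pi) ^ (1 / 2 : ℝ) * C * |z| ^ (1 / 2 : ℝ)) *
            (t ^ (1 / 2 : ℝ) * (1 + t) ^ (-2 : ℝ)) := by
        intro t ht
        have ht : 0 < t := ht
        have h1 := norm_exp_ofReal_mul_I_sub_one_le (-2 * Real.pi * z * t)
        have h2 : |(-2 * Real.pi * z * t)| = 2 * Real.pi * |z| * t := by
          rw [abs_mul, abs_mul, abs_of_pos ht, neg_mul, abs_neg,
            abs_of_pos (by positivity : 0 < 2 * Real.pi)]
        rw [h2, Real.mul_rpow (by positivity) ht.le, Real.mul_rpow (by positivity) (abs_nonneg z)]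
          at h1
        have h3 : (1 + t) ^ (-2 : ℝ) = ((1 + t)⁻¹) ^ 2 := by
          rw [Real.rpow_neg (by linarith), inv_pow]; norm_cast
        rw [← sub_one_mul, norm_mul, h3]
        calc _ ≤ (2 * ((2 * Real.pi) ^ (1 / 2 : ℝ) * |z| ^ (1 / 2 : ℝ) * t ^ (1 / 2 : ℝ))) *
              (C * ((1 + t)⁻¹) ^ 2) :=
              mul_le_mul h1 (hg t ht) (norm_nonneg _) (by positivity)
          _ = _ := by ring
      refine (norm_integral_le_of_norm_le (hi.const_mul _)
        ((ae_restrict_iff' measurableSet_Ioi).2 (ae_of_all _ hb))).trans (le_of_eq ?_)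
      rw [integral_const_mul]
      ring
    · refine Integrable.bdd_mul (c := 1) hgi (by fun_prop) (ae_of_all _ fun t => ?_)
      rw [Complex.norm_exp_ofReal_mul_I]

/-- Integration by parts. The boundary value `g 0` need not vanish, so the decay obtained is of
order $1/|z|$. -/
theorem exists_abs_mul_norm_halfFourier_le {g g' : ℝ → ℂ} {C C' : ℝ}
    (hm' : AEStronglyMeasurable g' (volume.restrict (Ioi 0)))
    (hcont : ContinuousWithinAt g (Ici 0) 0)
    (hd : ∀ t, 0 < t → HasDerivAt g (g' t) t)
    (hg : ∀ t, 0 < t → ‖g t‖ ≤ C * ((1 + t)⁻¹) ^ 2)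
    (hg' : ∀ t, 0 < t → ‖g' t‖ ≤ C' * ((1 + t)⁻¹) ^ 2) :
    ∃ K, 0 ≤ K ∧ ∀ z, |z| * ‖halfFourier g z‖ ≤ K := by
  have hgc : ContinuousOn g (Ioi 0) := fun t ht => (hd t ht).continuousAt.continuousWithinAt
  have hgi : IntegrableOn g (Ioi 0) := Integrable.mono' (integrableOn_one_add_inv_sq.const_mul C)
    (hgc.aestronglyMeasurable measurableSet_Ioi)
    ((ae_restrict_iff' measurableSet_Ioi).2 (ae_of_all _ fun t ht => hg t ht))
  have hgi' : IntegrableOn g' (Ioi 0) := Integrable.mono' (integrableOn_one_add_inv_sq.const_mul C')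
    hm' ((ae_restrict_iff' measurableSet_Ioi).2 (ae_of_all _ fun t ht => hg' t ht))
  have hlim : Tendsto (fun t : ℝ => C * ((1 + t)⁻¹) ^ 2) atTop (𝓝 0) := by
    have h1 : Tendsto (fun t : ℝ => (1 + t)⁻¹) atTop (𝓝 0) :=
      tendsto_inv_atTop_zero.comp (tendsto_atTop_add_const_left _ _ tendsto_id)
    simpa using (h1.pow 2).const_mul C
  refine ⟨(‖g 0‖ + ∫ t in Ioi (0 : ℝ), ‖g' t‖) / (2 * Real.pi),
    div_nonneg (add_nonneg (norm_nonneg _) (integral_nonneg fun _ => norm_nonneg _))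
      (by positivity), fun z => ?_⟩
  set e : ℝ → ℂ := fun t => Complex.exp ((-2 * Real.pi * z * t : ℝ) * Complex.I) with he
  have hen : ∀ t, ‖e t‖ = 1 := fun t => Complex.norm_exp_ofReal_mul_I _
  have hem : Continuous e := by simp only [he]; fun_prop
  set ω : ℂ := ((-2 * Real.pi * z : ℝ) : ℂ) * Complex.I with hω
  have hed : ∀ t, HasDerivAt e (e t * ω) t := fun t => by
    have h1 : HasDerivAt (fun t : ℝ => ((-2 * Real.pi * z * t : ℝ) : ℂ) * Complex.I) ω t := by
      have h2 := ((hasDerivAt_id t).const_mul (-2 * Real.pi * z)).ofReal_comp.mul_const Complex.I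
      simpa [hω] using h2
    exact h1.cexp
  have hi1 : IntegrableOn (fun t => e t * g t) (Ioi 0) :=
    Integrable.bdd_mul (c := 1) hgi hem.aestronglyMeasurable (ae_of_all _ fun t => (hen t).le)
  have hi2 : IntegrableOn (fun t => e t * g' t) (Ioi 0) :=
    Integrable.bdd_mul (c := 1) hgi' hem.aestronglyMeasurable (ae_of_all _ fun t => (hen t).le)
  have hint : IntegrableOn (fun t => e t * ω * g t + e t * g' t) (Ioi 0) := by
    refine Integrable.add ?_ hi2
    refine (hi1.const_mul ω).congr (ae_of_all _ fun t => ?_)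
    simp only
    ring
  have htend : Tendsto (fun t => e t * g t) atTop (𝓝 0) := by
    refine squeeze_zero_norm' ?_ hlim
    filter_upwards [eventually_gt_atTop 0] with t ht
    rw [norm_mul, hen, one_mul]
    exact hg t ht
  have key := integral_Ioi_of_hasDerivAt_of_tendsto (f := fun t => e t * g t)
    (hem.continuousWithinAt.mul hcont) (fun t ht => (hed t).mul (hd t ht)) hint htend
  have h0 : e 0 = 1 := by simp [he]
  have hsplit : ∫ t in Ioi (0 : ℝ), (e t * ω * g t + e t * g' t) =
      ω * halfFourier g z + ∫ t in Ioi (0 : ℝ), e t * g' t := by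
    have h2 : IntegrableOn (fun t => e t * ω * g t) (Ioi 0) :=
      (hi1.const_mul ω).congr (ae_of_all _ fun t => by simp only; ring)
    rw [integral_add h2 hi2, halfFourier, ← integral_const_mul]
    congr 1
    refine integral_congr_ae (ae_of_all _ fun t => ?_)
    simp only [he]
    ring
  rw [hsplit, h0, one_mul, zero_sub] at key
  have h3 : ω * halfFourier g z = -(g 0 + ∫ t in Ioi (0 : ℝ), e t * g' t) := by
    linear_combination key
  have h4 : ‖ω * halfFourier g z‖ ≤ ‖g 0‖ + ∫ t in Ioi (0 : ℝ), ‖g' t‖ := by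
    rw [h3, norm_neg]
    refine (norm_add_le _ _).trans (add_le_add_right ?_ _)
    refine (norm_integral_le_integral_norm _).trans (le_of_eq ?_)
    simp [hen]
  have h5 : ‖ω‖ = 2 * Real.pi * |z| := by
    rw [hω, norm_mul, Complex.norm_I, mul_one, Complex.norm_real, Real.norm_eq_abs, abs_mul,
      neg_mul, abs_neg, abs_of_pos (by positivity : 0 < 2 * Real.pi)]
  rw [norm_mul, h5] at h4
  rw [le_div_iff₀ (by positivity)]
  linarith

/-- Outside the unit interval the half-line Fourier integral decays, and inside it is close to its
value at the origin. -/
theorem exists_norm_halfFourier_sub_ite_le {g g' : ℝ → ℂ} {C C' : ℝ}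
    (hm' : AEStronglyMeasurable g' (volume.restrict (Ioi 0)))
    (hcont : ContinuousWithinAt g (Ici 0) 0)
    (hd : ∀ t, 0 < t → HasDerivAt g (g' t) t)
    (hg : ∀ t, 0 < t → ‖g t‖ ≤ C * ((1 + t)⁻¹) ^ 2)
    (hg' : ∀ t, 0 < t → ‖g' t‖ ≤ C' * ((1 + t)⁻¹) ^ 2) :
    ∃ K, 0 ≤ K ∧ ∀ z, ‖halfFourier g z - if |z| ≤ 1 then halfFourier g 0 else 0‖ ≤
      K * (|z| ^ (1 / 2 : ℝ) * (1 + |z|)⁻¹) := by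
  have hgc : ContinuousOn g (Ioi 0) := fun t ht => (hd t ht).continuousAt.continuousWithinAt
  obtain ⟨K₁, hK₁, h1⟩ := exists_norm_halfFourier_sub_le
    (hgc.aestronglyMeasurable measurableSet_Ioi) hg
  obtain ⟨K₂, hK₂, h2⟩ := exists_abs_mul_norm_halfFourier_le hm' hcont hd hg hg'
  refine ⟨2 * K₁ + 2 * K₂, by positivity, fun z => ?_⟩
  have hz0 := abs_nonneg z
  have hr0 := Real.rpow_nonneg hz0 (1 / 2)
  split_ifs with hz
  · refine (h1 z).trans ?_
    have h3 : (1 : ℝ) ≤ 2 * (1 + |z|)⁻¹ := by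
      rw [← div_eq_mul_inv, le_div_iff₀ (by positivity)]; linarith
    calc K₁ * |z| ^ (1 / 2 : ℝ) ≤ K₁ * |z| ^ (1 / 2 : ℝ) * (2 * (1 + |z|)⁻¹) :=
          le_mul_of_one_le_right (by positivity) h3
      _ = 2 * K₁ * (|z| ^ (1 / 2 : ℝ) * (1 + |z|)⁻¹) := by ring
      _ ≤ _ := mul_le_mul_of_nonneg_right (by linarith) (by positivity)
  · push Not at hz
    rw [sub_zero]
    have h3 : ‖halfFourier g z‖ ≤ K₂ * |z|⁻¹ := by
      rw [← div_eq_mul_inv, le_div_iff₀' (by linarith)]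
      exact h2 z
    have h4 : |z|⁻¹ ≤ 2 * (1 + |z|)⁻¹ := by
      rw [← div_eq_mul_inv, inv_le_iff_one_le_mul₀ (by linarith), div_mul_eq_mul_div,
        le_div_iff₀ (by positivity)]
      linarith
    have h5 : 1 ≤ |z| ^ (1 / 2 : ℝ) := Real.one_le_rpow hz.le (by norm_num)
    calc ‖halfFourier g z‖ ≤ K₂ * (2 * (1 + |z|)⁻¹) :=
          h3.trans (mul_le_mul_of_nonneg_left h4 hK₂)
      _ ≤ K₂ * (2 * (1 + |z|)⁻¹) * |z| ^ (1 / 2 : ℝ) :=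
          le_mul_of_one_le_right (by positivity) h5
      _ = 2 * K₂ * (|z| ^ (1 / 2 : ℝ) * (1 + |z|)⁻¹) := by ring
      _ ≤ _ := mul_le_mul_of_nonneg_right (by linarith) (by positivity)

/-! ### The critical profile -/

theorem one_add_pow_le (k : ℕ) {t : ℝ} (ht : 0 ≤ t) : (1 + t) ^ k ≤ 2 ^ k * (1 + t ^ k) := by
  have h : (1 + t) ^ k ≤ (2 * max 1 t) ^ k :=
    pow_le_pow_left₀ (by linarith) (by linarith [le_max_left 1 t, le_max_right 1 t]) k
  refine h.trans ?_
  rw [mul_pow]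
  refine mul_le_mul_of_nonneg_left ?_ (by positivity)
  rcases max_cases 1 t with ⟨h, _⟩ | ⟨h, _⟩ <;> rw [h]
  · rw [one_pow]; linarith [pow_nonneg ht k]
  · linarith

theorem exists_norm_inv_pow_add_le (k : ℕ) {c : ℂ} (hc : c ∈ Complex.slitPlane) :
    ∃ K, 0 ≤ K ∧ ∀ t : ℝ, 0 ≤ t → ‖((t : ℂ) ^ k + c)⁻¹‖ ≤ K * ((1 + t)⁻¹) ^ k := by
  obtain ⟨κ, hκ, h⟩ := exists_mul_one_add_le_norm_add hc
  refine ⟨κ⁻¹ * 2 ^ k, by positivity, fun t ht => ?_⟩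
  have h1 := h (t ^ k) (pow_nonneg ht k)
  push_cast at h1
  have h2 := one_add_pow_le k ht
  have h3 : 0 < (1 + t) ^ k := by positivity
  have h4 : (1 + t) ^ k * κ ≤ 2 ^ k * ‖(t : ℂ) ^ k + c‖ := by
    calc (1 + t) ^ k * κ ≤ 2 ^ k * (1 + t ^ k) * κ := mul_le_mul_of_nonneg_right h2 hκ.le
      _ = 2 ^ k * (κ * (1 + t ^ k)) := by ring
      _ ≤ _ := mul_le_mul_of_nonneg_left h1 (by positivity)
  have h5 : 0 < ‖(t : ℂ) ^ k + c‖ := by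
    have : 0 < 1 + t ^ k := by positivity
    exact lt_of_lt_of_le (by positivity) h1
  rw [norm_inv, inv_pow, inv_le_iff_one_le_mul₀ h5]
  field_simp
  linarith

theorem pow_mul_inv_one_add_pow_le {n m : ℕ} (h : n + 2 ≤ m) {t : ℝ} (ht : 0 ≤ t) :
    t ^ n * ((1 + t)⁻¹) ^ m ≤ ((1 + t)⁻¹) ^ 2 := by
  obtain ⟨j, rfl⟩ := Nat.exists_eq_add_of_le h
  have h0 : 0 < 1 + t := by linarith
  have h1 : (1 + t)⁻¹ ≤ 1 := inv_le_one_of_one_le₀ (by linarith)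
  have h2 : t * (1 + t)⁻¹ ≤ 1 := by
    rw [← div_eq_mul_inv, div_le_one h0]; linarith
  calc t ^ n * ((1 + t)⁻¹) ^ (n + 2 + j) =
        (t * (1 + t)⁻¹) ^ n * ((1 + t)⁻¹) ^ j * ((1 + t)⁻¹) ^ 2 := by ring
    _ ≤ 1 * 1 * ((1 + t)⁻¹) ^ 2 := by
        refine mul_le_mul_of_nonneg_right ?_ (by positivity)
        exact mul_le_mul (pow_le_one₀ (by positivity) h2) (pow_le_one₀ (by positivity) h1)
          (by positivity) zero_le_one
    _ = _ := by ring

/-- At the critical exponent the factor $t^{k-1}$ is an integer power, so the profile is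
differentiable up to the origin, and it and its derivative are $O((1+t)^{-2})$. -/
theorem exists_norm_halfFourier_profile_sub_ite_le {k : ℕ} (hk : 1 ≤ k) {c d : ℂ}
    (hc : c ∈ Complex.slitPlane) (hd : d ∈ Complex.slitPlane) :
    ∃ K, 0 ≤ K ∧ ∀ z, ‖halfFourier (profile k ((k : ℝ) - 1) c d) z -
      if |z| ≤ 1 then halfFourier (profile k ((k : ℝ) - 1) c d) 0 else 0‖ ≤
        K * (|z| ^ (1 / 2 : ℝ) * (1 + |z|)⁻¹) := by
  obtain ⟨K₁, hK₁, h1⟩ := exists_norm_inv_pow_add_le k hc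
  obtain ⟨K₂, hK₂, h2⟩ := exists_norm_inv_pow_add_le k hd
  have hc0 : ∀ t : ℝ, 0 ≤ t → (t : ℂ) ^ k + c ≠ 0 := fun t ht => by
    have := ofReal_add_ne_zero hc (pow_nonneg ht k)
    push_cast at this
    exact this
  have hd0 : ∀ t : ℝ, 0 ≤ t → (t : ℂ) ^ k + d ≠ 0 := fun t ht => by
    have := ofReal_add_ne_zero hd (pow_nonneg ht k)
    push_cast at this
    exact this
  set A : ℝ → ℂ := fun t => ((t : ℂ) ^ k + c)⁻¹ with hA
  set B : ℝ → ℂ := fun t => ((t : ℂ) ^ k + d)⁻¹ with hB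
  have hprof : profile k ((k : ℝ) - 1) c d = fun t : ℝ => (t : ℂ) ^ (k - 1) * (A t * B t) := by
    ext t
    have : (k : ℝ) - 1 = ((k - 1 : ℕ) : ℝ) := by push_cast [hk]; ring
    simp only [profile, this, Real.rpow_natCast, hA, hB, mul_inv]
    push_cast
    ring
  rw [hprof]
  have hpow : ∀ (n : ℕ) (t : ℝ), HasDerivAt (fun t : ℝ => (t : ℂ) ^ n) (n * (t : ℂ) ^ (n - 1)) t :=
    fun n t => by
      have h := (hasDerivAt_id t).ofReal_comp.pow n
      simp only [id, Complex.ofReal_one, mul_one] at h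
      exact h
  have hAd : ∀ t : ℝ, 0 ≤ t → HasDerivAt A (-(k * (t : ℂ) ^ (k - 1) * A t ^ 2)) t := fun t ht => by
    refine (((hpow k t).add_const c).inv (hc0 t ht)).congr_deriv ?_
    simp only [hA]
    rw [inv_pow, neg_div, div_eq_mul_inv]
  have hBd : ∀ t : ℝ, 0 ≤ t → HasDerivAt B (-(k * (t : ℂ) ^ (k - 1) * B t ^ 2)) t := fun t ht => by
    refine (((hpow k t).add_const d).inv (hd0 t ht)).congr_deriv ?_
    simp only [hB]
    rw [inv_pow, neg_div, div_eq_mul_inv]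
  -- For `k = 1` the truncated exponent `k - 1 - 1` is harmless: its coefficient `k - 1` is zero.
  set g' : ℝ → ℂ := fun t => ((k - 1 : ℕ) : ℂ) * (t : ℂ) ^ (k - 1 - 1) * (A t * B t) +
    (t : ℂ) ^ (k - 1) * (-(k * (t : ℂ) ^ (k - 1) * A t ^ 2) * B t +
      A t * -(k * (t : ℂ) ^ (k - 1) * B t ^ 2)) with hg'
  have hderiv : ∀ t : ℝ, 0 ≤ t → HasDerivAt (fun t : ℝ => (t : ℂ) ^ (k - 1) * (A t * B t)) (g' t) t :=
    fun t ht => (hpow (k - 1) t).mul ((hAd t ht).mul (hBd t ht))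
  refine exists_norm_halfFourier_sub_ite_le (g' := g') (C := K₁ * K₂)
    (C' := ((k - 1 : ℕ) : ℝ) * (K₁ * K₂) + k * (K₁ ^ 2 * K₂ + K₁ * K₂ ^ 2)) ?_
    (hderiv 0 le_rfl).continuousAt.continuousWithinAt (fun t ht => hderiv t ht.le) ?_ ?_
  · have hAm : Measurable A := by simp only [hA]; fun_prop
    have hBm : Measurable B := by simp only [hB]; fun_prop
    have : Measurable g' := by simp only [hg']; fun_prop
    exact this.aestronglyMeasurable
  · intro t ht
    have e0 := pow_mul_inv_one_add_pow_le (n := k - 1) (m := 2 * k) (by omega) ht.le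
    rw [norm_mul, norm_mul, norm_pow, Complex.norm_real, Real.norm_of_nonneg ht.le]
    calc t ^ (k - 1) * (‖A t‖ * ‖B t‖) ≤
          t ^ (k - 1) * ((K₁ * ((1 + t)⁻¹) ^ k) * (K₂ * ((1 + t)⁻¹) ^ k)) := by
          gcongr
          · exact h1 t ht.le
          · exact h2 t ht.le
      _ = K₁ * K₂ * (t ^ (k - 1) * ((1 + t)⁻¹) ^ (2 * k)) := by ring
      _ ≤ _ := by gcongr
  · intro t ht
    set Y := (1 + t)⁻¹ with hY
    have hY0 : 0 ≤ Y := by positivity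
    have e0 := pow_mul_inv_one_add_pow_le (n := k - 1 - 1) (m := 2 * k) (by omega) ht.le
    have e1 := pow_mul_inv_one_add_pow_le (n := (k - 1) + (k - 1)) (m := 3 * k) (by omega) ht.le
    rw [← hY] at e0 e1
    have a1 := h1 t ht.le
    have a2 := h2 t ht.le
    have hn : ∀ n : ℕ, ‖(t : ℂ) ^ n‖ = t ^ n := fun n => by
      rw [norm_pow, Complex.norm_real, Real.norm_of_nonneg ht.le]
    have b1 : ‖((k - 1 : ℕ) : ℂ) * (t : ℂ) ^ (k - 1 - 1) * (A t * B t)‖ ≤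
        ((k - 1 : ℕ) : ℝ) * (K₁ * K₂) * Y ^ 2 := by
      rw [norm_mul, norm_mul, norm_mul, hn, Complex.norm_natCast]
      calc ((k - 1 : ℕ) : ℝ) * t ^ (k - 1 - 1) * (‖A t‖ * ‖B t‖) ≤
            ((k - 1 : ℕ) : ℝ) * t ^ (k - 1 - 1) * ((K₁ * Y ^ k) * (K₂ * Y ^ k)) := by
            gcongr
        _ = ((k - 1 : ℕ) : ℝ) * (K₁ * K₂) * (t ^ (k - 1 - 1) * Y ^ (2 * k)) := by ring
        _ ≤ _ := by gcongr
    have b2 : ‖(t : ℂ) ^ (k - 1) * (-(k * (t : ℂ) ^ (k - 1) * A t ^ 2) * B t +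
        A t * -(k * (t : ℂ) ^ (k - 1) * B t ^ 2))‖ ≤ k * (K₁ ^ 2 * K₂ + K₁ * K₂ ^ 2) * Y ^ 2 := by
      rw [show (t : ℂ) ^ (k - 1) * (-(k * (t : ℂ) ^ (k - 1) * A t ^ 2) * B t +
        A t * -(k * (t : ℂ) ^ (k - 1) * B t ^ 2)) =
        -((k : ℂ) * (t : ℂ) ^ ((k - 1) + (k - 1)) * (A t ^ 2 * B t + A t * B t ^ 2)) by ring,
        norm_neg, norm_mul, norm_mul, hn, Complex.norm_natCast]
      calc (k : ℝ) * t ^ ((k - 1) + (k - 1)) * ‖A t ^ 2 * B t + A t * B t ^ 2‖ ≤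
            (k : ℝ) * t ^ ((k - 1) + (k - 1)) * ((K₁ * Y ^ k) ^ 2 * (K₂ * Y ^ k) +
              (K₁ * Y ^ k) * (K₂ * Y ^ k) ^ 2) := by
            gcongr
            refine (norm_add_le _ _).trans ?_
            rw [norm_mul, norm_mul, norm_pow, norm_pow]
            gcongr
        _ = k * (K₁ ^ 2 * K₂ + K₁ * K₂ ^ 2) * (t ^ ((k - 1) + (k - 1)) * Y ^ (3 * k)) := by ring
        _ ≤ _ := by gcongr
    refine (norm_add_le _ _).trans ((add_le_add b1 b2).trans (le_of_eq ?_))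
    ring

/-! ### Uniform bounds for Dirichlet integrals -/

theorem one_sub_cos_le_two (s : ℝ) : 1 - Real.cos s ≤ 2 := by linarith [Real.neg_one_le_cos s]

theorem one_sub_cos_le_sq (s : ℝ) : 1 - Real.cos s ≤ s ^ 2 / 2 := by
  linarith [Real.one_sub_sq_div_two_le_cos (x := s)]

theorem abs_one_sub_cos_div_le {s : ℝ} (hs : 0 < s) : |(1 - Real.cos s) / s| ≤ 1 := by
  have h0 : 0 ≤ 1 - Real.cos s := by linarith [Real.cos_le_one s]
  rw [abs_of_nonneg (by positivity), div_le_one hs]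
  rcases le_total s 2 with h | h
  · have := one_sub_cos_le_sq s
    nlinarith
  · linarith [one_sub_cos_le_two s]

theorem abs_one_sub_cos_div_sq_le {s : ℝ} (hs : 0 < s) :
    |(1 - Real.cos s) / s ^ 2| ≤ 8 * ((1 + s)⁻¹) ^ 2 := by
  have h0 : 0 ≤ 1 - Real.cos s := by linarith [Real.cos_le_one s]
  rw [abs_of_nonneg (by positivity), div_le_iff₀ (by positivity), inv_pow, mul_assoc,
    ← div_eq_inv_mul, mul_div_assoc', le_div_iff₀ (by positivity)]
  rcases le_total s 1 with h | h
  · have h1 := one_sub_cos_le_sq s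
    have h2 : (1 + s) ^ 2 ≤ 4 := by nlinarith
    nlinarith [mul_le_mul h1 h2 (by positivity) (by positivity : (0 : ℝ) ≤ s ^ 2 / 2)]
  · have h1 := one_sub_cos_le_two s
    have h2 : (1 + s) ^ 2 ≤ 4 * s ^ 2 := by nlinarith
    nlinarith [mul_le_mul h1 h2 (by positivity) (by positivity : (0 : ℝ) ≤ 2)]

/-- Integration by parts with the primitive $1-\cos s$ of the sine: the boundary terms are at most
`1` each, and $(1-\cos s)/s^2$ is integrable both at zero and at infinity. -/
theorem exists_abs_integral_inv_mul_sin_le_of_pos :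
    ∃ K, 0 ≤ K ∧ ∀ A B : ℝ, 0 < A → A ≤ B → |∫ s in A..B, s⁻¹ * Real.sin s| ≤ K := by
  refine ⟨2 + ∫ s in Ioi (0 : ℝ), 8 * ((1 + s)⁻¹) ^ 2,
    add_nonneg (by norm_num) (integral_nonneg fun s => by positivity), fun A B hA hAB => ?_⟩
  have hpos : ∀ s ∈ uIcc A B, 0 < s := fun s hs => by
    rw [uIcc_of_le hAB] at hs
    exact lt_of_lt_of_le hA hs.1
  have hderiv : ∀ s ∈ uIcc A B, HasDerivAt (fun s => (1 - Real.cos s) / s)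
      (s⁻¹ * Real.sin s - (1 - Real.cos s) / s ^ 2) s := fun s hs => by
    have hs0 := (hpos s hs).ne'
    refine (((Real.hasDerivAt_cos s).const_sub 1).div (hasDerivAt_id s) hs0).congr_deriv ?_
    simp only [id]
    field_simp
  have hc0 : ContinuousOn (fun s : ℝ => s⁻¹) (uIcc A B) :=
    continuousOn_inv₀.mono fun s hs => (hpos s hs).ne'
  have hi1 : IntervalIntegrable (fun s => s⁻¹ * Real.sin s) volume A B :=
    (hc0.mul Real.continuous_sin.continuousOn).intervalIntegrable
  have hi2 : IntervalIntegrable (fun s => (1 - Real.cos s) / s ^ 2) volume A B :=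
    ContinuousOn.intervalIntegrable (ContinuousOn.div (by fun_prop) (by fun_prop)
      fun s hs => pow_ne_zero _ (hpos s hs).ne')
  have key := intervalIntegral.integral_eq_sub_of_hasDerivAt hderiv (hi1.sub hi2)
  rw [intervalIntegral.integral_sub hi1 hi2] at key
  have e1 := abs_one_sub_cos_div_le hA
  have e2 := abs_one_sub_cos_div_le (lt_of_lt_of_le hA hAB)
  have e3 : |∫ s in A..B, (1 - Real.cos s) / s ^ 2| ≤
      ∫ s in Ioi (0 : ℝ), 8 * ((1 + s)⁻¹) ^ 2 := by
    have hsub : Ioc A B ⊆ Ioi 0 := fun s hs => hA.trans hs.1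
    rw [intervalIntegral.integral_of_le hAB, ← Real.norm_eq_abs]
    have h8 : IntegrableOn (fun s : ℝ => 8 * ((1 + s)⁻¹) ^ 2) (Ioi 0) :=
      integrableOn_one_add_inv_sq.const_mul 8
    refine (norm_integral_le_of_norm_le (h8.mono_set hsub) ?_).trans ?_
    · refine (ae_restrict_iff' measurableSet_Ioc).2 (ae_of_all _ fun s hs => ?_)
      exact abs_one_sub_cos_div_sq_le (hsub hs)
    · exact setIntegral_mono_set h8
        (ae_of_all _ fun s => by simp only [Pi.zero_apply]; positivity)
        (Filter.Eventually.of_forall hsub)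
  rw [abs_le] at *
  constructor <;> linarith

/-- Scale invariance of $dr/r$ removes the frequency, and oddness of the sine its sign. -/
theorem exists_abs_integral_inv_mul_sin_le :
    ∃ K, 0 ≤ K ∧ ∀ ω A B : ℝ, 0 < A → |∫ r in Ioc A B, r⁻¹ * Real.sin (ω * r)| ≤ K := by
  obtain ⟨K, hK, h⟩ := exists_abs_integral_inv_mul_sin_le_of_pos
  have hpos : ∀ ω A B : ℝ, 0 < ω → 0 < A → |∫ r in Ioc A B, r⁻¹ * Real.sin (ω * r)| ≤ K := by
    intro ω A B hω hA
    rcases le_total A B with hAB | hAB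
    · have h1 : ∀ r : ℝ, r⁻¹ * Real.sin (ω * r) = ω * ((ω * r)⁻¹ * Real.sin (ω * r)) := fun r => by
        rw [mul_inv]; field_simp
      rw [← intervalIntegral.integral_of_le hAB]
      simp_rw [h1]
      rw [intervalIntegral.integral_const_mul,
        intervalIntegral.mul_integral_comp_mul_left (f := fun s => s⁻¹ * Real.sin s)]
      exact h _ _ (by positivity) (by gcongr)
    · rw [Ioc_eq_empty (not_lt.2 hAB)]
      simpa using hK
  refine ⟨K, hK, fun ω A B hA => ?_⟩
  rcases lt_trichotomy ω 0 with hω | hω | hω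
  · have h1 := hpos (-ω) A B (by linarith) hA
    have h2 : ∀ r : ℝ, r⁻¹ * Real.sin (-ω * r) = -(r⁻¹ * Real.sin (ω * r)) := fun r => by
      rw [neg_mul, Real.sin_neg, mul_neg]
    simp_rw [h2] at h1
    rwa [integral_neg, abs_neg] at h1
  · simpa [hω] using hK
  · exact hpos ω A B hω hA

/-! ### The kernel -/

theorem integrableOn_inv_mul_kernelWeight :
    IntegrableOn (fun s : ℝ => s⁻¹ • (s ^ (1 / 2 : ℝ) * (1 + s)⁻¹)) (Ioi 0) := by
  refine (integrableOn_rpow_mul_one_add_rpow (p := -1 / 2) (q := -1) (by norm_num)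
    (by norm_num)).congr_fun (fun s hs => ?_) measurableSet_Ioi
  have hs : 0 < s := hs
  simp only [smul_eq_mul]
  rw [Real.rpow_neg_one, ← mul_assoc, ← Real.rpow_neg_one s, ← Real.rpow_add hs]
  norm_num

/-- Invariance of $dr/r$ makes the bound uniform in `x`; at `x = 0` the weight vanishes identically.
-/
theorem integral_inv_mul_kernelWeight_comp_le {γ : ℝ} (hγ : 0 < γ) (x : ℝ) :
    IntegrableOn (fun r : ℝ => r⁻¹ • ((|x| * r ^ γ) ^ (1 / 2 : ℝ) * (1 + |x| * r ^ γ)⁻¹)) (Ioi 0) ∧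
    ∫ r in Ioi (0 : ℝ), r⁻¹ • ((|x| * r ^ γ) ^ (1 / 2 : ℝ) * (1 + |x| * r ^ γ)⁻¹) ≤
      γ⁻¹ * ∫ s in Ioi (0 : ℝ), s⁻¹ • (s ^ (1 / 2 : ℝ) * (1 + s)⁻¹) := by
  by_cases hx : x = 0
  · have h0 : (0 : ℝ) ^ (1 / 2 : ℝ) = 0 := Real.zero_rpow (by norm_num)
    simp only [hx, abs_zero, zero_mul, h0, smul_zero, integral_zero]
    refine ⟨integrableOn_zero, mul_nonneg (by positivity)
      (setIntegral_nonneg measurableSet_Ioi fun s hs => ?_)⟩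
    have hs : 0 < s := hs
    rw [smul_eq_mul]
    positivity
  · exact ⟨integrableOn_inv_smul_comp_mul_rpow (φ := fun s => s ^ (1 / 2 : ℝ) * (1 + s)⁻¹)
      (abs_pos.2 hx) hγ integrableOn_inv_mul_kernelWeight,
      (integral_inv_smul_comp_mul_rpow (fun s => s ^ (1 / 2 : ℝ) * (1 + s)⁻¹)
        (abs_pos.2 hx) hγ).le⟩

/-- The restriction to $|z|\le1$ leaves an interval with the same lower end, so the Dirichlet bound
still applies. -/
theorem exists_Ioc_eq_inter {γ : ℝ} (hγ : 0 < γ) {A : ℝ} (hA : 0 < A) (B x : ℝ) :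
    ∃ B', Ioc A B ∩ {r | |x| * r ^ γ ≤ 1} = Ioc A B' := by
  by_cases hx : x = 0
  · exact ⟨B, by simp [hx]⟩
  · have hx0 : 0 < |x| := abs_pos.2 hx
    refine ⟨min B ((|x|⁻¹) ^ γ⁻¹), ?_⟩
    ext r
    simp only [mem_inter_iff, mem_Ioc, mem_ofPred_eq, le_min_iff, and_assoc, and_congr_right_iff]
    intro hr _
    rw [Real.le_rpow_inv_iff_of_pos (hA.trans hr).le (by positivity) hγ,
      le_inv_comm₀ (Real.rpow_pos_of_pos (hA.trans hr) _) hx0, inv_eq_one_div,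
      le_div_iff₀ (Real.rpow_pos_of_pos (hA.trans hr) _)]

/-- Each `J` is replaced by its value at zero cut off to $|z|\le1$. The error is integrable against
$dr/r$ uniformly in `x`. In the main term the vanishing mean makes the total coefficients for `ε₂ =
1` and `ε₂ = -1` opposite, so only a sine survives. -/
theorem exists_norm_kernel_le {γ : ℝ} (hγ : 0 < γ) (J : ℤˣ → ℤˣ → ℝ → ℂ) {K : ℝ}
    (hJm : ∀ ε₁ ε₂, Measurable (J ε₁ ε₂))
    (hJ : ∀ ε₁ ε₂ z, ‖J ε₁ ε₂ z - if |z| ≤ 1 then J ε₁ ε₂ 0 else 0‖ ≤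
      K * (|z| ^ (1 / 2 : ℝ) * (1 + |z|)⁻¹))
    (hmean : ∑ ε₁, ∑ ε₂, J ε₁ ε₂ 0 = 0) :
    ∃ C, ∀ A B x y : ℝ, 0 < A → ‖∑ ε₁ : ℤˣ, ∑ ε₂ : ℤˣ, ∫ r in Ioc A B, r⁻¹ •
      (Complex.exp ((-2 * Real.pi * y * (((ε₂ : ℤ) : ℝ) * r) : ℝ) * Complex.I) *
        J ε₁ ε₂ (((ε₁ : ℤ) : ℝ) * (x * r ^ γ)))‖ ≤ C := by
  obtain ⟨D, hD, hdir⟩ := exists_abs_integral_inv_mul_sin_le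
  set T : ℝ := ∫ s in Ioi (0 : ℝ), s⁻¹ • (s ^ (1 / 2 : ℝ) * (1 + s)⁻¹) with hT
  have hK : 0 ≤ K := by
    have h1 := (norm_nonneg _).trans (hJ 1 1 1)
    norm_num at h1
    linarith
  set c : ℂ := ∑ ε₁ : ℤˣ, J ε₁ 1 0 with hc
  have hc' : ∑ ε₁ : ℤˣ, J ε₁ (-1) 0 = -c := by
    rw [Finset.sum_comm, sum_units] at hmean
    rw [hc]
    linear_combination hmean
  -- One error term for each quadrant, and the factor $-2i$ of the sine for the main term.
  refine ⟨4 * (K * (γ⁻¹ * T)) + 2 * ‖c‖ * D, fun A B x y hA => ?_⟩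
  have hsub : Ioc A B ⊆ Ioi 0 := fun r hr => hA.trans hr.1
  set e : ℤˣ → ℝ → ℂ := fun ε₂ r =>
    Complex.exp ((-2 * Real.pi * y * (((ε₂ : ℤ) : ℝ) * r) : ℝ) * Complex.I) with he
  have hen : ∀ ε r, ‖e ε r‖ = 1 := fun ε r => Complex.norm_exp_ofReal_mul_I _
  have hem : ∀ ε, Measurable (e ε) := fun ε => by simp only [he]; fun_prop
  -- This set depends on $|x|r^\gamma$ only, hence is common to the four quadrants; the cancellation
  -- relies on this.
  set S := Ioc A B ∩ {r | |x| * r ^ γ ≤ 1} with hS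
  obtain ⟨B', hB'⟩ := exists_Ioc_eq_inter hγ hA B x
  have hSm : MeasurableSet S := by rw [hS, hB']; exact measurableSet_Ioc
  have habs : ∀ (ε : ℤˣ) (r : ℝ), 0 < r → |((ε : ℤ) : ℝ) * (x * r ^ γ)| = |x| * r ^ γ :=
    fun ε r hr => by
      rw [abs_units_mul, abs_mul, abs_of_pos (Real.rpow_pos_of_pos hr γ)]
  obtain ⟨hWi, hWle⟩ := integral_inv_mul_kernelWeight_comp_le hγ x
  have hinvi : IntegrableOn (fun r : ℝ => r⁻¹) (Ioc A B) := by
    refine (ContinuousOn.integrableOn_compact (K := Icc A B) isCompact_Icc ?_).mono_set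
      Ioc_subset_Icc_self
    exact continuousOn_inv₀.mono fun s hs => (lt_of_lt_of_le hA hs.1).ne'
  -- the error term
  set E : ℤˣ → ℤˣ → ℝ → ℂ := fun ε₁ ε₂ r => r⁻¹ • (e ε₂ r *
    (J ε₁ ε₂ (((ε₁ : ℤ) : ℝ) * (x * r ^ γ)) - if |x| * r ^ γ ≤ 1 then J ε₁ ε₂ 0 else 0)) with hE
  have hEb : ∀ ε₁ ε₂, ∀ r ∈ Ioc A B, ‖E ε₁ ε₂ r‖ ≤
      K * (r⁻¹ • ((|x| * r ^ γ) ^ (1 / 2 : ℝ) * (1 + |x| * r ^ γ)⁻¹)) := fun ε₁ ε₂ r hr => by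
    have hr0 : 0 < r := hsub hr
    have h1 := hJ ε₁ ε₂ (((ε₁ : ℤ) : ℝ) * (x * r ^ γ))
    rw [habs ε₁ r hr0] at h1
    simp only [hE]
    rw [norm_smul, norm_mul, hen, one_mul, Real.norm_of_nonneg (by positivity), smul_eq_mul]
    refine (mul_le_mul_of_nonneg_left h1 (by positivity)).trans (le_of_eq ?_)
    ring
  have hEi : ∀ ε₁ ε₂, IntegrableOn (E ε₁ ε₂) (Ioc A B) := fun ε₁ ε₂ => by
    refine Integrable.mono' ((hWi.mono_set hsub).const_mul K) ?_
      ((ae_restrict_iff' measurableSet_Ioc).2 (ae_of_all _ (hEb ε₁ ε₂)))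
    have h1 : Measurable fun r : ℝ => J ε₁ ε₂ (((ε₁ : ℤ) : ℝ) * (x * r ^ γ)) :=
      (hJm ε₁ ε₂).comp (by fun_prop)
    have h2 : Measurable fun r : ℝ => if |x| * r ^ γ ≤ 1 then J ε₁ ε₂ 0 else 0 :=
      Measurable.ite (measurableSet_le (by fun_prop) (by fun_prop)) (by fun_prop) (by fun_prop)
    have h3 := hem ε₂
    have : Measurable (E ε₁ ε₂) := by simp only [hE]; fun_prop
    exact this.aestronglyMeasurable
  have hEle : ∀ ε₁ ε₂, ‖∫ r in Ioc A B, E ε₁ ε₂ r‖ ≤ K * (γ⁻¹ * T) := fun ε₁ ε₂ => by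
    refine (norm_integral_le_of_norm_le ((hWi.mono_set hsub).const_mul K)
      ((ae_restrict_iff' measurableSet_Ioc).2 (ae_of_all _ (hEb ε₁ ε₂)))).trans ?_
    rw [integral_const_mul]
    refine mul_le_mul_of_nonneg_left (le_trans ?_ hWle) hK
    refine setIntegral_mono_set hWi ?_ (Filter.Eventually.of_forall hsub)
    refine (ae_restrict_iff' measurableSet_Ioi).2 (ae_of_all _ fun r hr => ?_)
    have hr : 0 < r := hr
    simp only [Pi.zero_apply, smul_eq_mul]
    positivity
  -- the main term
  have hmi : ∀ ε₂, IntegrableOn (fun r : ℝ => r⁻¹ • e ε₂ r) (Ioc A B) := fun ε₂ =>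
    Integrable.mono' hinvi (measurable_inv.smul (hem ε₂)).aestronglyMeasurable
      ((ae_restrict_iff' measurableSet_Ioc).2 (ae_of_all _ fun r hr => by
        have : 0 < r := hsub hr
        rw [norm_smul, hen, mul_one, Real.norm_of_nonneg (by positivity)]))
  have hsplit : ∀ ε₁ ε₂ : ℤˣ, ∫ r in Ioc A B, r⁻¹ • (e ε₂ r *
      J ε₁ ε₂ (((ε₁ : ℤ) : ℝ) * (x * r ^ γ))) =
      (∫ r in Ioc A B, E ε₁ ε₂ r) + (∫ r in S, r⁻¹ • e ε₂ r) * J ε₁ ε₂ 0 := fun ε₁ ε₂ => by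
    have h1 : ∫ r in S, r⁻¹ • e ε₂ r =
        ∫ r in Ioc A B, indicator {r | |x| * r ^ γ ≤ 1} (fun r : ℝ => r⁻¹ • e ε₂ r) r := by
      rw [setIntegral_indicator (measurableSet_le (by fun_prop) (by fun_prop))]
    rw [h1, ← integral_mul_const, ← integral_add (hEi ε₁ ε₂)]
    · refine setIntegral_congr_fun measurableSet_Ioc fun r _ => ?_
      simp only [hE, indicator, mem_ofPred_eq, Complex.real_smul]
      split_ifs <;> ring
    · refine Integrable.mul_const ?_ _
      exact (hmi ε₂).indicator (measurableSet_le (by fun_prop) (by fun_prop))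
  have hdiff : (∫ r in S, r⁻¹ • e 1 r) - ∫ r in S, r⁻¹ • e (-1) r =
      ((∫ r in S, r⁻¹ * Real.sin (2 * Real.pi * y * r) : ℝ) : ℂ) * (-2 * Complex.I) := by
    rw [← integral_sub ((hmi 1).mono_set inter_subset_left) ((hmi (-1)).mono_set inter_subset_left),
      ← integral_complex_ofReal, ← integral_mul_const]
    refine setIntegral_congr_fun hSm fun r _ => ?_
    simp only [he, Units.val_one, Int.cast_one, Complex.ofReal_one, one_mul, Units.val_neg,
      Int.cast_neg, neg_mul, mul_neg, neg_neg, Complex.real_smul, Complex.ofReal_mul, Complex.ofReal_sin, Complex.ofReal_neg,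
      Complex.ofReal_inv, Complex.ofReal_ofNat, Complex.sin]
    linear_combination ((r : ℂ)⁻¹ * (Complex.exp (-(2 * Real.pi * y * r * Complex.I)) -
      Complex.exp (2 * Real.pi * y * r * Complex.I))) * Complex.I_sq
  simp only [sum_units] at hc hc' ⊢
  rw [hsplit 1 1, hsplit 1 (-1), hsplit (-1) 1, hsplit (-1) (-1)]
  have hsum : (∫ r in Ioc A B, E 1 1 r) + (∫ r in S, r⁻¹ • e 1 r) * J 1 1 0 +
      ((∫ r in Ioc A B, E 1 (-1) r) + (∫ r in S, r⁻¹ • e (-1) r) * J 1 (-1) 0) +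
      ((∫ r in Ioc A B, E (-1) 1 r) + (∫ r in S, r⁻¹ • e 1 r) * J (-1) 1 0 +
      ((∫ r in Ioc A B, E (-1) (-1) r) + (∫ r in S, r⁻¹ • e (-1) r) * J (-1) (-1) 0)) =
      (∫ r in Ioc A B, E 1 1 r) + (∫ r in Ioc A B, E 1 (-1) r) + (∫ r in Ioc A B, E (-1) 1 r) +
      (∫ r in Ioc A B, E (-1) (-1) r) +
      c * (((∫ r in S, r⁻¹ * Real.sin (2 * Real.pi * y * r) : ℝ) : ℂ) * (-2 * Complex.I)) := by
    rw [← hdiff]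
    linear_combination (∫ r in S, r⁻¹ • e 1 r) * (-hc) + (∫ r in S, r⁻¹ • e (-1) r) * hc'
  rw [hsum]
  have hdirS := hdir (2 * Real.pi * y) A B' hA
  rw [← hB', ← hS] at hdirS
  have hmainle : ‖c * (((∫ r in S, r⁻¹ * Real.sin (2 * Real.pi * y * r) : ℝ) : ℂ) *
      (-2 * Complex.I))‖ ≤ 2 * ‖c‖ * D := by
    rw [norm_mul, norm_mul, Complex.norm_real, Real.norm_eq_abs, norm_mul, Complex.norm_I, mul_one,
      norm_neg, Complex.norm_ofNat]
    nlinarith [norm_nonneg c]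
  have t1 := norm_add_le ((∫ r in Ioc A B, E 1 1 r) + (∫ r in Ioc A B, E 1 (-1) r) +
    (∫ r in Ioc A B, E (-1) 1 r) + (∫ r in Ioc A B, E (-1) (-1) r))
    (c * (((∫ r in S, r⁻¹ * Real.sin (2 * Real.pi * y * r) : ℝ) : ℂ) * (-2 * Complex.I)))
  have t2 := norm_add₄_le (a := ∫ r in Ioc A B, E 1 1 r) (b := ∫ r in Ioc A B, E 1 (-1) r)
    (c := ∫ r in Ioc A B, E (-1) 1 r) (d := ∫ r in Ioc A B, E (-1) (-1) r)
  linarith [hEle 1 1, hEle 1 (-1), hEle (-1) 1, hEle (-1) (-1)]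

/-! ### Truncations of the multiplier to horizontal strips -/

theorem exists_units_mul_abs (x : ℝ) : ∃ ε : ℤˣ, x = ((ε : ℤ) : ℝ) * |x| := by
  rcases le_total 0 x with h | h
  · exact ⟨1, by simp [abs_of_nonneg h]⟩
  · exact ⟨-1, by simp [abs_of_nonpos h]⟩

/-- Factoring out $Y^l$ leaves $X^k/Y^l-a$, to which the slit-plane bound applies. Away from $y=0$
this gives decay in $x$. -/
theorem exists_norm_inv_sub_le (k l : ℕ) {a : ℂ} (ha : -a ∈ Complex.slitPlane) {A : ℝ}
    (hA : 0 < A) : ∃ K, 0 ≤ K ∧ ∀ X Y : ℝ, 0 ≤ X → A ≤ Y →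
      ‖((X : ℂ) ^ k - a * (Y : ℂ) ^ l)⁻¹‖ ≤ K * ((1 + X)⁻¹) ^ k := by
  obtain ⟨κ, hκ, h⟩ := exists_mul_one_add_le_norm_add ha
  -- Chosen so that $\delta(1+X^k)\le Y^l+X^k$ for $Y\ge A$.
  set δ := min (A ^ l) 1 with hδ
  have hδ0 : 0 < δ := lt_min (pow_pos hA l) one_pos
  refine ⟨(κ * δ)⁻¹ * 2 ^ k, by positivity, fun X Y hX hY => ?_⟩
  have hY0 : 0 < Y := lt_of_lt_of_le hA hY
  have hYl : 0 < Y ^ l := pow_pos hY0 l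
  have h1 := h (X ^ k / Y ^ l) (by positivity)
  have hYC : (Y : ℂ) ^ l ≠ 0 := pow_ne_zero _ (by exact_mod_cast hY0.ne')
  have h2 : (X : ℂ) ^ k - a * (Y : ℂ) ^ l = (Y : ℂ) ^ l * (((X ^ k / Y ^ l : ℝ) : ℂ) + -a) := by
    push_cast
    field_simp
    ring
  have h3 : κ * δ * (1 + X ^ k) ≤ ‖(X : ℂ) ^ k - a * (Y : ℂ) ^ l‖ := by
    rw [h2, norm_mul, norm_pow, Complex.norm_real, Real.norm_of_nonneg hY0.le]
    have e1 : δ ≤ Y ^ l := (min_le_left _ _).trans (pow_le_pow_left₀ hA.le hY l)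
    have e2 : δ ≤ 1 := min_le_right _ _
    have e3 : 0 ≤ X ^ k := by positivity
    calc κ * δ * (1 + X ^ k) ≤ κ * (Y ^ l + X ^ k) := by
          rw [mul_assoc]
          refine mul_le_mul_of_nonneg_left ?_ hκ.le
          nlinarith
      _ = Y ^ l * (κ * (1 + X ^ k / Y ^ l)) := by field_simp
      _ ≤ _ := mul_le_mul_of_nonneg_left h1 hYl.le
  have h4 := one_add_pow_le k hX
  have h5 : 0 < 1 + X ^ k := by positivity
  have h6 : 0 < ‖(X : ℂ) ^ k - a * (Y : ℂ) ^ l‖ := lt_of_lt_of_le (by positivity) h3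
  rw [norm_inv, inv_pow, inv_le_iff_one_le_mul₀ h6]
  have h7 : (1 + X) ^ k * (κ * δ) ≤ 2 ^ k * ‖(X : ℂ) ^ k - a * (Y : ℂ) ^ l‖ := by
    calc (1 + X) ^ k * (κ * δ) ≤ 2 ^ k * (1 + X ^ k) * (κ * δ) :=
          mul_le_mul_of_nonneg_right h4 (by positivity)
      _ = 2 ^ k * (κ * δ * (1 + X ^ k)) := by ring
      _ ≤ _ := mul_le_mul_of_nonneg_left h3 (by positivity)
  have h8 : 0 < (1 + X) ^ k := by positivity
  have h9 : 0 < κ * δ := by positivity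
  calc (1 : ℝ) = (κ * δ)⁻¹ * ((1 + X) ^ k)⁻¹ * ((1 + X) ^ k * (κ * δ)) := by field_simp
    _ ≤ (κ * δ)⁻¹ * ((1 + X) ^ k)⁻¹ * (2 ^ k * ‖(X : ℂ) ^ k - a * (Y : ℂ) ^ l‖) :=
        mul_le_mul_of_nonneg_left h7 (by positivity)
    _ = _ := by ring

theorem exists_norm_multiplier_le_of_pos {k l : ℕ} (hk : 1 ≤ k) (hl : 1 ≤ l) {a b : ℂ}
    (ha : -a ∈ Complex.slitPlane) (hb : -b ∈ Complex.slitPlane) {A : ℝ} (hA : 0 < A) (B : ℝ) :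
    ∃ K, 0 ≤ K ∧ ∀ X Y : ℝ, 0 ≤ X → A ≤ Y → Y ≤ B →
      ‖multiplier k l ((k : ℝ) - 1) ((l : ℝ) - 1) a b X Y‖ ≤ K * ((1 + X)⁻¹) ^ 2 := by
  obtain ⟨K₁, hK₁, h1⟩ := exists_norm_inv_sub_le k l ha hA
  obtain ⟨K₂, hK₂, h2⟩ := exists_norm_inv_sub_le k l hb hA
  refine ⟨|B| ^ (l - 1) * (K₁ * K₂), by positivity, fun X Y hX hAY hYB => ?_⟩
  have hY : 0 ≤ Y := hA.le.trans hAY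
  have ek : (k : ℝ) - 1 = ((k - 1 : ℕ) : ℝ) := by push_cast [hk]; ring
  have el : (l : ℝ) - 1 = ((l - 1 : ℕ) : ℝ) := by push_cast [hl]; ring
  have e0 := pow_mul_inv_one_add_pow_le (n := k - 1) (m := 2 * k) (by omega) hX
  have a1 := h1 X Y hX hAY
  have a2 := h2 X Y hX hAY
  have hYB' : Y ≤ |B| := hYB.trans (le_abs_self B)
  rw [multiplier, ek, el, Real.rpow_natCast, Real.rpow_natCast, norm_mul, Complex.norm_real,
    abs_of_nonneg hX, abs_of_nonneg hY,
    Real.norm_of_nonneg (show 0 ≤ X ^ (k - 1) * Y ^ (l - 1) by positivity), mul_inv, norm_mul]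
  calc X ^ (k - 1) * Y ^ (l - 1) * (‖((X : ℂ) ^ k - a * (Y : ℂ) ^ l)⁻¹‖ *
        ‖((X : ℂ) ^ k - b * (Y : ℂ) ^ l)⁻¹‖)
      ≤ X ^ (k - 1) * |B| ^ (l - 1) * ((K₁ * ((1 + X)⁻¹) ^ k) * (K₂ * ((1 + X)⁻¹) ^ k)) := by
        gcongr
    _ = |B| ^ (l - 1) * (K₁ * K₂) * (X ^ (k - 1) * ((1 + X)⁻¹) ^ (2 * k)) := by ring
    _ ≤ _ := by gcongr

theorem exists_norm_multiplier_le {k l : ℕ} (hk : 1 ≤ k) (hl : 1 ≤ l) {a b : ℂ}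
    (ha : NoRealRoots k l a) (hb : NoRealRoots k l b) {A : ℝ} (hA : 0 < A) (B : ℝ) :
    ∃ K, 0 ≤ K ∧ ∀ x y : ℝ, A ≤ |y| → |y| ≤ B →
      ‖multiplier k l ((k : ℝ) - 1) ((l : ℝ) - 1) a b x y‖ ≤ K * ((1 + |x|)⁻¹) ^ 2 := by
  choose K hK0 hK using fun ε₁ ε₂ => exists_norm_multiplier_le_of_pos hk hl
    (ha.neg_quadSign_mul_mem hk ε₁ ε₂) (hb.neg_quadSign_mul_mem hk ε₁ ε₂) hA B
  refine ⟨∑ ε₁, ∑ ε₂, K ε₁ ε₂, Finset.sum_nonneg fun _ _ => Finset.sum_nonneg fun _ _ => hK0 _ _,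
    fun x y h1 h2 => ?_⟩
  obtain ⟨ε₁, hε₁⟩ := exists_units_mul_abs x
  obtain ⟨ε₂, hε₂⟩ := exists_units_mul_abs y
  have h3 : multiplier k l ((k : ℝ) - 1) ((l : ℝ) - 1) a b x y =
      multiplier k l ((k : ℝ) - 1) ((l : ℝ) - 1) (quadSign k l ε₁ ε₂ * a) (quadSign k l ε₁ ε₂ * b)
        |x| |y| := by
    rw [← multiplier_units_mul, ← hε₁, ← hε₂]
  rw [h3]
  refine (hK ε₁ ε₂ _ _ (abs_nonneg x) h1 h2).trans (mul_le_mul_of_nonneg_right ?_ (by positivity))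
  exact (Finset.single_le_sum (f := fun ε₂ => K ε₁ ε₂) (fun _ _ => hK0 _ _)
    (Finset.mem_univ ε₂)).trans (Finset.single_le_sum (f := fun ε₁ => ∑ ε₂, K ε₁ ε₂)
    (fun _ _ => Finset.sum_nonneg fun _ _ => hK0 _ _) (Finset.mem_univ ε₁))

theorem measurable_multiplier (k l : ℕ) (p q : ℝ) (a b : ℂ) :
    Measurable fun z : ℝ × ℝ => multiplier k l p q a b z.1 z.2 := by
  unfold multiplier
  fun_prop

theorem measurable_profile (k : ℕ) (p : ℝ) (c d : ℂ) : Measurable (profile k p c d) := by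
  unfold profile
  fun_prop

theorem measurable_halfFourier {g : ℝ → ℂ} (hg : Measurable g) : Measurable (halfFourier g) := by
  have h : StronglyMeasurable fun z : ℝ × ℝ =>
      Complex.exp ((-2 * Real.pi * z.1 * z.2 : ℝ) * Complex.I) * g z.2 := by
    refine Measurable.stronglyMeasurable ?_
    fun_prop
  exact (h.integral_prod_right' (ν := volume.restrict (Ioi 0))).measurable

/-- The strip `A < |y| ≤ B`. -/
def strip (A B : ℝ) : Set (ℝ × ℝ) := {z | A < |z.2|} ∩ {z | |z.2| ≤ B}

theorem measurableSet_strip (A B : ℝ) : MeasurableSet (strip A B) :=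
  (measurableSet_lt (by fun_prop) (by fun_prop)).inter
    (measurableSet_le (by fun_prop) (by fun_prop))

/-- Strips are the convenient truncation: the multiplier is absolutely integrable on them, and in
polar coordinates they restrict the radius only. -/
theorem integrableOn_multiplier_strip {k l : ℕ} (hk : 1 ≤ k) (hl : 1 ≤ l) {a b : ℂ}
    (ha : NoRealRoots k l a) (hb : NoRealRoots k l b) {A : ℝ} (hA : 0 < A) (B : ℝ) :
    IntegrableOn (fun z : ℝ × ℝ => multiplier k l ((k : ℝ) - 1) ((l : ℝ) - 1) a b z.1 z.2)
      (strip A B) := by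
  obtain ⟨K, hK, h⟩ := exists_norm_multiplier_le hk hl ha hb hA B
  have h1 : Integrable fun x : ℝ => ((1 + |x|)⁻¹) ^ 2 := by
    have := integrable_one_add_norm (E := ℝ) (μ := volume) (r := 2) (by simp)
    refine this.congr (ae_of_all _ fun x => ?_)
    simp only [Real.norm_eq_abs]
    rw [Real.rpow_neg (by positivity), inv_pow]
    norm_cast
  have h2 : Integrable ((Icc (-B) B).indicator fun _ : ℝ => (1 : ℝ)) :=
    (integrable_indicator_iff measurableSet_Icc).2 (integrableOn_const (by simp))
  have h3 : Integrable fun z : ℝ × ℝ =>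
      K * (((1 + |z.1|)⁻¹) ^ 2 * (Icc (-B) B).indicator (fun _ : ℝ => (1 : ℝ)) z.2) :=
    (h1.mul_prod h2).const_mul K
  refine Integrable.mono' h3.integrableOn (measurable_multiplier _ _ _ _ _ _).aestronglyMeasurable
    ((ae_restrict_iff' (measurableSet_strip A B)).2 (ae_of_all _ fun z hz => ?_))
  have hz2 : z.2 ∈ Icc (-B) B := abs_le.1 hz.2
  rw [indicator_of_mem hz2, mul_one]
  exact h _ _ hz.1.le hz.2

/-- The Fourier transforms of the truncated multipliers are uniformly bounded, provided that the
mean value of the multiplier vanishes. -/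
theorem exists_norm_integral_strip_le {k l : ℕ} (hk : 1 ≤ k) (hl : 1 ≤ l) {a b : ℂ}
    (ha : NoRealRoots k l a) (hb : NoRealRoots k l b)
    (hmean : multiplierMean k l ((k : ℝ) - 1) a b = 0) :
    ∃ C, ∀ A B x y : ℝ, 0 < A → ‖∫ z in strip A B,
      Complex.exp ((-2 * Real.pi * (x * z.1 + y * z.2) : ℝ) * Complex.I) *
        multiplier k l ((k : ℝ) - 1) ((l : ℝ) - 1) a b z.1 z.2‖ ≤ C := by
  have hk0 : (0 : ℝ) < k := by exact_mod_cast hk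
  have hl0 : (0 : ℝ) < l := by exact_mod_cast hl
  set J : ℤˣ → ℤˣ → ℝ → ℂ := fun ε₁ ε₂ => halfFourier
    (profile k ((k : ℝ) - 1) (-(quadSign k l ε₁ ε₂ * a)) (-(quadSign k l ε₁ ε₂ * b))) with hJ
  choose K hK0 hK using fun ε₁ ε₂ => exists_norm_halfFourier_profile_sub_ite_le hk
    (ha.neg_quadSign_mul_mem hk ε₁ ε₂) (hb.neg_quadSign_mul_mem hk ε₁ ε₂)
  obtain ⟨C, hC⟩ := exists_norm_kernel_le (γ := (l : ℝ) / k) (by positivity) J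
    (K := ∑ ε₁, ∑ ε₂, K ε₁ ε₂)
    (fun ε₁ ε₂ => measurable_halfFourier (measurable_profile _ _ _ _))
    (fun ε₁ ε₂ z => (hK ε₁ ε₂ z).trans (mul_le_mul_of_nonneg_right
      ((Finset.single_le_sum (f := fun ε₂ => K ε₁ ε₂) (fun _ _ => hK0 _ _)
        (Finset.mem_univ ε₂)).trans (Finset.single_le_sum (f := fun ε₁ => ∑ ε₂, K ε₁ ε₂)
        (fun _ _ => Finset.sum_nonneg fun _ _ => hK0 _ _) (Finset.mem_univ ε₁))) (by positivity)))
    (by simpa only [hJ, halfFourier_zero, multiplierMean] using hmean)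
  refine ⟨C, fun A B x y hA => ?_⟩
  refine le_trans (le_of_eq ?_) (hC A B x y hA)
  congr 1
  set Θ : ℝ → ℝ → ℂ := fun x' y' => (strip A B).indicator (fun z : ℝ × ℝ =>
    Complex.exp ((-2 * Real.pi * (x * z.1 + y * z.2) : ℝ) * Complex.I)) (x', y') with hΘ
  have hΘm : ∀ z : ℝ × ℝ, Θ z.1 z.2 * multiplier k l ((k : ℝ) - 1) ((l : ℝ) - 1) a b z.1 z.2 =
      (strip A B).indicator (fun z : ℝ × ℝ =>
        Complex.exp ((-2 * Real.pi * (x * z.1 + y * z.2) : ℝ) * Complex.I) *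
        multiplier k l ((k : ℝ) - 1) ((l : ℝ) - 1) a b z.1 z.2) z := fun z => by
    simp only [hΘ, indicator]
    split_ifs <;> simp
  have hint : Integrable fun z : ℝ × ℝ =>
      Θ z.1 z.2 * multiplier k l ((k : ℝ) - 1) ((l : ℝ) - 1) a b z.1 z.2 := by
    simp_rw [hΘm]
    refine IntegrableOn.integrable_indicator ?_ (measurableSet_strip A B)
    refine Integrable.bdd_mul (c := 1) (integrableOn_multiplier_strip hk hl ha hb hA B)
      (by fun_prop) (ae_of_all _ fun z => ?_)
    rw [Complex.norm_exp_ofReal_mul_I]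
  rw [← integral_indicator (measurableSet_strip A B)]
  simp_rw [← hΘm]
  -- For $p=k-1$, $q=l-1$ the homogeneity relation reads $lk+kl=2kl$.
  rw [integral_mul_multiplier hk (by ring) a b hint]
  refine Finset.sum_congr rfl fun ε₁ _ => Finset.sum_congr rfl fun ε₂ _ => ?_
  have hsub : Ioc A B ⊆ Ioi 0 := fun r hr => hA.trans hr.1
  have hind : ∀ r ∈ Ioi (0 : ℝ), r⁻¹ • ∫ t in Ioi (0 : ℝ),
      Θ (((ε₁ : ℤ) : ℝ) * (r ^ ((l : ℝ) / k) * t)) (((ε₂ : ℤ) : ℝ) * r) *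
        profile k ((k : ℝ) - 1) (-(quadSign k l ε₁ ε₂ * a)) (-(quadSign k l ε₁ ε₂ * b)) t =
      (Ioc A B).indicator (fun r => r⁻¹ •
        (Complex.exp ((-2 * Real.pi * y * (((ε₂ : ℤ) : ℝ) * r) : ℝ) * Complex.I) *
        J ε₁ ε₂ (((ε₁ : ℤ) : ℝ) * (x * r ^ ((l : ℝ) / k))))) r := by
    intro r hr
    have hr : 0 < r := hr
    have hmem : ∀ t : ℝ, (((ε₁ : ℤ) : ℝ) * (r ^ ((l : ℝ) / k) * t), ((ε₂ : ℤ) : ℝ) * r) ∈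
        strip A B ↔ r ∈ Ioc A B := fun t => by
      change A < |((ε₂ : ℤ) : ℝ) * r| ∧ |((ε₂ : ℤ) : ℝ) * r| ≤ B ↔ _
      rw [abs_units_mul, abs_of_pos hr, mem_Ioc]
    by_cases hrm : r ∈ Ioc A B
    · rw [indicator_of_mem hrm]
      congr 1
      simp only [hJ, halfFourier]
      rw [← integral_const_mul]
      refine setIntegral_congr_fun measurableSet_Ioi fun t _ => ?_
      simp only [hΘ]
      rw [indicator_of_mem ((hmem t).2 hrm), ← mul_assoc (Complex.exp _) (Complex.exp _),
        ← Complex.exp_add]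
      congr 2
      push_cast
      ring
    · rw [indicator_of_notMem hrm]
      have h0 : ∀ t, Θ (((ε₁ : ℤ) : ℝ) * (r ^ ((l : ℝ) / k) * t)) (((ε₂ : ℤ) : ℝ) * r) = 0 :=
        fun t => indicator_of_notMem (fun h => hrm ((hmem t).1 h)) _
      simp [h0]
  rw [setIntegral_congr_fun measurableSet_Ioi hind, setIntegral_indicator measurableSet_Ioc,
    inter_eq_self_of_subset_right hsub]

/-! ### Bilinear forms with bounded kernels -/

theorem integral_fourier_mul_eq_integral_mul_fourier {f g : Plane → ℂ} (hf : Integrable f)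
    (hg : Integrable g) : ∫ p, 𝓕 f p * g p = ∫ x, f x * 𝓕 g x := by
  have h := VectorFourier.integral_fourierIntegral_smul_eq_flip (L := innerₗ Plane)
    (μ := volume) (ν := volume) Real.continuous_fourierChar continuous_inner hf hg
  rw [flip_innerₗ] at h
  exact h

/-- Moving the Fourier transform twice turns the form into $\iint F(x)\,G'(y)\,\hat m(x+y)$ with
$G'(y)=\overline{G(-y)}$, whose kernel is bounded by `K`. -/
theorem norm_integral_fourier_mul_conj_fourier_mul_le {m : Plane → ℂ} (hm : Integrable m) {K : ℝ}
    (hK : ∀ x, ‖𝓕 m x‖ ≤ K) (F G : 𝓢(Plane, ℂ)) :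
    ‖∫ p, 𝓕 F p * conj (𝓕 G p) * m p‖ ≤ K * (normL1 F * normL1 G) := by
  set G' : Plane → ℂ := fun x => conj (G (-x)) with hG'
  have hG'i : Integrable G' := by
    have h1 : Integrable fun x => G (-x) := G.integrable.comp_neg
    refine h1.congr' ?_ (ae_of_all _ fun x => by simp [hG'])
    exact (Complex.continuous_conj.comp (G.continuous.comp continuous_neg)).aestronglyMeasurable
  have hG'n : ∫ x, ‖G' x‖ = normL1 G := by
    simp only [hG', RCLike.norm_conj, normL1]
    exact integral_neg_eq_self (fun x => ‖G x‖) volume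
  have hconj : ∀ p, conj (𝓕 G p) = 𝓕 G' p := fun p => by
    rw [SchwartzMap.fourier_coe, Real.fourier_eq', Real.fourier_eq', ← integral_conj,
      ← integral_neg_eq_self]
    refine integral_congr_ae (ae_of_all _ fun x => ?_)
    simp only [hG', smul_eq_mul, map_mul, ← Complex.exp_conj, Complex.conj_ofReal, Complex.conj_I,
      inner_neg_left]
    congr 2
    push_cast
    ring
  have hFm : Continuous fun p => 𝓕 G' p := by
    have : (fun p => 𝓕 G' p) = fun p => conj (𝓕 G p) := by
      ext p; rw [hconj]
    rw [this]
    exact Complex.continuous_conj.comp (𝓕 G).continuous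
  have hFb : ∀ p, ‖𝓕 G' p‖ ≤ normL1 G := fun p => by
    rw [← hG'n]
    exact VectorFourier.norm_fourierIntegral_le_integral_norm _ _ _ _ _
  have hGmi : Integrable fun p => 𝓕 G' p * m p :=
    hm.bdd_mul (c := normL1 G) hFm.aestronglyMeasurable (ae_of_all _ hFb)
  have hinner : ∀ x, ‖𝓕 (fun p => 𝓕 G' p * m p) x‖ ≤ K * normL1 G := fun x => by
    set e : Plane → ℂ := fun p => Complex.exp ((-2 * Real.pi * inner ℝ p x : ℝ) * Complex.I) with he
    have hei : Integrable fun p => e p * m p := by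
      refine hm.bdd_mul (c := 1) ?_ (ae_of_all _ fun p => ?_)
      · have : Continuous e := by simp only [he]; fun_prop
        exact this.aestronglyMeasurable
      · simp only [he]
        rw [Complex.norm_exp_ofReal_mul_I]
    have h1 : 𝓕 (fun p => 𝓕 G' p * m p) x = ∫ p, 𝓕 G' p * (e p * m p) := by
      rw [Real.fourier_eq']
      refine integral_congr_ae (ae_of_all _ fun p => ?_)
      simp only [he, smul_eq_mul]
      ring
    -- A modulation becomes a translation of the Fourier transform.
    have h2 : ∀ y, 𝓕 (fun p => e p * m p) y = 𝓕 m (x + y) := fun y => by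
      rw [Real.fourier_eq', Real.fourier_eq']
      refine integral_congr_ae (ae_of_all _ fun p => ?_)
      simp only [he, smul_eq_mul]
      rw [← mul_assoc, ← Complex.exp_add, inner_add_right]
      congr 2
      push_cast
      ring
    rw [h1, integral_fourier_mul_eq_integral_mul_fourier hG'i hei]
    simp_rw [h2]
    refine (norm_integral_le_of_norm_le (hG'i.norm.const_mul K) (ae_of_all _ fun y => ?_)).trans
      (le_of_eq ?_)
    · rw [norm_mul, mul_comm]
      exact mul_le_mul_of_nonneg_right (hK _) (norm_nonneg _)
    · rw [integral_const_mul, hG'n]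
  have h3 : ∫ p, 𝓕 F p * conj (𝓕 G p) * m p = ∫ x, F x * 𝓕 (fun p => 𝓕 G' p * m p) x := by
    rw [← integral_fourier_mul_eq_integral_mul_fourier F.integrable hGmi]
    refine integral_congr_ae (ae_of_all _ fun p => ?_)
    simp only [hconj, mul_assoc]
    rfl
  rw [h3]
  refine (norm_integral_le_of_norm_le (F.integrable.norm.const_mul (K * normL1 G))
    (ae_of_all _ fun x => ?_)).trans (le_of_eq ?_)
  · rw [norm_mul, mul_comm]
    exact mul_le_mul_of_nonneg_right (hinner x) (norm_nonneg _)
  · rw [integral_const_mul]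
    simp only [normL1]
    ring

/-! ### Sufficiency -/

theorem integrable_sobolevInner {k l : ℕ} (hk : 1 ≤ k) (hl : 1 ≤ l) (u v : 𝓢(Plane, ℂ)) :
    Integrable fun p : Plane =>
      u p * conj (v p) * ((|p 0| ^ ((k : ℝ) - 1) * |p 1| ^ ((l : ℝ) - 1) : ℝ) : ℂ) := by
  have ek : (k : ℝ) - 1 = ((k - 1 : ℕ) : ℝ) := by push_cast [hk]; ring
  have el : (l : ℝ) - 1 = ((l - 1 : ℕ) : ℝ) := by push_cast [hl]; ring
  simp_rw [ek, el, Real.rpow_natCast]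
  obtain ⟨C, -, hC⟩ := u.decay ((k - 1) + (l - 1)) 0
  have hv : Integrable fun p => conj (v p) :=
    v.integrable.congr' (Complex.continuous_conj.comp v.continuous).aestronglyMeasurable
      (ae_of_all _ fun x => by simp)
  have h := hv.bdd_mul (c := C)
    (f := fun p : Plane => u p * ((|p 0| ^ (k - 1) * |p 1| ^ (l - 1) : ℝ) : ℂ)) ?_
    (ae_of_all _ fun p => ?_)
  · refine h.congr (ae_of_all _ fun p => ?_)
    simp only
    ring
  · refine Continuous.aestronglyMeasurable ?_
    exact u.continuous.mul (Complex.continuous_ofReal.comp (by fun_prop))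
  · have h1 := hC p
    rw [norm_iteratedFDeriv_zero] at h1
    refine le_trans ?_ h1
    rw [norm_mul, Complex.norm_real, Real.norm_of_nonneg (by positivity), mul_comm, pow_add]
    have hp : ∀ j : Fin 2, |p j| ≤ ‖p‖ := fun j => by
      simpa using PiLp.norm_apply_le p j
    gcongr
    · exact hp 0
    · exact hp 1

/-- The plane is exhausted by strips up to the null set $\eta=0$. The original integrand is
integrable, so the truncated forms converge, and each obeys the kernel bound with the same constant.
-/
theorem BE.of_multiplierMean_eq_zero {k l : ℕ} (hk : 1 ≤ k) (hl : 1 ≤ l) {σ τ : ℂ}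
    (hell : Elliptic k l σ τ)
    (hmean : multiplierMean k l ((k : ℝ) - 1) (tauOne k l τ) (sigmaOne k l σ) = 0) :
    BE k l (((k : ℝ) - 1) / 2) (((l : ℝ) - 1) / 2) σ τ := by
  obtain ⟨hσ, hτ⟩ := hell
  obtain ⟨C, hC⟩ := exists_norm_integral_strip_le hk hl hτ hσ hmean
  set a := tauOne k l τ with ha
  set b := sigmaOne k l σ with hb
  set c : ℝ := ((2 * Real.pi) ^ (2 * k))⁻¹ with hc
  have hc0 : 0 < c := by positivity
  refine ⟨c * C, fun f g => ?_⟩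
  set F := diffOp k l τ f with hF
  set G := diffOp k l σ g with hG
  set w : Plane → ℂ := fun p =>
    𝓕 f p * conj (𝓕 g p) * ((|p 0| ^ ((k : ℝ) - 1) * |p 1| ^ ((l : ℝ) - 1) : ℝ) : ℂ) with hw
  have hwi : Integrable w := integrable_sobolevInner hk hl (𝓕 f) (𝓕 g)
  have hS : sobolevInner (((k : ℝ) - 1) / 2) (((l : ℝ) - 1) / 2) f g = ∫ p, w p := by
    simp only [sobolevInner, hw, mul_div_cancel₀ _ (two_ne_zero' ℝ)]
  set S : ℕ → Set Plane := fun n => {p | (p 0, p 1) ∈ strip (1 / ((n : ℝ) + 1)) n} with hSdef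
  have hSm : ∀ n, MeasurableSet (S n) := fun n =>
    measurePreserving_planeToProd.measurable (measurableSet_strip _ _)
  have hne : ∀ᵐ p : Plane, p 1 ≠ 0 := by
    have h1 : ∀ᵐ y : ℝ, y ≠ 0 := by simp [ae_iff]
    have h2 : ∀ᵐ z : ℝ × ℝ, z.2 ≠ 0 := Measure.quasiMeasurePreserving_snd.ae h1
    exact measurePreserving_planeToProd.quasiMeasurePreserving.ae h2
  have hcover : AECover volume atTop S := by
    refine ⟨?_, hSm⟩
    filter_upwards [hne] with p hp
    have hp0 : 0 < |p 1| := abs_pos.2 hp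
    have h1 := (tendsto_one_div_add_atTop_nhds_zero_nat (𝕜 := ℝ)).eventually_lt_const hp0
    have h2 := tendsto_natCast_atTop_atTop (R := ℝ) |>.eventually_ge_atTop |p 1|
    filter_upwards [h1, h2] with n h1 h2
    exact ⟨h1, h2⟩
  have hlim := hcover.integral_tendsto_of_countably_generated hwi
  rw [hS]
  refine le_of_tendsto hlim.norm (Eventually.of_forall fun n => ?_)
  have hA : (0 : ℝ) < 1 / ((n : ℝ) + 1) := by positivity
  set m₀ : ℝ × ℝ → ℂ := (strip (1 / ((n : ℝ) + 1)) n).indicator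
    fun z => multiplier k l ((k : ℝ) - 1) ((l : ℝ) - 1) a b z.1 z.2 with hm₀
  set m : Plane → ℂ := fun p => m₀ (p 0, p 1) with hm
  have hmi : Integrable m := integrable_plane.2
    ((integrableOn_multiplier_strip hk hl hτ hσ hA n).integrable_indicator (measurableSet_strip _ _))
  have hmF : ∀ x, ‖𝓕 m x‖ ≤ C := fun x => by
    have h1 : 𝓕 m x = ∫ z in strip (1 / ((n : ℝ) + 1)) n,
        Complex.exp ((-2 * Real.pi * (x 0 * z.1 + x 1 * z.2) : ℝ) * Complex.I) *
        multiplier k l ((k : ℝ) - 1) ((l : ℝ) - 1) a b z.1 z.2 := by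
      rw [Real.fourier_eq', ← integral_indicator (measurableSet_strip _ _), ← integral_plane]
      refine integral_congr_ae (ae_of_all _ fun p => ?_)
      simp only [hm, hm₀, indicator, smul_eq_mul, inner_plane]
      split_ifs
      · rw [mul_comm (x 0), mul_comm (x 1)]
      · simp
    rw [h1]
    exact hC _ _ _ _ hA
  have hpt : ∫ p in S n, w p = (c : ℂ) * ∫ p, 𝓕 F p * conj (𝓕 G p) * m p := by
    rw [← integral_indicator (hSm n), ← integral_const_mul]
    refine integral_congr_ae (ae_of_all _ fun p => ?_)
    by_cases hp : p ∈ S n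
    · have hp' : (p 0, p 1) ∈ strip (1 / ((n : ℝ) + 1)) n := hp
      have hp1 : ¬(p 0 = 0 ∧ p 1 = 0) := fun h0 => by
        have h4 : 1 / ((n : ℝ) + 1) < |p 1| := hp'.1
        rw [h0.2, abs_zero] at h4
        linarith
      have h1 := symbol_mul_conj_symbol k l σ τ (p 0) (p 1)
      have h2 : ((p 0 : ℂ) ^ k - a * (p 1 : ℂ) ^ l) ≠ 0 := fun h0 => hp1 (hτ _ _ h0)
      have h3 : ((p 0 : ℂ) ^ k - b * (p 1 : ℂ) ^ l) ≠ 0 := fun h0 => hp1 (hσ _ _ h0)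
      rw [← ha, ← hb] at h1
      rw [indicator_of_mem hp]
      simp only [hm, hm₀]
      rw [indicator_of_mem hp', hF, hG, fourier_diffOp, fourier_diffOp, map_mul,
        mul_mul_mul_comm, h1, multiplier, hc, mul_inv]
      simp only [hw]
      generalize ((p 0 : ℂ) ^ k - a * (p 1 : ℂ) ^ l) = U at h2 ⊢
      generalize ((p 0 : ℂ) ^ k - b * (p 1 : ℂ) ^ l) = V at h3 ⊢
      push_cast
      have hπ : (Real.pi : ℂ) ≠ 0 := by exact_mod_cast Real.pi_ne_zero
      field_simp
    · rw [indicator_of_notMem hp]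
      simp only [hm, hm₀]
      rw [indicator_of_notMem (show (p 0, p 1) ∉ strip (1 / ((n : ℝ) + 1)) n from hp), mul_zero,
        mul_zero]
  rw [hpt, norm_mul, Complex.norm_real, Real.norm_of_nonneg hc0.le, mul_assoc]
  exact mul_le_mul_of_nonneg_left
    (norm_integral_fourier_mul_conj_fourier_mul_le hmi hmF F G) hc0.le

end BilinearEmbedding

theorem theorem1 (k l : ℕ) (hk : 1 ≤ k) (hl : 1 ≤ l) (α β : ℝ) (hα : 0 ≤ α) (hβ : 0 ≤ β)
    (σ τ : ℂ) (hσ : σ ≠ 0) (hτ : τ ≠ 0) (hell : BilinearEmbedding.Elliptic k l σ τ) :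
    BilinearEmbedding.BE k l α β σ τ ↔
      (Odd k ∨ Odd l) ∧ α = ((k : ℝ) - 1) / 2 ∧ β = ((l : ℝ) - 1) / 2 ∧
        ((0 < (BilinearEmbedding.sigmaOne k l σ).im ∧ 0 < (BilinearEmbedding.tauOne k l τ).im) ∨
          ((BilinearEmbedding.sigmaOne k l σ).im < 0 ∧
            (BilinearEmbedding.tauOne k l τ).im < 0)) := by
  have hk0 : (0 : ℝ) < k := by exact_mod_cast hk
  have hl0 : (0 : ℝ) < l := by exact_mod_cast hl
  constructor
  · intro h
    have hsc := h.homogeneity hα hβ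
    -- Since $\beta\ge0$, the second term of the homogeneity relation is positive, whence
    -- $l(2\alpha+1)<2kl$.
    have hα1 : 2 * α + 1 < 2 * k := by
      by_contra hge
      push Not at hge
      have h1 : 0 < (k : ℝ) * (2 * β + 1) := by positivity
      nlinarith
    obtain ⟨hodd, hp, hs⟩ := (BilinearEmbedding.multiplierMean_eq_zero_iff hk (by linarith) hα1
      hell.2 hell.1).1 (h.multiplierMean_eq_zero hk hl hα hβ hell hsc hα1)
    refine ⟨hodd, by linarith, ?_, ?_⟩
    -- Once $2\alpha=k-1$, the homogeneity relation determines $\beta$.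
    · rw [hp] at hsc
      have h1 : (k : ℝ) * (2 * β + 1) = k * l := by linarith
      have h2 := mul_left_cancel₀ hk0.ne' h1
      linarith
    · tauto
  · rintro ⟨hodd, rfl, rfl, hs⟩
    refine BilinearEmbedding.BE.of_multiplierMean_eq_zero hk hl hell ?_
    exact (BilinearEmbedding.multiplierMean_eq_zero_iff hk (by linarith) (by linarith)
      hell.2 hell.1).2 ⟨hodd, rfl, by tauto⟩
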